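/- **Setting.** Let $M$ be a finite Markov decision process with state set $S$, action set $\mathcal A^{\mathrm{all}}$, available actions $\mathcal A(s)$, transition function $P$, cost $\mathcal C(s,a)\in[0,c_{\max}]$ for available pairs ($c_{\max}>0$), and a set $S^*$ of accepting states; a run satisfies the specification $\varphi$ iff it visits some state of $S^*$ infinitely often. Every non-zero transition probability of an available pair is at least $\beta>0$. For a stationary randomized policy $\pi$, the gain $g_\pi(s)$ is the long-run average expected cost from $s$. An end component $(A,\mathcal A_A)$ is a nonempty set of states $A$ with nonempty sets $\mathcal A_A(s)\subseteq\mathcal A(s)$, $s\in A$, closed under these actions and strongly connected through them; an AMEC is a maximal end component with $A\cap S^*\neq\emptyset$. Write $\Pi_A$ for the deterministic policies of $(A,\mathcal A_A)$; the $\eta$-greedy version $d_\eta$ of $d\in\Pi_A$ plays $d(s)$ with probability $1-\eta$ and a uniformly random action of $\mathcal A_A(s)$ with probability $\eta$. For a matrix $B$ let $\Delta(B)=\frac12\max_{i,j}\sum_k|B_{ik}-B_{jk}|$. For $\alpha\in(0,1)$, dynamics $Q$ and a policy $\pi$ let $Q_{\alpha,\pi}=\alpha Q_\pi+(1-\alpha)I$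 on $A$, and set $$m(Q)=\max_{d\in\Pi_A}\min\{m\ge1:\Delta(Q_{\alpha,d_\eta}^m)<1\},\qquad m=m(P),\qquad \bar\Delta_A=\max_{d\in\Pi_A}\Delta(P_{\alpha,d_\eta}^{m}).$$ **Samples.** For each available $(s,a)$ there is an i.i.d. sequence of samples from $P(s,a,\cdot)$, and $\widehat P_n$ is the empirical frequency of the first $n$ of them. For $\delta\in(0,1)$ put $\xi(n)=\frac{\log(4n^2|S|^2|\mathcal A^{\mathrm{all}}|/\delta)}{n-1}$ and $\psi_{sas'}(n)=\sqrt{2\widehat P_n(s,a,s')(1-\widehat P_n(s,a,s'))\,\xi(n)}+\frac73\xi(n)$. Let $\mathcal E$ be the event that $|P(s,a,s')-\widehat P_n(s,a,s')|\le\psi_{sas'}(n)$ for all available $(s,a)$, all $s'$ and all $n>1$. A distribution $p$ on $S$ is plausible for $(s,a)$ at $n$ if, for each $s'$: $p(s')=\widehat P_n(s,a,s')$ when the latter is $0$ or $1$, and otherwise $p(s')\in[\beta,1-\beta]$ and $|p(s')-\widehat P_n(s,a,s')|\le\psi_{sas'}(n)$. Let $\psi^{-1}(\rho)=\lceil\frac2{\zeta^2}\log\frac{16|S|^2|\mathcal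 A^{\mathrm{all}}|}{\zeta^4\delta}\rceil+3$, where $\zeta>0$ solves $\frac{\zeta}{\sqrt2}+\frac73\zeta^2=\rho$. Initially $n_0\ge\frac5\beta\log\frac{100|S|^2|\mathcal A^{\mathrm{all}}|}{\beta^2\delta}$ samples of each pair are available (support verification). **Algorithm** $\mathtt{PlanRecurrent}$, with error $0<\epsilon\le c_{\max}$ ($\epsilon=\epsilon_{\mathtt{PR}}$), inside an AMEC $(A,\mathcal A_A)$. Start with $\rho=1$ and repeat: (1) $\rho\leftarrow\rho/2$; (2) sample until $n=\max(n_0,\psi^{-1}(\rho))$ samples of each $(s,a)\in(A,\mathcal A_A)$ are available; (3) run value iteration from $0$ with $$\mathcal Lv(s)=\min_{a\in\mathcal A_A(s)}\Bigl(\mathcal C(s,a)+\alpha\min_{p\text{ plausible}}p\cdot v\Bigr)+(1-\alpha)v(s)$$ until two successive iterates $v$, $v'=\mathcal Lv$ satisfy $\max(v'-v)-\min(v'-v)<\frac{2\epsilon}3$, and let $\widetilde P$ attain the inner minima at $v'$; (4) let $\pi$ be the $\eta$-greedy version of a greedy policy with respect to $v'$ (minimizers of the bracket at $v'$; ties are broken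 arbitrarily); (5) stop and return $\pi$ if, with $\widetilde m=m(\widetilde P)$, $$\rho\le\frac1{\alpha|A|}\Bigl(\Bigl(\frac{\epsilon\,(1-\Delta(\widetilde P_{\alpha,\pi}^{\widetilde m}))}{3c_{\max}}+1\Bigr)^{1/\widetilde m}-1\Bigr).$$ **Claim.** There is a universal constant $K>0$, and for every such $M$, AMEC, $c_{\max},\beta,\alpha,\epsilon$ there is $\eta^*\in(0,1]$, such that for all $\eta\in(0,\eta^*]$, $\delta\in(0,1)$ and $n_0$ as above the following holds. One has $\bar\Delta_A<1$, a gain-optimal policy of $(A,\mathcal A_A)$ (among its stationary policies) exists, $\mathbb P(\mathcal E)\ge1-\delta$, and, almost surely on $\mathcal E$, for every choice of the tie-breaking: * every repeat can be carried out (in particular value iteration terminates), and, with $Y=\dfrac{m|A|c_{\max}}{\epsilon(1-\bar\Delta_A)}$, the algorithm stops after at most $\lceil\log_2(6Y)\rceil$ repeats (halvings of $\rho$); * at most $K\,Y^2\bigl(1+\log\frac{|S|^2|\mathcal A^{\mathrm{all}}|\,Y}{\delta}\bigr)=\tilde{\mathcal O}(Y^2)$ new samples are collected for each $(s,a)\in(A,\mathcal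 A_A)$; * the returned $\eta$-greedy policy $\pi$ satisfies $|g_\pi(s)-g_{\pi_A}(s)|<\epsilon$ for every gain-optimal policy $\pi_A$ of $(A,\mathcal A_A)$ and every $s\in A$, and $\mathbb P[\pi\models\varphi\mid s_0=s]=1$ for every $s\in A$. For $m=1$ (the simplifying convention $m=1$) one has $Y=\frac{|A|c_{\max}}{\epsilon(1-\bar\Delta_A)}$. -/

import Mathlib

open MeasureTheory ProbabilityTheory Filter

noncomputable section

namespace PlanRec

/-- A finite Markov decision process with available actions, costs, and a set `acc` of accepting
states. A run satisfies the specification when it visits an accepting state infinitely often. -/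
structure MDP (S Act : Type*) where
  avail : S → Finset Act
  P : S → Act → PMF S
  cost : S → Act → ℝ
  acc : Set S

namespace MDP

variable {S Act : Type*} (M : MDP S Act)

/-- Transition probability as a real number. -/
def prob (s : S) (a : Act) (s' : S) : ℝ := (M.P s a s').toReal

/-- End components: a nonempty set of states with nonempty sets of available actions, closed under
these actions and strongly connected through them. -/
structure EndComponent where
  states : Finset S
  acts : S → Finset Act
  nonempty : states.Nonempty
  acts_nonempty : ∀ s ∈ states, (acts s).Nonempty
  acts_avail : ∀ s ∈ states, acts s ⊆ M.avail s
  closed : ∀ s ∈ states, ∀ a ∈ acts s, ∀ s', 0 < M.prob s a s' → s' ∈ states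
  connected : ∀ s ∈ states, ∀ s' ∈ states,
    Relation.ReflTransGen (fun x y => x ∈ states ∧ ∃ a ∈ acts x, 0 < M.prob x a y) s s'

/-- Containment of end components. -/
def EndComponent.Sub {M : MDP S Act} (E F : M.EndComponent) : Prop :=
  E.states ⊆ F.states ∧ ∀ s ∈ E.states, E.acts s ⊆ F.acts s

/-- Accepting maximal end components. -/
def EndComponent.IsAMEC {M : MDP S Act} (E : M.EndComponent) : Prop :=
  (∃ s ∈ E.states, s ∈ M.acc) ∧ ∀ F : M.EndComponent, E.Sub F → F.Sub E

section Trajectories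

variable [Countable S] [Countable Act] [MeasurableSpace S] [MeasurableSingletonClass S]
  [MeasurableSpace Act] [MeasurableSingletonClass Act]

/-- One step of the chain of state-action pairs under the stationary policy `π`: the next state is
drawn from `P s a`, the next action from `π`. -/
def stepMeasure (π : S → PMF Act) (x : S × Act) : Measure (S × Act) :=
  ((M.P x.1 x.2).bind fun s' => (π s').map fun a' => (s', a')).toMeasure

/-- The transition kernel at time `n`, given the history. -/
def stepKernel (π : S → PMF Act) (n : ℕ) :
    Kernel ((i : Finset.Iic n) → (fun _ : ℕ => S × Act) i) (S × Act) :=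
  (Kernel.ofFunOfCountable (M.stepMeasure π)).comap
    (fun h => h ⟨n, Finset.mem_Iic.2 le_rfl⟩) (measurable_pi_apply _)

instance (π : S → PMF Act) (n : ℕ) : IsMarkovKernel (M.stepKernel π n) := by
  have : IsMarkovKernel (Kernel.ofFunOfCountable (M.stepMeasure π)) :=
    ⟨fun x => by
      change IsProbabilityMeasure (M.stepMeasure π x)
      unfold stepMeasure
      infer_instance⟩
  unfold stepKernel
  infer_instance

/-- The law of the trajectory `(s₀, a₀), (s₁, a₁), …` under `π`, started at `s₀ = s`. -/
def pathMeasure (π : S → PMF Act) (s : S) : Measure (ℕ → S × Act) :=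
  Kernel.trajMeasure (X := fun _ => S × Act) ((π s).map fun a => (s, a)).toMeasure (M.stepKernel π)

/-- The gain (long-run average expected cost) of `π` from `s`. For a stationary policy in a finite
process the averages converge, so that the upper limit is the limit. -/
def gain (π : S → PMF Act) (s : S) : ℝ :=
  limsup (fun T : ℕ =>
    (∫ τ, ∑ t ∈ Finset.range T, M.cost (τ t).1 (τ t).2 ∂(M.pathMeasure π s)) / T) atTop

/-- The probability that the run of `π` from `s` satisfies the specification. -/
def satProb (π : S → PMF Act) (s : S) : ENNReal :=
  M.pathMeasure π s {τ | ∃ s' ∈ M.acc, ∃ᶠ t in atTop, (τ t).1 = s'}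

variable {M}

/-- `π` is a (stationary, randomized) policy of the end component. -/
def EndComponent.IsPolicy (E : M.EndComponent) (π : S → PMF Act) : Prop :=
  ∀ s ∈ E.states, ∀ a, π s a ≠ 0 → a ∈ E.acts s

/-- `π` is a gain-optimal policy of the end component. -/
def EndComponent.IsGainOptimal (E : M.EndComponent) (π : S → PMF Act) : Prop :=
  E.IsPolicy π ∧ ∀ π', E.IsPolicy π' → ∀ s ∈ E.states, M.gain π s ≤ M.gain π' s

end Trajectories

/-- Deterministic policies of an end component. -/
abbrev EndComponent.DetPolicy {M : MDP S Act} (E : M.EndComponent) : Type _ :=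
  (s : E.states) → {a // a ∈ E.acts s}

open Classical in
/-- Action probabilities of the `η`-greedy version of a deterministic policy: with probability `η`
an action is drawn uniformly from the actions of the end component. -/
def EndComponent.etaWeight {M : MDP S Act} (E : M.EndComponent) (η : ℝ) (d : E.DetPolicy)
    (s : E.states) (a : Act) : ℝ :=
  (1 - η) * (if a = d s then 1 else 0) + η * (if a ∈ E.acts s then ((E.acts s).card : ℝ)⁻¹ else 0)

/-- The matrix `α Q_w + (1 - α) I` on the states of the end component, for action probabilities `w`
and dynamics `Q`. -/
def EndComponent.chain {M : MDP S Act} [Fintype Act] (E : M.EndComponent) (α : ℝ)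
    (Q : S → Act → S → ℝ) (w : E.states → Act → ℝ) : Matrix E.states E.states ℝ :=
  open Classical in
  α • (Matrix.of fun (s s' : E.states) => ∑ a, w s a * Q s a s') + (1 - α) • (1 : Matrix E.states E.states ℝ)

end MDP

/-- The coefficient of ergodicity `Δ(M) = ½ max_{i,j} ∑ₖ |M_{ik} - M_{jk}|`. -/
def ergCoeff {ι : Type*} [Fintype ι] (M : Matrix ι ι ℝ) : ℝ :=
  (1 / 2) * ⨆ ij : ι × ι, ∑ k, |M ij.1 k - M ij.2 k|

namespace MDP.EndComponent

variable {S Act : Type*} [Fintype Act] {M : MDP S Act} (E : M.EndComponent)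

open Classical in
/-- `Δ((α Q_{d_η} + (1 - α) I)^m)`, where `d_η` is the `η`-greedy version of `d`. -/
def erg (α η : ℝ) (Q : S → Act → S → ℝ) (m : ℕ) (d : E.DetPolicy) : ℝ :=
  ergCoeff (E.chain α Q (E.etaWeight η d) ^ m)

/-- `max_d min {m ≥ 1 : Δ((α Q_{d_η} + (1 - α) I)^m) < 1}`, over the deterministic policies `d`. -/
def mixExp (α η : ℝ) (Q : S → Act → S → ℝ) : ℕ :=
  ⨆ d : E.DetPolicy, sInf {m : ℕ | 1 ≤ m ∧ E.erg α η Q m d < 1}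

/-- The worst-case coefficient of ergodicity `Δ̄_A` of the end component (for the true dynamics). -/
def ergBar (α η : ℝ) : ℝ :=
  ⨆ d : E.DetPolicy, E.erg α η M.prob (E.mixExp α η M.prob) d

end MDP.EndComponent

section Sampling

variable {S Act : Type*} [Fintype S] [Fintype Act]

open Classical in
/-- The empirical transition function of the first `n` samples. -/
def empirical (x : S → Act → ℕ → S) (n : ℕ) (s : S) (a : Act) (s' : S) : ℝ :=
  (((Finset.range n).filter fun i => x s a i = s').card : ℝ) / n

variable (S Act) in
/-- `ξ(n) = log(4 n² |S|² |Act| / δ) / (n - 1)`. -/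
def xi (δ : ℝ) (n : ℕ) : ℝ :=
  Real.log (4 * (n : ℝ) ^ 2 * (Fintype.card S : ℝ) ^ 2 * Fintype.card Act / δ) / ((n : ℝ) - 1)

variable (S Act) in
/-- The confidence width `ψ_{sas'}(n)` at empirical frequency `q`. -/
def psi (δ : ℝ) (n : ℕ) (q : ℝ) : ℝ :=
  Real.sqrt (2 * (q * (1 - q)) * xi S Act δ n) + 7 / 3 * xi S Act δ n

/-- The positive root `ζ` of `ζ / √2 + 7 ζ² / 3 = ρ`. -/
def zeta (ρ : ℝ) : ℝ :=
  (-(3 / (7 * Real.sqrt 2)) + Real.sqrt ((3 / (7 * Real.sqrt 2)) ^ 2 + 12 / 7 * ρ)) / 2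

variable (S Act) in
/-- The number of samples `ψ⁻¹(ρ)` that makes the confidence width smaller than `ρ`. -/
def psiInv (δ ρ : ℝ) : ℕ :=
  ⌈2 / zeta ρ ^ 2 *
    Real.log (16 * (Fintype.card S : ℝ) ^ 2 * Fintype.card Act / (zeta ρ ^ 4 * δ))⌉₊ + 3

variable (S Act) in
/-- The number of samples per state-action pair that the support verification needs. -/
def phiSupport (β δ : ℝ) : ℝ :=
  5 / β * Real.log (100 * (Fintype.card S : ℝ) ^ 2 * Fintype.card Act / (β ^ 2 * δ))

/-- The samples `x` for which, for every available pair and every `n > 1`, the empirical transition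
probabilities are within the confidence width of the true ones. -/
def MDP.Concentrated (M : MDP S Act) (δ : ℝ) (x : S → Act → ℕ → S) : Prop :=
  ∀ s, ∀ a ∈ M.avail s, ∀ s', ∀ n : ℕ, 1 < n →
    |M.prob s a s' - empirical x n s a s'| ≤ psi S Act δ n (empirical x n s a s')

variable (Act) in
/-- Plausible next-state distributions, given the empirical one `q` of `n` samples. -/
def plausible (β δ : ℝ) (n : ℕ) (q : S → ℝ) : Set (S → ℝ) :=
  {p | p ∈ stdSimplex ℝ S ∧ ∀ s', (q s' = 0 → p s' = 0) ∧ (q s' = 1 → p s' = 1) ∧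
    (q s' ≠ 0 → q s' ≠ 1 →
      |p s' - q s'| ≤ psi S Act δ n (q s') ∧ p s' ∈ Set.Icc β (1 - β))}

end Sampling

namespace MDP.EndComponent

variable {S Act : Type*} [Fintype S] [Fintype Act] {M : MDP S Act} (E : M.EndComponent)

/-- `p · v` for a vector `v` on the states of the end component. -/
def pair (p : S → ℝ) (v : E.states → ℝ) : ℝ := ∑ s' : E.states, p s' * v s'

/-- The optimistic action value `C(s,a) + α min_p p · v`, `p` ranging over the plausible
distributions. -/
def qValue (α β δ : ℝ) (n : ℕ) (q : S → Act → S → ℝ) (v : E.states → ℝ) (s : E.states)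
    (a : Act) : ℝ :=
  M.cost s a + α * sInf ((fun p => E.pair p v) '' plausible Act β δ n (q s a))

/-- The optimistic average-cost Bellman operator with aperiodicity coefficient `α`. -/
def bellman (α β δ : ℝ) (n : ℕ) (q : S → Act → S → ℝ) (v : E.states → ℝ) : E.states → ℝ :=
  fun s => (⨅ a : {a // a ∈ E.acts s}, E.qValue α β δ n q v s a) + (1 - α) * v s

/-- Value iteration from `0`. -/
def valueIter (α β δ : ℝ) (n : ℕ) (q : S → Act → S → ℝ) (j : ℕ) : E.states → ℝ :=
  (E.bellman α β δ n q)^[j] 0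

/-- The span distance `max (v' - v) - min (v' - v)`. -/
def spanDist (v' v : E.states → ℝ) : ℝ := (⨆ s, (v' s - v s)) - ⨅ s, (v' s - v s)

/-- The data computed in one repeat of the algorithm: the last two value iterates, the optimistic
dynamics, the greedy policy and the `η`-greedy policy. -/
structure Pass where
  v : E.states → ℝ
  v' : E.states → ℝ
  dyn : S → Act → S → ℝ
  greedy : E.DetPolicy
  policy : S → PMF Act

/-- `R` is a possible result of one repeat, for `n` samples with empirical frequencies `q`: value
iteration is run until the span distance of successive iterates drops below `2 ε / 3`, `dyn` attains
the inner minima at `v'`, `greedy` is greedy with respect to `v'` (ties are broken arbitrarily), and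
`policy` is on the end component the `η`-greedy version of `greedy`. -/
structure IsPass (α β δ η ε : ℝ) (n : ℕ) (q : S → Act → S → ℝ) (R : E.Pass) : Prop where
  iterates : ∃ j, R.v = E.valueIter α β δ n q j ∧ R.v' = E.valueIter α β δ n q (j + 1) ∧
    E.spanDist R.v' R.v < 2 * ε / 3 ∧
    ∀ i < j, 2 * ε / 3 ≤ E.spanDist (E.valueIter α β δ n q (i + 1)) (E.valueIter α β δ n q i)
  optimistic : ∀ s : E.states, ∀ a ∈ E.acts s, R.dyn s a ∈ plausible Act β δ n (q s a) ∧
    ∀ p ∈ plausible Act β δ n (q s a), E.pair (R.dyn s a) R.v' ≤ E.pair p R.v'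
  greedy_le : ∀ s : E.states, ∀ a ∈ E.acts s,
    E.qValue α β δ n q R.v' s (R.greedy s) ≤ E.qValue α β δ n q R.v' s a
  policy_eq : ∀ (s : E.states) (a : Act), (R.policy s a).toReal = E.etaWeight η R.greedy s a

/-- The stopping test at accuracy `ρ`:
`ρ ≤ (((ε/3) (1 - Δ(P̃_{α,π}^m)) / c_max + 1)^(1/m) - 1) / (α |A|)`, where `P̃` is the optimistic
dynamics, `π` the `η`-greedy policy, and `m` the exponent `mixExp` of `P̃`. -/
def StopTest (α η ε cmax ρ : ℝ) (R : E.Pass) : Prop :=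
  let m := E.mixExp α η R.dyn
  ρ ≤ 1 / (α * E.states.card) *
    ((ε / 3 * (1 - E.erg α η R.dyn m R.greedy) / cmax + 1) ^ (1 / (m : ℝ)) - 1)

end MDP.EndComponent

/-- The accuracy in the `k`-th repeat: it starts at `1` and every repeat begins by halving it. -/
def rho (k : ℕ) : ℝ := (1 / 2) ^ k

/-- The number of samples per state-action pair in the data set in the `k`-th repeat, if `n₀` were
there before: the data set is filled up to `ψ⁻¹(ρ_k)`. -/
def sampleSize (S Act : Type*) [Fintype S] [Fintype Act] (δ : ℝ) (n₀ k : ℕ) : ℕ :=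
  max n₀ (psiInv S Act δ (rho k))

namespace MDP.EndComponent

variable {S Act : Type*} [Fintype S] [Fintype Act] {M : MDP S Act} (E : M.EndComponent)

/-- `R` is a possible result of the `k`-th repeat of the algorithm on the samples `x`. -/
def IsRepeat (α β δ η ε : ℝ) (n₀ : ℕ) (x : S → Act → ℕ → S) (k : ℕ) (R : E.Pass) : Prop :=
  E.IsPass α β δ η ε (sampleSize S Act δ n₀ k) (empirical x (sampleSize S Act δ n₀ k)) R

/-- The quantity `m |A| c_max / (ε (1 - Δ̄_A))`. -/
def complexity (α η ε cmax : ℝ) : ℝ :=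
  E.mixExp α η M.prob * E.states.card * cmax / (ε * (1 - E.ergBar α η))

end MDP.EndComponent

end PlanRec

end

set_option linter.unusedSectionVars false

/-! Gains are never computed; they are enclosed by Poisson inequalities. If some `h` satisfies `G ≤
c_π + P_π h - h` throughout the component, telescoping gives `G ≤ g_π`, and likewise from above
(`gain_mem_Icc`). On the concentration event the true dynamics are plausible (`prob_mem_plausible`),
so an optimistic Bellman update lies below one true step of any policy, and `min (v' - v)` lies
below every gain (`le_gain_of_isBellman`). Value iteration stops with span below `2ε/3`, so the
returned policy may exceed `max (v' - v)` by `ε/3`.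

In the optimistic dynamics, one step of the `η`-greedy policy adds to `v'` at most `max (v' - v)`
plus a term of order `η` (`step_le`). Changing to the true dynamics with `v'` itself would cost the
span of `v'`, which the stopping test does not control. An approximate Poisson solution `h` of the
optimistic chain is used instead. Its oscillation is at most `m c_max / (1 - Δ)`
(`exists_approx_poisson`), and its level obeys the same upper bound (`poisson_bounds_le`). Changing
the dynamics then costs half the row distance times this oscillation, which the stopping test bounds
through Bernoulli's inequality. The confidence widths are in fact at most `19/20 ρ`, and the `ε/60`
saved pays for `η` and for the approximation.

The test succeeds once `6 Y ρ ≤ 1` (`stopTest_of_le`): plausible dynamics have the true support, so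
`m` is the same for both, and `Δ` of the `m`-th power moves by at most a multiple of `ρ`. Value
iteration terminates because spans stay bounded and the chains are lazy (`increments_converge`). The
span bound is uniform over all samples, so `η*` can be fixed in advance.

The concentration event comes from a Chernoff bound and an estimate of the binary divergence with
the variance at the empirical frequency (`sq_div_le_kl`). The specification holds almost surely
because the `η`-greedy policy uses every action of a strongly connected component. -/

namespace PlanRec.MDP

/-! ### Expectations along trajectories -/

section Trajectories

variable {S Act : Type*} [Fintype S] [Fintype Act] (M : MDP S Act)

/-- One step of the state chain under `π`, applied to `f`. -/
noncomputable def avgStep (π : S → PMF Act) (f : S → ℝ) (s : S) : ℝ :=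
  ∑ a, (π s a).toReal * ∑ s', M.prob s a s' * f s'

/-- The average over the actions drawn from `π`. -/
noncomputable def actAvg (π : S → PMF Act) (g : S × Act → ℝ) (s : S) : ℝ :=
  ∑ a, (π s a).toReal * g (s, a)

variable [MeasurableSpace S] [MeasurableSingletonClass S]
  [MeasurableSpace Act] [MeasurableSingletonClass Act]

theorem integral_stepMeasure (π : S → PMF Act) (x : S × Act) (f : S × Act → ℝ) :
    ∫ y, f y ∂(M.stepMeasure π x) = ∑ s', M.prob x.1 x.2 s' * actAvg π f s' := by
  classical
  unfold stepMeasure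
  rw [PMF.integral_eq_sum, Fintype.sum_prod_type]
  refine Finset.sum_congr rfl fun s' _ => ?_
  simp only [actAvg, Finset.mul_sum]
  refine Finset.sum_congr rfl fun a' _ => ?_
  have h : (((M.P x.1 x.2).bind fun s' => (π s').map fun a' => (s', a')) (s', a'))
      = M.P x.1 x.2 s' * π s' a' := by
    rw [PMF.bind_apply, tsum_eq_single s']
    · congr 1
      rw [PMF.map_apply, tsum_eq_single a']
      · simp
      · intro b hb
        simp [hb.symm]
    · intro b hb
      rw [PMF.map_apply]
      simp [hb.symm]
  rw [h, ENNReal.toReal_mul, smul_eq_mul, prob, mul_assoc]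

theorem integral_start (π : S → PMF Act) (s : S) (f : S × Act → ℝ) :
    ∫ y, f y ∂((π s).map fun a => (s, a)).toMeasure = actAvg π f s := by
  classical
  rw [PMF.integral_eq_sum, Fintype.sum_prod_type, Finset.sum_eq_single s]
  · simp only [actAvg]
    refine Finset.sum_congr rfl fun a' _ => ?_
    rw [PMF.map_apply, tsum_eq_single a', if_pos rfl, smul_eq_mul]
    intro b hb
    simp [hb.symm]
  · intro b _ hb
    refine Finset.sum_eq_zero fun a' _ => ?_
    rw [PMF.map_apply]
    simp [hb]
  · simp

instance (π : S → PMF Act) (s : S) : IsProbabilityMeasure (M.pathMeasure π s) := by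
  unfold pathMeasure
  infer_instance

/-- The Markov property: the law up to time `n + 1` is the law of the history composed with the step
kernel, so the last coordinate can be integrated out. -/
theorem integral_pathMeasure_succ (π : S → PMF Act) (s : S) (n : ℕ)
    (F : ((i : Finset.Iic n) → (fun _ : ℕ => S × Act) i) → ℝ) (f : S × Act → ℝ) :
    ∫ τ, F (Preorder.frestrictLe n τ) * f (τ (n + 1)) ∂(M.pathMeasure π s) =
      ∫ τ, F (Preorder.frestrictLe n τ) *
        ∑ s', M.prob (τ n).1 (τ n).2 s' * actAvg π f s' ∂(M.pathMeasure π s) := by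
  have key := Kernel.map_frestrictLe_trajMeasure_compProd_eq_map_trajMeasure
    (X := fun _ => S × Act) (κ := M.stepKernel π)
    (μ₀ := ((π s).map fun a => (s, a)).toMeasure) (a := n)
  change (M.pathMeasure π s).map _ ⊗ₘ _ = (M.pathMeasure π s).map _ at key
  have hfin : ∀ G : (((i : Finset.Iic n) → (fun _ : ℕ => S × Act) i) × (S × Act)) → ℝ,
      Measurable G := fun G => measurable_of_finite G
  have hfin' : ∀ G : (((i : Finset.Iic n) → (fun _ : ℕ => S × Act) i)) → ℝ,
      Measurable G := fun G => measurable_of_finite G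
  have h1 : ∫ τ, F (Preorder.frestrictLe n τ) * f (τ (n + 1)) ∂(M.pathMeasure π s) =
      ∫ y, F y.1 * f y.2 ∂((M.pathMeasure π s).map
        fun x => (Preorder.frestrictLe n x, x (n + 1))) := by
    rw [integral_map (by fun_prop) (hfin fun y => F y.1 * f y.2).aestronglyMeasurable]
  have : IsProbabilityMeasure ((M.pathMeasure π s).map
      (Preorder.frestrictLe (π := fun _ : ℕ => S × Act) n)) :=
    Measure.isProbabilityMeasure_map (by fun_prop)
  rw [h1, ← key, Measure.integral_compProd Integrable.of_finite, integral_map (by fun_prop)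
    (hfin' _).aestronglyMeasurable]
  refine integral_congr_ae (Eventually.of_forall fun τ => ?_)
  simp only
  rw [integral_const_mul]
  congr 1
  exact M.integral_stepMeasure π (τ n) f

theorem integral_pathMeasure_zero (π : S → PMF Act) (s : S) (f : S × Act → ℝ) :
    ∫ τ, f (τ 0) ∂(M.pathMeasure π s) = actAvg π f s := by
  have h0 : (M.pathMeasure π s).map (fun τ => τ 0) = ((π s).map fun a => (s, a)).toMeasure := by
    have h1 : (fun τ : (ℕ → S × Act) => τ 0) =
        (fun h : (i : Finset.Iic 0) → (fun _ : ℕ => S × Act) i => h ⟨0, by simp⟩) ∘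
          (Preorder.frestrictLe 0) := rfl
    rw [h1, ← Measure.map_map (by fun_prop) (by fun_prop)]
    unfold pathMeasure Kernel.trajMeasure
    rw [Measure.map_comp _ _ (by fun_prop), Kernel.traj_map_frestrictLe, Kernel.partialTraj_self,
      Measure.id_comp, Measure.map_map (by fun_prop) (by fun_prop)]
    convert! Measure.map_id
  rw [← integral_start π s f, ← h0, integral_map (measurable_pi_apply 0).aemeasurable
    (measurable_of_finite f).aestronglyMeasurable]

end Trajectories
end PlanRec.MDP

/-! ### Recurrence, and gain bounds from Poisson inequalities -/

namespace PlanRec.MDP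

open Classical in
/-- The weight `0` at `t` and `1` elsewhere. -/
noncomputable def avoid {S : Type*} (t s : S) : ℝ := if s = t then 0 else 1

theorem avoid_nonneg {S : Type*} (t s : S) : 0 ≤ avoid t s := by
  unfold avoid; split_ifs <;> norm_num

theorem avoid_le_one {S : Type*} (t s : S) : avoid t s ≤ 1 := by
  unfold avoid; split_ifs <;> norm_num

section Recurrence

variable {S Act : Type*} [Fintype S] [Fintype Act] (M : MDP S Act)

/-- The expectation operator of the state chain under `π`, where the run is weighted by `N s` on
leaving the state `s`. -/
noncomputable def weightedStep (π : S → PMF Act) (N : S → ℝ) : (S → ℝ) →ₗ[ℝ] (S → ℝ) where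
  toFun f s := N s * M.avgStep π f s
  map_add' f g := by
    funext s
    simp only [avgStep, Pi.add_apply, mul_add, Finset.sum_add_distrib]
  map_smul' c f := by
    funext s
    simp only [avgStep, Pi.smul_apply, smul_eq_mul, RingHom.id_apply, Finset.mul_sum]
    exact Finset.sum_congr rfl fun a _ => Finset.sum_congr rfl fun s' _ => by ring

theorem weightedStep_apply (π : S → PMF Act) (N f : S → ℝ) (s : S) :
    M.weightedStep π N f s = N s * M.avgStep π f s := rfl

theorem prob_nonneg (s : S) (a : Act) (s' : S) : 0 ≤ M.prob s a s' := ENNReal.toReal_nonneg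

theorem _root_.PMF.sum_toReal_eq_one {β : Type*} [Fintype β] (p : PMF β) :
    ∑ b, (p b).toReal = 1 := by
  rw [← ENNReal.toReal_sum fun b _ => p.apply_ne_top b, ← tsum_fintype (L := .unconditional β), p.tsum_coe,
    ENNReal.toReal_one]

theorem sum_prob (s : S) (a : Act) : ∑ s', M.prob s a s' = 1 := (M.P s a).sum_toReal_eq_one

theorem avgStep_const (π : S → PMF Act) (c : ℝ) (s : S) : M.avgStep π (fun _ => c) s = c := by
  simp only [avgStep, ← Finset.sum_mul, sum_prob, one_mul, PMF.sum_toReal_eq_one]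

variable {M} {E : M.EndComponent}

theorem EndComponent.prob_eq_zero {s : S} (hs : s ∈ E.states) {a : Act} (ha : a ∈ E.acts s)
    {s' : S} (hs' : s' ∉ E.states) : M.prob s a s' = 0 := by
  by_contra h
  exact hs' (E.closed s hs a ha s' (lt_of_le_of_ne (M.prob_nonneg _ _ _) (Ne.symm h)))

variable [MeasurableSpace S] [MeasurableSingletonClass S]
  [MeasurableSpace Act] [MeasurableSingletonClass Act] {π : S → PMF Act}

theorem EndComponent.IsPolicy.toReal_eq_zero (hπ : E.IsPolicy π) {s : S} (hs : s ∈ E.states)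
    {a : Act} (ha : a ∉ E.acts s) : (π s a).toReal = 0 := by
  by_contra h
  exact ha (hπ s hs a fun h0 => h (by simp [h0]))

theorem EndComponent.IsPolicy.avgStep_mono (hπ : E.IsPolicy π) {f g : S → ℝ}
    (h : ∀ s ∈ E.states, f s ≤ g s) {s : S} (hs : s ∈ E.states) :
    M.avgStep π f s ≤ M.avgStep π g s := by
  refine Finset.sum_le_sum fun a _ => ?_
  by_cases ha : a ∈ E.acts s
  · refine mul_le_mul_of_nonneg_left (Finset.sum_le_sum fun s' _ => ?_) ENNReal.toReal_nonneg
    by_cases hs' : s' ∈ E.states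
    · exact mul_le_mul_of_nonneg_left (h s' hs') (M.prob_nonneg _ _ _)
    · simp [E.prob_eq_zero hs ha hs']
  · simp [hπ.toReal_eq_zero hs ha]

theorem EndComponent.IsPolicy.avgStep_pos (hπ : E.IsPolicy π) {f : S → ℝ}
    (h : ∀ s ∈ E.states, 0 ≤ f s) {s s' : S} (hs : s ∈ E.states) {a : Act} (ha : π s a ≠ 0)
    (hp : 0 < M.prob s a s') (hf : 0 < f s') : 0 < M.avgStep π f s := by
  have haE := hπ s hs a ha
  have hnn : ∀ b ∈ E.acts s, ∀ t, 0 ≤ M.prob s b t * f t := fun b hb t => by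
    by_cases ht : t ∈ E.states
    · exact mul_nonneg (M.prob_nonneg _ _ _) (h t ht)
    · simp [E.prob_eq_zero hs hb ht]
  refine Finset.sum_pos' (fun b _ => ?_) ⟨a, Finset.mem_univ _, ?_⟩
  · by_cases hb : b ∈ E.acts s
    · exact mul_nonneg ENNReal.toReal_nonneg (Finset.sum_nonneg fun t _ => hnn b hb t)
    · simp [hπ.toReal_eq_zero hs hb]
  · refine mul_pos (ENNReal.toReal_pos ha ((π s).apply_ne_top a)) ?_
    exact Finset.sum_pos' (fun t _ => hnn a haE t) ⟨s', Finset.mem_univ _, mul_pos hp hf⟩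

theorem EndComponent.IsPolicy.weightedStep_iterate_mono (hπ : E.IsPolicy π) {N : S → ℝ}
    (hN : ∀ s, 0 ≤ N s) {f g : S → ℝ} (h : ∀ s ∈ E.states, f s ≤ g s) (n : ℕ) :
    ∀ s ∈ E.states, (M.weightedStep π N)^[n] f s ≤ (M.weightedStep π N)^[n] g s := by
  induction n with
  | zero => simpa using h
  | succ n ih =>
    intro s hs
    rw [Function.iterate_succ_apply', Function.iterate_succ_apply']
    exact mul_le_mul_of_nonneg_left (hπ.avgStep_mono ih hs) (hN s)

theorem weightedStep_one_iterate_const (c : ℝ) (n : ℕ) :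
    (M.weightedStep π 1)^[n] (fun _ => c) = fun _ => c := by
  refine Function.iterate_fixed ?_ n
  funext s
  simp [weightedStep_apply, avgStep_const]

/-- One formula for two uses: `k = 0` gives the expected cost at time `n`, while `N = avoid t`, `g =
1` give the probability of missing `t` at the times `n, …, n + k - 1`. -/
theorem integral_prod_pathMeasure (s : S) (N : S → ℝ) (n k : ℕ) (g : S × Act → ℝ) :
    ∫ τ, (∏ i ∈ Finset.range k, N (τ (n + i)).1) * g (τ (n + k)) ∂(M.pathMeasure π s) =
      (M.weightedStep π 1)^[n] ((M.weightedStep π N)^[k] (actAvg π g)) s := by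
  have one : ∀ n, ∀ g : S × Act → ℝ, ∫ τ, g (τ n) ∂(M.pathMeasure π s) =
      (M.weightedStep π 1)^[n] (actAvg π g) s := by
    intro n
    induction n with
    | zero => intro g; exact M.integral_pathMeasure_zero π s g
    | succ n ih =>
      intro g
      have h := M.integral_pathMeasure_succ π s n (fun _ => 1) g
      simp only [one_mul] at h
      rw [h, ih fun x => ∑ s', M.prob x.1 x.2 s' * actAvg π g s', Function.iterate_succ_apply]
      refine congrFun (congrArg _ (funext fun t => ?_)) s
      simp [weightedStep_apply, actAvg, avgStep]
  induction k generalizing g with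
  | zero => simpa using one n g
  | succ k ih =>
    -- `attach` supplies the bounds `n + i ≤ n + k` needed to read the state off the history.
    have h := M.integral_pathMeasure_succ π s (n + k)
      (fun h => ∏ i ∈ (Finset.range (k + 1)).attach,
        N (h ⟨n + i.1, Finset.mem_Iic.2 (by have := Finset.mem_range.1 i.2; omega)⟩).1) g
    simp only [Preorder.frestrictLe_apply] at h
    have e : ∀ τ : ℕ → S × Act, ∏ i ∈ (Finset.range (k + 1)).attach, N (τ (n + i.1)).1 =
        ∏ i ∈ Finset.range (k + 1), N (τ (n + i)).1 := fun τ =>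
      Finset.prod_attach (Finset.range (k + 1)) fun i => N (τ (n + i)).1
    simp only [e] at h
    rw [← add_assoc, h]
    have h2 := ih fun x => N x.1 * ∑ s', M.prob x.1 x.2 s' * actAvg π g s'
    simp only [Finset.prod_range_succ, mul_assoc]
    rw [h2, Function.iterate_succ_apply]
    refine congrFun (congrArg _ (congrArg _ (funext fun t => ?_))) s
    simp only [weightedStep_apply, actAvg, avgStep, Finset.mul_sum]
    exact Finset.sum_congr rfl fun a _ => Finset.sum_congr rfl fun s' _ => Finset.sum_congr rfl
      fun a' _ => by ring

/-- The hypothesis that `π` uses every action of the end component. -/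
def EndComponent.IsFull (E : M.EndComponent) (π : S → PMF Act) : Prop :=
  ∀ s ∈ E.states, ∀ a ∈ E.acts s, π s a ≠ 0

theorem EndComponent.IsPolicy.avoid_iterate_nonneg (hπ : E.IsPolicy π) (t : S) (n : ℕ) :
    ∀ s ∈ E.states, 0 ≤ (M.weightedStep π (avoid t))^[n] 1 s := fun s hs => by
  have h := hπ.weightedStep_iterate_mono (avoid_nonneg t) (f := 0) (g := 1)
    (fun _ _ => by simp) n s hs
  rwa [iterate_map_zero] at h

theorem EndComponent.IsPolicy.avoid_iterate_anti (hπ : E.IsPolicy π) (t : S) :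
    ∀ s ∈ E.states, Antitone fun n => (M.weightedStep π (avoid t))^[n] 1 s := fun s hs => by
  refine antitone_nat_of_succ_le fun n => ?_
  rw [Function.iterate_succ_apply]
  refine hπ.weightedStep_iterate_mono (avoid_nonneg t) (fun s' _ => ?_) n s hs
  rw [weightedStep_apply, show (1 : S → ℝ) = fun _ => 1 from rfl, avgStep_const, mul_one]
  exact avoid_le_one t s'

/-- Backward induction along a path to `t`: the weight at `t` is `0`, and a predecessor moves with
positive probability to a state whose avoidance probability is already below `1`. These
probabilities decrease in the number of steps, so one `k` serves all states. -/
theorem EndComponent.IsPolicy.avoid_iterate_lt_one (hπ : E.IsPolicy π) (hf : E.IsFull π)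
    {t : S} (ht : t ∈ E.states) :
    ∃ k, ∀ s ∈ E.states, (M.weightedStep π (avoid t))^[k] 1 s < 1 := by
  have h1 : ∀ s ∈ E.states, ∃ k, (M.weightedStep π (avoid t))^[k] 1 s < 1 := by
    intro s hs
    induction E.connected s hs t ht using Relation.ReflTransGen.head_induction_on with
    | refl => exact ⟨1, by simp [weightedStep_apply, avoid]⟩
    | head hab hbc ih =>
      rename_i a c
      obtain ⟨haE, b, hb, hp⟩ := hab
      have hcE := E.closed a haE b hb c hp
      obtain ⟨k, hk⟩ := ih hcE
      refine ⟨k + 1, ?_⟩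
      rw [Function.iterate_succ_apply', weightedStep_apply]
      set u := (M.weightedStep π (avoid t))^[k] 1
      have hu0 := hπ.avoid_iterate_nonneg t k
      have hu1 : ∀ s ∈ E.states, u s ≤ 1 := fun s hs => by
        simpa using hπ.avoid_iterate_anti t s hs (Nat.zero_le k)
      have hpos := hπ.avgStep_pos (f := fun s => 1 - u s) (fun s hs => by linarith [hu1 s hs])
        haE (hf a haE b hb) hp (by linarith)
      have hsub : M.avgStep π (fun s => 1 - u s) a = 1 - M.avgStep π u a := by
        have := congrFun (map_sub (M.weightedStep π 1) (fun _ => (1 : ℝ)) u) a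
        simpa [weightedStep_apply, avgStep_const, Pi.sub_def] using this
      have h0 : 0 ≤ M.avgStep π u a := by
        have := hπ.avgStep_mono (f := fun _ => 0) hu0 haE
        rwa [avgStep_const] at this
      nlinarith [avoid_le_one t a, avoid_nonneg t a]
  choose! k hk using h1
  refine ⟨E.states.sup k, fun s hs => ?_⟩
  exact (hπ.avoid_iterate_anti t s hs (Finset.le_sup hs)).trans_lt (hk s hs)

/-- The bound below `1` over `k` steps is uniform in the starting state, so it multiplies over
consecutive blocks of length `k`. -/
theorem EndComponent.IsPolicy.avoid_iterate_small (hπ : E.IsPolicy π) (hf : E.IsFull π)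
    {t : S} (ht : t ∈ E.states) {e : ℝ} (he : 0 < e) :
    ∃ k, ∀ s ∈ E.states, (M.weightedStep π (avoid t))^[k] 1 s ≤ e := by
  obtain ⟨k, hk⟩ := hπ.avoid_iterate_lt_one hf ht
  obtain ⟨s₀, hs₀, hmax⟩ := E.states.exists_max_image
    (fun s => (M.weightedStep π (avoid t))^[k] 1 s) E.nonempty
  set b := (M.weightedStep π (avoid t))^[k] 1 s₀
  have hb0 : 0 ≤ b := hπ.avoid_iterate_nonneg t k s₀ hs₀
  have hpow : ∀ j, ∀ s ∈ E.states, (M.weightedStep π (avoid t))^[j * k] 1 s ≤ b ^ j := by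
    intro j
    induction j with
    | zero => simp
    | succ j ih =>
      intro s hs
      have h1 : (M.weightedStep π (avoid t))^[(j + 1) * k] 1 s ≤
          (M.weightedStep π (avoid t))^[k] (b ^ j • (1 : S → ℝ)) s := by
        rw [show (j + 1) * k = k + j * k by ring, Function.iterate_add_apply]
        exact hπ.weightedStep_iterate_mono (avoid_nonneg t) (fun s' hs' => by simpa using ih s' hs')
          k s hs
      have h2 : (M.weightedStep π (avoid t))^[k] (b ^ j • (1 : S → ℝ)) =
          b ^ j • (M.weightedStep π (avoid t))^[k] 1 := by
        rw [← Module.End.pow_apply, map_smul, Module.End.pow_apply]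
      rw [h2] at h1
      refine h1.trans ?_
      rw [pow_succ]
      exact mul_le_mul_of_nonneg_left (hmax s hs) (pow_nonneg hb0 j)
  obtain ⟨j, hj⟩ := exists_pow_lt_of_lt_one he (hk s₀ hs₀)
  exact ⟨j * k, fun s hs => (hpow j s hs).trans hj.le⟩

/-- A fixed accepting state is almost surely visited after each time `n`, since avoiding it for `k`
further steps has arbitrarily small probability. Intersect over the countably many `n`. -/
theorem EndComponent.IsPolicy.satProb_eq_one (hπ : E.IsPolicy π) (hf : E.IsFull π)
    (hacc : ∃ s ∈ E.states, s ∈ M.acc) {s : S} (hs : s ∈ E.states) : M.satProb π s = 1 := by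
  obtain ⟨t, ht, hta⟩ := hacc
  have hnull : ∀ n, M.pathMeasure π s {τ | ∀ i, (τ (n + i)).1 ≠ t} = 0 := by
    intro n
    have hmeas : MeasurableSet {τ : ℕ → S × Act | ∀ i, (τ (n + i)).1 ≠ t} := by
      have : {τ : ℕ → S × Act | ∀ i, (τ (n + i)).1 ≠ t} =
          ⋂ i, (fun τ => τ (n + i)) ⁻¹' {x | x.1 ≠ t} := by ext; simp
      rw [this]
      exact MeasurableSet.iInter fun i =>
        (measurable_pi_apply (n + i)) (Set.toFinite _).measurableSet
    have hle : ∀ e : ℝ, 0 < e → (M.pathMeasure π s).real {τ | ∀ i, (τ (n + i)).1 ≠ t} ≤ e := by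
      intro e he
      obtain ⟨k, hk⟩ := hπ.avoid_iterate_small hf ht he
      have h1 := integral_prod_pathMeasure (π := π) (M := M) s (avoid t) n k fun _ => 1
      have h2 : actAvg π (fun _ => (1 : ℝ)) = 1 := by
        funext x; simp [actAvg, PMF.sum_toReal_eq_one]
      rw [h2] at h1
      have h3 : (M.weightedStep π 1)^[n] ((M.weightedStep π (avoid t))^[k] 1) s ≤ e := by
        have := hπ.weightedStep_iterate_mono (N := 1) (fun _ => zero_le_one) hk n s hs
        rwa [weightedStep_one_iterate_const] at this
      rw [← h1] at h3
      refine le_trans ?_ h3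
      rw [← integral_indicator_one hmeas]
      have hm : Measurable fun τ : ℕ → S × Act =>
          (∏ i ∈ Finset.range k, avoid t (τ (n + i)).1) * 1 := by
        refine (Finset.measurable_prod _ fun i _ => ?_).mul_const 1
        exact (measurable_of_finite (fun x : S × Act => avoid t x.1)).comp
          (measurable_pi_apply (n + i))
      have hb : ∀ τ : ℕ → S × Act, 0 ≤ (∏ i ∈ Finset.range k, avoid t (τ (n + i)).1) * 1 ∧
          (∏ i ∈ Finset.range k, avoid t (τ (n + i)).1) * 1 ≤ 1 := fun τ => by
        rw [mul_one]
        exact ⟨Finset.prod_nonneg fun i _ => avoid_nonneg _ _,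
          Finset.prod_le_one (fun i _ => avoid_nonneg _ _) fun i _ => avoid_le_one _ _⟩
      refine integral_mono ((integrable_indicator_iff hmeas).2 (integrable_const _).integrableOn)
        (Integrable.of_bound hm.aestronglyMeasurable 1 (Eventually.of_forall fun τ => ?_))
        fun τ => ?_
      · rw [Real.norm_eq_abs, abs_le]
        constructor <;> linarith [(hb τ).1, (hb τ).2]
      · by_cases hτ : τ ∈ {τ : ℕ → S × Act | ∀ i, (τ (n + i)).1 ≠ t}
        · rw [Set.indicator_of_mem hτ]
          simp only [Set.mem_ofPred_eq] at hτ
          simp [avoid, hτ]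
        · rw [Set.indicator_of_notMem hτ]
          exact (hb τ).1
    have h0 : (M.pathMeasure π s).real {τ | ∀ i, (τ (n + i)).1 ≠ t} = 0 :=
      le_antisymm (le_of_forall_pos_le_add fun e he => by simpa using hle e he) measureReal_nonneg
    exact (measureReal_eq_zero_iff).1 h0
  have hae : ∀ᵐ τ ∂(M.pathMeasure π s), ∃ s' ∈ M.acc, ∃ᶠ t in atTop, (τ t).1 = s' := by
    have : ∀ᵐ τ ∂(M.pathMeasure π s), ∀ n, ¬ ∀ i, (τ (n + i)).1 ≠ t := by
      rw [ae_all_iff]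
      intro n
      rw [ae_iff]
      simpa using hnull n
    filter_upwards [this] with τ hτ
    refine ⟨t, hta, frequently_atTop.2 fun n => ?_⟩
    have := hτ n
    push Not at this
    obtain ⟨i, hi⟩ := this
    exact ⟨n + i, by omega, hi⟩
  exact by
    unfold satProb
    rw [← measure_univ (μ := M.pathMeasure π s)]
    exact measure_congr (eventuallyEq_univ.2 hae)

/-- Applying `P_π^t` to the inequalities and summing over `t < T` telescopes the terms in `h`, which
stay bounded; then divide by `T`. Both bounds are assumed together because a real `limsup` is only
meaningful for a bounded sequence. -/
theorem EndComponent.IsPolicy.gain_mem_Icc (hπ : E.IsPolicy π) {h : S → ℝ} {G₁ G₂ : ℝ}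
    (h₁ : ∀ s ∈ E.states, G₁ ≤ actAvg π (fun x => M.cost x.1 x.2) s + M.avgStep π h s - h s)
    (h₂ : ∀ s ∈ E.states, actAvg π (fun x => M.cost x.1 x.2) s + M.avgStep π h s - h s ≤ G₂)
    {s : S} (hs : s ∈ E.states) : M.gain π s ∈ Set.Icc G₁ G₂ := by
  set c := actAvg π (fun x => M.cost x.1 x.2) with hc
  set A := M.weightedStep π 1
  have hA : ∀ f s, M.avgStep π f s = A f s := fun f s => by simp [A, weightedStep_apply]
  obtain ⟨C, hC⟩ : ∃ C, ∀ s ∈ E.states, |h s| ≤ C :=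
    ⟨∑ s, |h s|, fun s _ => Finset.single_le_sum (f := fun s => |h s|)
      (fun _ _ => abs_nonneg _) (Finset.mem_univ s)⟩
  have hAC : ∀ T, |A^[T] h s| ≤ C := fun T => by
    have l1 := hπ.weightedStep_iterate_mono (N := 1) (fun _ => zero_le_one)
      (f := fun _ => -C) (fun s hs => (abs_le.1 (hC s hs)).1) T s hs
    have l2 := hπ.weightedStep_iterate_mono (N := 1) (fun _ => zero_le_one)
      (g := fun _ => C) (fun s hs => (abs_le.1 (hC s hs)).2) T s hs
    rw [weightedStep_one_iterate_const] at l1 l2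
    exact abs_le.2 ⟨l1, l2⟩
  have hstep : ∀ t, G₁ ≤ A^[t] c s + A^[t + 1] h s - A^[t] h s ∧
      A^[t] c s + A^[t + 1] h s - A^[t] h s ≤ G₂ := fun t => by
    have e : A^[t] c s + A^[t + 1] h s - A^[t] h s = A^[t] (c + A h - h) s := by
      simp only [← Module.End.pow_apply, map_sub, map_add, Pi.sub_apply, Pi.add_apply]
      rw [pow_succ, Module.End.mul_apply]
    rw [e]
    have l1 := hπ.weightedStep_iterate_mono (N := 1) (fun _ => zero_le_one)
      (f := fun _ => G₁) (g := c + A h - h)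
      (fun s hs => by simpa [hA] using h₁ s hs) t s hs
    have l2 := hπ.weightedStep_iterate_mono (N := 1) (fun _ => zero_le_one)
      (g := fun _ => G₂) (f := c + A h - h)
      (fun s hs => by simpa [hA] using h₂ s hs) t s hs
    rw [weightedStep_one_iterate_const] at l1 l2
    exact ⟨l1, l2⟩
  have hint : ∀ T : ℕ, ∫ τ, ∑ t ∈ Finset.range T, M.cost (τ t).1 (τ t).2 ∂(M.pathMeasure π s) =
      ∑ t ∈ Finset.range T, A^[t] c s := fun T => by
    rw [integral_finsetSum]
    · refine Finset.sum_congr rfl fun t _ => ?_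
      have := integral_prod_pathMeasure (π := π) (M := M) s 1 t 0 fun x => M.cost x.1 x.2
      simpa using this
    · intro t _
      have hm : Measurable fun τ : ℕ → S × Act => M.cost (τ t).1 (τ t).2 :=
        (measurable_of_finite (fun x : S × Act => M.cost x.1 x.2)).comp (measurable_pi_apply t)
      refine Integrable.of_bound hm.aestronglyMeasurable (∑ x : S × Act, |M.cost x.1 x.2|)
        (Eventually.of_forall fun τ => ?_)
      exact Finset.single_le_sum (f := fun x : S × Act => |M.cost x.1 x.2|)
        (fun _ _ => abs_nonneg _) (Finset.mem_univ (τ t))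
  have hsum : ∀ T : ℕ, T * G₁ - 2 * C ≤ ∑ t ∈ Finset.range T, A^[t] c s ∧
      ∑ t ∈ Finset.range T, A^[t] c s ≤ T * G₂ + 2 * C := fun T => by
    have tel := Finset.sum_range_sub (fun t => A^[t] h s) T
    have s1 := Finset.sum_le_sum fun t (_ : t ∈ Finset.range T) => (hstep t).1
    have s2 := Finset.sum_le_sum fun t (_ : t ∈ Finset.range T) => (hstep t).2
    simp only [add_sub_assoc, Finset.sum_add_distrib, tel, Finset.sum_const, Finset.card_range,
      nsmul_eq_mul] at s1 s2
    have b1 := abs_le.1 (hAC T)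
    have b2 := abs_le.1 (hAC 0)
    constructor <;> linarith [b1.1, b1.2, b2.1, b2.2]
  have hlo : Tendsto (fun T : ℕ => G₁ - 2 * C / T) atTop (nhds G₁) := by
    simpa using tendsto_const_nhds.sub (tendsto_const_div_atTop_nhds_zero_nat (2 * C))
  have hhi : Tendsto (fun T : ℕ => G₂ + 2 * C / T) atTop (nhds G₂) := by
    simpa using tendsto_const_nhds.add (tendsto_const_div_atTop_nhds_zero_nat (2 * C))
  have hle1 : ∀ᶠ T : ℕ in atTop, G₁ - 2 * C / T ≤ (∑ t ∈ Finset.range T, A^[t] c s) / T := by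
    filter_upwards [eventually_gt_atTop 0] with T hT
    have hT' : (0 : ℝ) < T := by exact_mod_cast hT
    rw [le_div_iff₀ hT', sub_mul, div_mul_cancel₀ _ hT'.ne', mul_comm]
    exact (hsum T).1
  have hle2 : ∀ᶠ T : ℕ in atTop, (∑ t ∈ Finset.range T, A^[t] c s) / T ≤ G₂ + 2 * C / T := by
    filter_upwards [eventually_gt_atTop 0] with T hT
    have hT' : (0 : ℝ) < T := by exact_mod_cast hT
    rw [div_le_iff₀ hT', add_mul, div_mul_cancel₀ _ hT'.ne', mul_comm]
    exact (hsum T).2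
  unfold gain
  simp only [hint]
  constructor
  · rw [← hlo.limsup_eq]
    exact limsup_le_limsup hle1 hlo.isCoboundedUnder_le
      (hhi.isBoundedUnder_le.mono_le hle2)
  · rw [← hhi.limsup_eq]
    exact limsup_le_limsup hle2 (hlo.isBoundedUnder_ge.mono_ge hle1).isCoboundedUnder_le
      hhi.isBoundedUnder_le

/-- The missing upper bound is the maximum over the finite component. -/
theorem EndComponent.IsPolicy.le_gain (hπ : E.IsPolicy π) {h : S → ℝ} {G : ℝ}
    (hG : ∀ s ∈ E.states, G ≤ actAvg π (fun x => M.cost x.1 x.2) s + M.avgStep π h s - h s)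
    {s : S} (hs : s ∈ E.states) : G ≤ M.gain π s := by
  obtain ⟨s₀, -, hmax⟩ := E.states.exists_max_image
    (fun s => actAvg π (fun x => M.cost x.1 x.2) s + M.avgStep π h s - h s) E.nonempty
  exact (hπ.gain_mem_Icc hG hmax hs).1

theorem EndComponent.IsPolicy.gain_le (hπ : E.IsPolicy π) {h : S → ℝ} {G : ℝ}
    (hG : ∀ s ∈ E.states, actAvg π (fun x => M.cost x.1 x.2) s + M.avgStep π h s - h s ≤ G)
    {s : S} (hs : s ∈ E.states) : M.gain π s ≤ G := by
  obtain ⟨s₀, -, hmin⟩ := E.states.exists_min_image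
    (fun s => actAvg π (fun x => M.cost x.1 x.2) s + M.avgStep π h s - h s) E.nonempty
  exact (hπ.gain_mem_Icc hmin hG hs).2
end Recurrence
end PlanRec.MDP

/-! ### Convergence of the increments of value iteration -/

namespace PlanRec

section ValueIteration

variable {ι : Type*} [Fintype ι]

/-- Increments that are averaged with weight `1 - α` in one step and bounded by their last maximum
otherwise stay close to their maximal value over long time spans. -/
theorem exists_increments_near_sup [Nonempty ι] {α : ℝ} (hα₀ : 0 ≤ α) (hα : α < 1) {w : ℕ → ι → ℝ}
    (hw : ∀ n M, (∀ s, w n s ≤ M) → ∀ s, w (n + 1) s ≤ α * M + (1 - α) * w n s)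
    {m : ℝ} (hm : ∀ n s, m ≤ w n s) :
    ∃ M, (∀ n, ∃ s, M ≤ w n s) ∧ (∀ e > 0, ∃ n₀, ∀ n ≥ n₀, ∀ s, w n s ≤ M + e) ∧
      ∀ (K : ℕ), ∀ e > 0, ∃ n₀, ∀ n ≥ n₀, ∃ s,
        K * (M - e) ≤ ∑ k ∈ Finset.range K, w (n + k) s := by
  have hbdd : ∀ n, BddAbove (Set.range (w n)) := fun n => (Set.finite_range _).bddAbove
  have hanti : Antitone fun n => ⨆ s, w n s := antitone_nat_of_succ_le fun n => by
    refine ciSup_le fun s => ?_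
    have h1 := hw n (⨆ s, w n s) (fun s => le_ciSup (hbdd n) s) s
    have h2 := le_ciSup (hbdd n) s
    nlinarith
  have hlow : BddBelow (Set.range fun n => ⨆ s, w n s) := ⟨m, by
    rintro _ ⟨n, rfl⟩
    exact (hm n (Classical.arbitrary ι)).trans (le_ciSup (hbdd n) _)⟩
  have hlim := tendsto_atTop_ciInf hanti hlow
  set M := ⨅ n, ⨆ s, w n s
  have hMle : ∀ n, M ≤ ⨆ s, w n s := fun n => ciInf_le hlow n
  have hatt : ∀ n, ∃ s, M ≤ w n s := fun n => by
    obtain ⟨s, hs⟩ := exists_eq_ciSup_of_finite (f := w n)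
    exact ⟨s, hs ▸ hMle n⟩
  have hup : ∀ e > 0, ∃ n₀, ∀ n ≥ n₀, ∀ s, w n s ≤ M + e := fun e he => by
    obtain ⟨n₀, h⟩ := eventually_atTop.1 (hlim.eventually (ge_mem_nhds (show M < M + e by linarith)))
    exact ⟨n₀, fun n hn s => (le_ciSup (hbdd n) s).trans (h n hn)⟩
  refine ⟨M, hatt, hup, fun K e he => ?_⟩
  have hpos : 0 < (1 - α) ^ K := pow_pos (by linarith) K
  -- Going back one step in time multiplies the deficit `b - w` of a state by at most `1 / (1 - α)`.
  -- With this tolerance, a state that reaches the limit at time `n + K` has had a deficit of at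
  -- most `e` during the `K` preceding steps.
  obtain ⟨n₀, hn₀⟩ := hup (e * (1 - α) ^ K) (by positivity)
  refine ⟨n₀, fun n hn => ?_⟩
  obtain ⟨s, hs⟩ := hatt (n + K)
  refine ⟨s, ?_⟩
  set b := M + e * (1 - α) ^ K with hb
  have hback : ∀ j ≤ K, (1 - α) ^ j * (b - w (n + (K - j)) s) ≤ e * (1 - α) ^ K := by
    intro j
    induction j with
    | zero => intro _; simp [hb]; linarith
    | succ j ih =>
      intro hj
      have h1 := ih (by omega)
      have h2 := hw (n + (K - (j + 1))) b (hn₀ _ (by omega)) s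
      rw [show n + (K - (j + 1)) + 1 = n + (K - j) by omega] at h2
      refine le_trans ?_ h1
      rw [pow_succ, mul_assoc]
      refine mul_le_mul_of_nonneg_left ?_ (pow_nonneg (by linarith) j)
      linarith
  have hterm : ∀ k ∈ Finset.range K, M - e ≤ w (n + k) s := by
    intro k hk
    have hkK := Finset.mem_range.1 hk
    have h1 := hback (K - k) (by omega)
    rw [show n + (K - (K - k)) = n + k by omega] at h1
    have h3 : (1 - α) ^ K ≤ (1 - α) ^ (K - k) :=
      pow_le_pow_of_le_one (by linarith) (by linarith) (by omega)
    by_contra hcon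
    push Not at hcon
    have h4 : 0 < b - w (n + k) s - e := by
      have : 0 < e * (1 - α) ^ K := by positivity
      linarith
    have h5 : 0 < (1 - α) ^ (K - k) := pow_pos (by linarith) _
    nlinarith
  calc (K : ℝ) * (M - e) = ∑ k ∈ Finset.range K, (M - e) := by
        rw [Finset.sum_const, Finset.card_range, nsmul_eq_mul]
    _ ≤ _ := Finset.sum_le_sum hterm


/-- The maximal increment tends to some `M`, the minimal one to some `-m`. If `M > -m`, then over
`K` steps one state grows at nearly the rate `M` and another at nearly the rate `-m`, and they drift
apart by a multiple of `K`, against the bounded span. -/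
theorem increments_converge [Nonempty ι] {α : ℝ} (hα₀ : 0 ≤ α) (hα : α < 1) {x : ℕ → ι → ℝ}
    (hw : ∀ n M, (∀ s, x (n + 1) s - x n s ≤ M) →
      ∀ s, x (n + 2) s - x (n + 1) s ≤ α * M + (1 - α) * (x (n + 1) s - x n s))
    (hw' : ∀ n m, (∀ s, m ≤ x (n + 1) s - x n s) →
      ∀ s, α * m + (1 - α) * (x (n + 1) s - x n s) ≤ x (n + 2) s - x (n + 1) s)
    {W : ℝ} (hW : ∀ n i j, x n i - x n j ≤ W) :
    ∃ g, ∀ e > 0, ∃ n₀, ∀ n ≥ n₀, ∀ s, |x (n + 1) s - x n s - g| ≤ e := by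
  have htel : ∀ n K s, ∑ k ∈ Finset.range K, (x (n + k + 1) s - x (n + k) s) =
      x (n + K) s - x n s := fun n K s => by
    have := Finset.sum_range_sub (fun k => x (n + k) s) K
    simpa [add_assoc] using this
  obtain ⟨lo, hlo⟩ : ∃ m, ∀ n s, m ≤ x (n + 1) s - x n s := by
    obtain ⟨s₀, h₀⟩ := Finite.exists_min fun s => x 1 s - x 0 s
    refine ⟨x 1 s₀ - x 0 s₀, fun n => ?_⟩
    induction n with
    | zero => exact h₀
    | succ n ih => intro s; nlinarith [hw' n _ ih s, ih s]
  obtain ⟨hi, hhi⟩ : ∃ m, ∀ n s, x (n + 1) s - x n s ≤ m := by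
    obtain ⟨s₀, h₀⟩ := Finite.exists_max fun s => x 1 s - x 0 s
    refine ⟨x 1 s₀ - x 0 s₀, fun n => ?_⟩
    induction n with
    | zero => exact h₀
    | succ n ih => intro s; nlinarith [hw n _ ih s, ih s]
  obtain ⟨M, hM1, hM2, hM3⟩ := exists_increments_near_sup hα₀ hα
    (w := fun n s => x (n + 1) s - x n s) hw hlo
  obtain ⟨m, hm1, hm2, hm3⟩ := exists_increments_near_sup hα₀ hα
    (w := fun n s => -(x (n + 1) s - x n s)) (m := -hi)
    (fun n B hB s => by
      have := hw' n (-B) (fun s => by linarith [hB s]) s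
      simp only [show n + 1 + 1 = n + 2 from rfl]
      linarith) (fun n s => by linarith [hhi n s])
  have hmM : M ≤ -m := by
    by_contra hcon
    push Not at hcon
    -- With tolerance `(M + m) / 4` the two states separate by `K (M + m) / 2 > 2 W`, while the span
    -- bound at the two end times allows only `2 W`.
    obtain ⟨K, hK⟩ := exists_nat_gt (4 * W / (M + m))
    rw [div_lt_iff₀ (by linarith)] at hK
    obtain ⟨n1, h1⟩ := hM3 K ((M + m) / 4) (by linarith)
    obtain ⟨n2, h2⟩ := hm3 K ((M + m) / 4) (by linarith)
    obtain ⟨s, hs⟩ := h1 (max n1 n2) (le_max_left _ _)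
    obtain ⟨t, ht⟩ := h2 (max n1 n2) (le_max_right _ _)
    simp only [Finset.sum_neg_distrib] at ht
    rw [htel] at hs ht
    have a1 := hW (max n1 n2 + K) s t
    have a2 := hW (max n1 n2) t s
    nlinarith
  refine ⟨M, fun e he => ?_⟩
  obtain ⟨n1, h1⟩ := hM2 e he
  obtain ⟨n2, h2⟩ := hm2 e he
  refine ⟨max n1 n2, fun n hn s => abs_le.2 ⟨?_, ?_⟩⟩
  · have := h2 n (le_trans (le_max_right _ _) hn) s
    obtain ⟨t, ht⟩ := hm1 n
    linarith
  · have := h1 n (le_trans (le_max_left _ _) hn) s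
    linarith

/-- `T` is the Bellman operator `v ↦ min_{(c, p) ∈ K s} (c + α p · v) + (1 - α) v s`. -/
def IsBellman (α : ℝ) (K : ι → Set (ℝ × (ι → ℝ))) (T : (ι → ℝ) → ι → ℝ) : Prop :=
  ∀ v s, IsLeast ((fun k : ℝ × (ι → ℝ) => k.1 + α * ∑ j, k.2 j * v j + (1 - α) * v s) '' K s)
    (T v s)

/-- Follow a path from a maximizer of `f`: if a state is within `D` of the maximum, its successor is
within `(D + C) / β`. The resulting `W` depends on the graph, `β` and `C`, not on `f`. -/
theorem exists_span_bound {r : ι → ι → Prop} (hr : ∀ i j, Relation.ReflTransGen r i j)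
    {β C : ℝ} (hβ : 0 < β) :
    ∃ W, ∀ (f : ι → ℝ), (∀ X, (∀ s, f s ≤ X) → ∀ s t, r s t → f s ≤ C + β * f t + (1 - β) * X) →
      ∀ i j, f i - f j ≤ W := by
  have key : ∀ i j, ∃ W, ∀ (f : ι → ℝ) (X : ℝ), (∀ s, f s ≤ X) →
      (∀ s t, r s t → f s ≤ C + β * f t + (1 - β) * X) → f i = X → X - f j ≤ W := by
    intro i j
    induction hr i j with
    | refl => exact ⟨0, fun f X _ _ h => by linarith⟩
    | tail _ hbc ih =>
      rename_i b c _
      obtain ⟨W, hW⟩ := ih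
      refine ⟨(W + C) / β, fun f X h1 h2 h3 => ?_⟩
      have := hW f X h1 h2 h3
      have := h2 _ _ hbc
      rw [le_div_iff₀ hβ]
      linarith
  choose W hW using key
  refine ⟨∑ i, ∑ j, |W i j|, fun f hf i j => ?_⟩
  have : Nonempty ι := ⟨i⟩
  obtain ⟨i₀, h₀⟩ := Finite.exists_max f
  have h1 := hW i₀ j f (f i₀) h₀ (hf _ h₀) rfl
  have h2 : |W i₀ j| ≤ ∑ j, |W i₀ j| :=
    Finset.single_le_sum (f := fun j => |W i₀ j|) (fun _ _ => abs_nonneg _) (Finset.mem_univ j)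
  have h3 : ∑ j, |W i₀ j| ≤ ∑ i, ∑ j, |W i j| :=
    Finset.single_le_sum (f := fun i => ∑ j, |W i j|)
      (fun _ _ => Finset.sum_nonneg fun _ _ => abs_nonneg _) (Finset.mem_univ i₀)
  linarith [h₀ i, le_abs_self (W i₀ j)]

variable {α : ℝ} {K : ι → Set (ℝ × (ι → ℝ))} {T : (ι → ℝ) → ι → ℝ}

theorem sum_mul_le_of_mem_stdSimplex {p : ι → ℝ} (hp : p ∈ stdSimplex ℝ ι) {v : ι → ℝ} {B : ℝ}
    (h : ∀ j, v j ≤ B) : ∑ j, p j * v j ≤ B := by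
  calc ∑ j, p j * v j ≤ ∑ j, p j * B :=
        Finset.sum_le_sum fun j _ => mul_le_mul_of_nonneg_left (h j) (hp.1 j)
    _ = B := by rw [← Finset.sum_mul, hp.2, one_mul]

/-- The choice that is minimal at `v` also competes at `v'`, and its distribution averages `v' - v`.
-/
theorem IsBellman.increment_le (hT : IsBellman α K T) (hα₀ : 0 ≤ α)
    (hK : ∀ s, ∀ k ∈ K s, k.2 ∈ stdSimplex ℝ ι) {v v' : ι → ℝ} {B : ℝ}
    (h : ∀ s, v' s - v s ≤ B) (s : ι) :
    T v' s - T v s ≤ α * B + (1 - α) * (v' s - v s) := by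
  obtain ⟨⟨k, hk, hkv⟩, -⟩ := hT v s
  have h1 := (hT v' s).2 ⟨k, hk, rfl⟩
  have h2 := sum_mul_le_of_mem_stdSimplex (hK s k hk) h
  simp only [mul_sub, Finset.sum_sub_distrib] at h2
  simp only at hkv h1
  nlinarith [mul_le_mul_of_nonneg_left h2 hα₀]

theorem IsBellman.le_increment (hT : IsBellman α K T) (hα₀ : 0 ≤ α)
    (hK : ∀ s, ∀ k ∈ K s, k.2 ∈ stdSimplex ℝ ι) {v v' : ι → ℝ} {B : ℝ}
    (h : ∀ s, B ≤ v' s - v s) (s : ι) :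
    α * B + (1 - α) * (v' s - v s) ≤ T v' s - T v s := by
  have := hT.increment_le hα₀ hK (v := v') (v' := v) (B := -B) (fun s => by linarith [h s]) s
  linarith

theorem IsBellman.iterate_mono (hT : IsBellman α K T) (hα₀ : 0 ≤ α) (hα : α < 1)
    (hK : ∀ s, ∀ k ∈ K s, 0 ≤ k.1 ∧ k.2 ∈ stdSimplex ℝ ι) (n : ℕ) :
    ∀ s, 0 ≤ T^[n + 1] 0 s - T^[n] 0 s := by
  induction n with
  | zero =>
    intro s
    obtain ⟨⟨k, hk, hkv⟩, -⟩ := hT 0 s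
    have := (hK s k hk).1
    simp at hkv ⊢
    linarith
  | succ n ih =>
    intro s
    have := hT.le_increment hα₀ (fun s k hk => (hK s k hk).2) ih s
    rw [← Function.iterate_succ_apply' T, ← Function.iterate_succ_apply' T] at this
    nlinarith [ih s]

/-- The iterates from `0` increase, as costs are nonnegative. Hence `x s ≤ T x s`, and bounding `T x
s` by a choice that moves to `t` with weight at least `β` gives the hypothesis of
`exists_span_bound`. `W` is fixed before `K` and `T`, so that it cannot depend on the samples. -/
theorem IsBellman.exists_span_iterate_le {r : ι → ι → Prop}
    (hr : ∀ i j, Relation.ReflTransGen r i j) {α β c : ℝ} (hβ : 0 < β) (hα₀ : 0 < α) (hα : α < 1) :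
    ∃ W, ∀ (K : ι → Set (ℝ × (ι → ℝ))) (T : (ι → ℝ) → ι → ℝ), IsBellman α K T →
      (∀ s, ∀ k ∈ K s, 0 ≤ k.1 ∧ k.2 ∈ stdSimplex ℝ ι) →
      (∀ s t, r s t → ∃ k ∈ K s, k.1 ≤ c ∧ β ≤ k.2 t) →
      ∀ n i j, T^[n] 0 i - T^[n] 0 j ≤ W := by
  obtain ⟨W, hW⟩ := exists_span_bound hr (C := c / α) hβ
  refine ⟨W, fun K T hT hK hrK n => hW _ fun X hX s t hst => ?_⟩
  obtain ⟨k, hk, hc, ht⟩ := hrK s t hst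
  have h1 := hT.iterate_mono hα₀.le hα hK n s
  rw [Function.iterate_succ_apply'] at h1
  set x := T^[n] 0
  have h2 := (hT x s).2 ⟨k, hk, rfl⟩
  simp only at h2
  have h3 : ∑ j, k.2 j * x j ≤ β * x t + (1 - β) * X := by
    have e : ∑ j, k.2 j * (X - x j) = X - ∑ j, k.2 j * x j := by
      simp [mul_sub, Finset.sum_sub_distrib, ← Finset.sum_mul, (hK s k hk).2.2]
    have h4 : k.2 t * (X - x t) ≤ ∑ j, k.2 j * (X - x j) :=
      Finset.single_le_sum (f := fun j => k.2 j * (X - x j))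
        (fun j _ => mul_nonneg ((hK s k hk).2.1 j) (by linarith [hX j])) (Finset.mem_univ t)
    nlinarith [hX t]
  have h4 : x s * α ≤ c + α * (β * x t + (1 - β) * X) := by
    nlinarith [mul_le_mul_of_nonneg_left h3 hα₀.le]
  rw [← le_div_iff₀ hα₀] at h4
  rw [add_div, mul_div_cancel_left₀ _ hα₀.ne'] at h4
  linarith

theorem IsBellman.increments_converge [Nonempty ι] (hT : IsBellman α K T) (hα₀ : 0 ≤ α)
    (hα : α < 1) (hK : ∀ s, ∀ k ∈ K s, k.2 ∈ stdSimplex ℝ ι) {W : ℝ}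
    (hW : ∀ n i j, T^[n] 0 i - T^[n] 0 j ≤ W) :
    ∃ g, ∀ e > 0, ∃ n₀, ∀ n ≥ n₀, ∀ s, |T^[n + 1] 0 s - T^[n] 0 s - g| ≤ e := by
  refine PlanRec.increments_converge hα₀ hα (fun n B hB s => ?_) (fun n B hB s => ?_) hW
  · have := hT.increment_le hα₀ hK hB s
    rwa [← Function.iterate_succ_apply' T, ← Function.iterate_succ_apply' T] at this
  · have := hT.le_increment hα₀ hK hB s
    rwa [← Function.iterate_succ_apply' T, ← Function.iterate_succ_apply' T] at this

end ValueIteration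
end PlanRec

/-! ### Coefficients of ergodicity and approximate Poisson solutions -/

namespace PlanRec

section Ergodicity

variable {ι : Type*} [Fintype ι]

/-- Centre `v` at the midpoint of its range, which does not change the sum; its entries are then at
most `c / 2` in absolute value. -/
theorem abs_sum_mul_le_of_sum_eq_zero {d v : ι → ℝ} (hd : ∑ k, d k = 0) {c : ℝ}
    (hv : ∀ i j, v i - v j ≤ c) : |∑ k, d k * v k| ≤ (1 / 2 * ∑ k, |d k|) * c := by
  rcases isEmpty_or_nonempty ι with h | h
  · simp
  obtain ⟨i₀, hi⟩ := Finite.exists_max v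
  obtain ⟨j₀, hj⟩ := Finite.exists_min v
  set t := (v i₀ + v j₀) / 2 with ht
  have e : ∑ k, d k * v k = ∑ k, d k * (v k - t) := by
    simp [mul_sub, Finset.sum_sub_distrib, ← Finset.sum_mul, hd]
  rw [e]
  calc |∑ k, d k * (v k - t)| ≤ ∑ k, |d k * (v k - t)| := Finset.abs_sum_le_sum_abs _ _
    _ ≤ ∑ k, |d k| * (c / 2) := by
        refine Finset.sum_le_sum fun k _ => ?_
        rw [abs_mul]
        refine mul_le_mul_of_nonneg_left (abs_le.2 ?_) (abs_nonneg _)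
        constructor <;> linarith [hi k, hj k, hv i₀ j₀]
    _ = _ := by rw [← Finset.sum_mul]; ring

theorem le_ergCoeff (B : Matrix ι ι ℝ) (i j : ι) :
    1 / 2 * ∑ k, |B i k - B j k| ≤ ergCoeff B := by
  unfold ergCoeff
  have : ∑ k, |B i k - B j k| ≤ ⨆ ij : ι × ι, ∑ k, |B ij.1 k - B ij.2 k| :=
    le_ciSup (f := fun ij : ι × ι => ∑ k, |B ij.1 k - B ij.2 k|)
      (Set.finite_range _).bddAbove (i, j)
  linarith

theorem exists_eq_ergCoeff [Nonempty ι] (B : Matrix ι ι ℝ) :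
    ∃ i j, ergCoeff B = 1 / 2 * ∑ k, |B i k - B j k| := by
  obtain ⟨ij, h⟩ := exists_eq_ciSup_of_finite (f := fun ij : ι × ι => ∑ k, |B ij.1 k - B ij.2 k|)
  exact ⟨ij.1, ij.2, by unfold ergCoeff; rw [← h]⟩

theorem ergCoeff_nonneg [Nonempty ι] (B : Matrix ι ι ℝ) : 0 ≤ ergCoeff B := by
  obtain ⟨i, j, h⟩ := exists_eq_ergCoeff B
  rw [h]
  positivity

theorem ergCoeff_le_add [Nonempty ι] {B B' : Matrix ι ι ℝ} {D : ℝ}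
    (h : ∀ i, ∑ k, |B i k - B' i k| ≤ D) : ergCoeff B ≤ ergCoeff B' + D := by
  obtain ⟨i, j, hij⟩ := exists_eq_ergCoeff B
  have h1 : ∑ k, |B i k - B j k| ≤
      ∑ k, |B i k - B' i k| + ∑ k, |B j k - B' j k| + ∑ k, |B' i k - B' j k| := by
    rw [← Finset.sum_add_distrib, ← Finset.sum_add_distrib]
    refine Finset.sum_le_sum fun k _ => ?_
    have e : B i k - B j k = (B i k - B' i k) - (B j k - B' j k) + (B' i k - B' j k) := by ring
    rw [e]
    exact (abs_add_le _ _).trans (add_le_add_left (abs_sub _ _) _)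
  linarith [le_ergCoeff B' i j, h i, h j]

variable [DecidableEq ι] {B B' : Matrix ι ι ℝ}

theorem sum_row (hB : B ∈ Matrix.rowStochastic ℝ ι) (i : ι) : ∑ j, B i j = 1 :=
  Matrix.sum_row_of_mem_rowStochastic hB i

theorem mulVec_sub_le_ergCoeff (hB : B ∈ Matrix.rowStochastic ℝ ι) {v : ι → ℝ} {c : ℝ}
    (hv : ∀ i j, v i - v j ≤ c) (i j : ι) :
    (B.mulVec v) i - (B.mulVec v) j ≤ ergCoeff B * c := by
  have h := abs_sum_mul_le_of_sum_eq_zero (d := fun k => B i k - B j k)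
    (by rw [Finset.sum_sub_distrib, sum_row hB, sum_row hB, sub_self]) hv
  have hc : 0 ≤ c := by simpa using hv i i
  have e : ∑ k, (B i k - B j k) * v k = (B.mulVec v) i - (B.mulVec v) j := by
    simp [Matrix.mulVec, dotProduct, sub_mul, Finset.sum_sub_distrib]
  rw [← e]
  exact (le_abs_self _).trans (h.trans (mul_le_mul_of_nonneg_right (le_ergCoeff B i j) hc))

/-- Total variation distance is one minus the overlap. This turns `ergCoeff B < 1` into a condition
on the zero pattern of `B`. -/
theorem half_sum_abs_sub_row (hB : B ∈ Matrix.rowStochastic ℝ ι) (i j : ι) :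
    1 / 2 * ∑ k, |B i k - B j k| = 1 - ∑ k, min (B i k) (B j k) := by
  have e : ∀ k, |B i k - B j k| = B i k + B j k - 2 * min (B i k) (B j k) := fun k => by
    rcases le_total (B i k) (B j k) with h | h
    · rw [abs_of_nonpos (by linarith), min_eq_left h]; ring
    · rw [abs_of_nonneg (by linarith), min_eq_right h]; ring
  simp only [e, Finset.sum_sub_distrib, Finset.sum_add_distrib, sum_row hB, ← Finset.mul_sum]
  ring

theorem ergCoeff_lt_one_iff [Nonempty ι] (hB : B ∈ Matrix.rowStochastic ℝ ι) :
    ergCoeff B < 1 ↔ ∀ i j, ∃ k, 0 < B i k ∧ 0 < B j k := by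
  constructor
  · intro h i j
    have h1 := (le_ergCoeff B i j).trans_lt h
    rw [half_sum_abs_sub_row hB] at h1
    have h2 : 0 < ∑ k, min (B i k) (B j k) := by linarith
    obtain ⟨k, -, hk⟩ := Finset.exists_lt_of_sum_lt (s := Finset.univ) (f := fun _ : ι => (0 : ℝ))
      (by simpa using h2)
    exact ⟨k, lt_min_iff.1 hk⟩
  · intro h
    obtain ⟨i, j, hij⟩ := exists_eq_ergCoeff B
    rw [hij, half_sum_abs_sub_row hB]
    obtain ⟨k, hk⟩ := h i j
    have : 0 < ∑ k, min (B i k) (B j k) := Finset.sum_pos'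
      (fun k _ => le_min (Matrix.nonneg_of_mem_rowStochastic hB)
        (Matrix.nonneg_of_mem_rowStochastic hB)) ⟨k, Finset.mem_univ k, lt_min_iff.2 hk⟩
    linarith

/-- Split `B^(m+1) - B'^(m+1) = B^m (B - B') + (B^m - B'^m) B'`. Multiplication by stochastic
matrices does not enlarge the row errors, so they grow only linearly in `m`. -/
theorem sum_abs_pow_sub_le (hB : B ∈ Matrix.rowStochastic ℝ ι)
    (hB' : B' ∈ Matrix.rowStochastic ℝ ι) {D : ℝ} (h : ∀ i, ∑ k, |B i k - B' i k| ≤ D) (m : ℕ) :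
    ∀ i, ∑ k, |(B ^ m) i k - (B' ^ m) i k| ≤ m * D := by
  induction m with
  | zero => simp
  | succ m ih =>
    intro i
    have e : ∀ k, (B ^ (m + 1)) i k - (B' ^ (m + 1)) i k =
        ∑ l, ((B ^ m) i l * (B l k - B' l k) + ((B ^ m) i l - (B' ^ m) i l) * B' l k) := fun k => by
      rw [pow_succ, pow_succ, Matrix.mul_apply, Matrix.mul_apply, ← Finset.sum_sub_distrib]
      exact Finset.sum_congr rfl fun l _ => by ring
    have hP := pow_mem hB m
    calc ∑ k, |(B ^ (m + 1)) i k - (B' ^ (m + 1)) i k|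
        ≤ ∑ k, ∑ l, ((B ^ m) i l * |B l k - B' l k| + |(B ^ m) i l - (B' ^ m) i l| * B' l k) := by
          refine Finset.sum_le_sum fun k _ => ?_
          rw [e]
          refine (Finset.abs_sum_le_sum_abs _ _).trans (Finset.sum_le_sum fun l _ => ?_)
          refine (abs_add_le _ _).trans ?_
          rw [abs_mul, abs_mul, abs_of_nonneg (Matrix.nonneg_of_mem_rowStochastic hP),
            abs_of_nonneg (Matrix.nonneg_of_mem_rowStochastic hB')]
      _ = ∑ l, ((B ^ m) i l * ∑ k, |B l k - B' l k|) + ∑ l, |(B ^ m) i l - (B' ^ m) i l| := by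
          rw [Finset.sum_comm]
          simp only [Finset.sum_add_distrib, ← Finset.mul_sum, sum_row hB', mul_one]
      _ ≤ ∑ l, (B ^ m) i l * D + m * D :=
          add_le_add (Finset.sum_le_sum fun l _ => mul_le_mul_of_nonneg_left (h l)
            (Matrix.nonneg_of_mem_rowStochastic hP)) (ih i)
      _ = (m + 1 : ℕ) * D := by rw [← Finset.sum_mul, sum_row hP]; push_cast; ring

theorem mulVec_le_of_le (hB : B ∈ Matrix.rowStochastic ℝ ι) {v : ι → ℝ} {b : ℝ}
    (h : ∀ j, v j ≤ b) (i : ι) : B.mulVec v i ≤ b :=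
  sum_mul_le_of_mem_stdSimplex ⟨fun _ => Matrix.nonneg_of_mem_rowStochastic hB, sum_row hB i⟩ h

/-- Lower and upper bounds for the same average cost are compatible. -/
theorem poisson_bounds_le [Nonempty ι] (hB : B ∈ Matrix.rowStochastic ℝ ι) {c h h' : ι → ℝ}
    {a b : ℝ} (ha : ∀ i, a ≤ c i + B.mulVec h i - h i)
    (hb : ∀ i, c i + B.mulVec h' i - h' i ≤ b) : a ≤ b := by
  -- At a maximizer, averaging by `B` cannot increase `h - h'`.
  obtain ⟨i, hi⟩ := Finite.exists_max (h - h')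
  have h1 := mulVec_le_of_le hB hi i
  rw [Matrix.mulVec_sub] at h1
  simp only [Pi.sub_apply] at h1
  linarith [ha i, hb i]

theorem pow_mulVec_sub_le (hB : B ∈ Matrix.rowStochastic ℝ ι) {v : ι → ℝ} {c : ℝ}
    (hv : ∀ i j, v i - v j ≤ c) (n : ℕ) :
    ∀ i j, ((B ^ n).mulVec v) i - ((B ^ n).mulVec v) j ≤ ergCoeff B ^ n * c := by
  induction n with
  | zero => simpa using hv
  | succ n ih =>
    intro i j
    rw [pow_succ', ← Matrix.mulVec_mulVec, pow_succ', mul_assoc]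
    exact mulVec_sub_le_ergCoeff hB ih i j

theorem ergCoeff_le_one [Nonempty ι] (hB : B ∈ Matrix.rowStochastic ℝ ι) : ergCoeff B ≤ 1 := by
  obtain ⟨i, j, hij⟩ := exists_eq_ergCoeff B
  rw [hij, half_sum_abs_sub_row hB]
  have : 0 ≤ ∑ k, min (B i k) (B j k) := Finset.sum_nonneg
      (fun k _ => le_min (Matrix.nonneg_of_mem_rowStochastic hB)
        (Matrix.nonneg_of_mem_rowStochastic hB))
  linarith

/-- Take the truncated Neumann series `h = ∑_{t < q m} B^t c`, grouped into blocks of length `m`.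
The residual is `B^(q m) c`, of oscillation at most `Δ^q C`, while the geometric series bounds the
oscillation of `h` independently of `q`. Truncation makes a stationary distribution unnecessary. -/
theorem exists_approx_poisson [Nonempty ι] (hB : B ∈ Matrix.rowStochastic ℝ ι) {m : ℕ}
    (hm : ergCoeff (B ^ m) < 1) {c : ι → ℝ} {C : ℝ} (hc : ∀ i j, c i - c j ≤ C) {e : ℝ}
    (he : 0 < e) :
    ∃ h : ι → ℝ, (∀ i j, h i - h j ≤ m * C / (1 - ergCoeff (B ^ m))) ∧
      ∀ i j, (c i + B.mulVec h i - h i) - (c j + B.mulVec h j - h j) ≤ e := by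
  set A := B ^ m with hA
  have hAs : A ∈ Matrix.rowStochastic ℝ ι := pow_mem hB m
  have hD0 := ergCoeff_nonneg A
  have hC : 0 ≤ C := by
    have := hc (Classical.arbitrary ι) (Classical.arbitrary ι)
    simpa using this
  set k : ι → ℝ := ∑ t ∈ Finset.range m, (B ^ t).mulVec c with hk
  have hkB : B.mulVec k - k = A.mulVec c - c := by
    rw [hk, Matrix.mulVec_sum, ← Finset.sum_sub_distrib]
    have := Finset.sum_range_sub (fun t => (B ^ t).mulVec c) m
    simp only [pow_zero, Matrix.one_mulVec] at this
    rw [← this]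
    refine Finset.sum_congr rfl fun t _ => ?_
    rw [Matrix.mulVec_mulVec, ← pow_succ']
  have hkosc : ∀ i j, k i - k j ≤ m * C := fun i j => by
    rw [hk, Finset.sum_apply, Finset.sum_apply, ← Finset.sum_sub_distrib]
    have : ∀ t ∈ Finset.range m, (B ^ t).mulVec c i - (B ^ t).mulVec c j ≤ C := fun t _ => by
      have h1 := pow_mulVec_sub_le hB hc t i j
      have h2 := pow_le_one₀ (n := t) (ergCoeff_nonneg B) (ergCoeff_le_one hB)
      nlinarith
    simpa using Finset.sum_le_sum this
  obtain ⟨q, hq⟩ := exists_pow_lt_of_lt_one (show 0 < e / (C + 1) by positivity) hm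
  rw [lt_div_iff₀ (by positivity)] at hq
  refine ⟨∑ t ∈ Finset.range q, (A ^ t).mulVec k, fun i j => ?_, fun i j => ?_⟩
  · rw [Finset.sum_apply, Finset.sum_apply, ← Finset.sum_sub_distrib]
    calc ∑ t ∈ Finset.range q, ((A ^ t).mulVec k i - (A ^ t).mulVec k j)
        ≤ ∑ t ∈ Finset.range q, ergCoeff A ^ t * (m * C) :=
          Finset.sum_le_sum fun t _ => pow_mulVec_sub_le hAs hkosc t i j
      _ = (∑ t ∈ Finset.range q, ergCoeff A ^ t) * (m * C) := by rw [Finset.sum_mul]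
      _ ≤ (1 - ergCoeff A)⁻¹ * (m * C) := by
          refine mul_le_mul_of_nonneg_right ?_ (by positivity)
          rw [← tsum_geometric_of_lt_one hD0 hm]
          exact (summable_geometric_of_lt_one hD0 hm).sum_le_tsum _ fun t _ => pow_nonneg hD0 t
      _ = _ := by rw [div_eq_inv_mul]
  · have hs : ∀ i, c i + B.mulVec (∑ t ∈ Finset.range q, (A ^ t).mulVec k) i -
        (∑ t ∈ Finset.range q, (A ^ t).mulVec k) i = (A ^ q).mulVec c i := fun i => by
      have h1 : B.mulVec (∑ t ∈ Finset.range q, (A ^ t).mulVec k) -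
          ∑ t ∈ Finset.range q, (A ^ t).mulVec k = (A ^ q).mulVec c - c := by
        have := Finset.sum_range_sub (fun t => (A ^ t).mulVec c) q
        simp only [pow_zero, Matrix.one_mulVec] at this
        rw [← this, Matrix.mulVec_sum, ← Finset.sum_sub_distrib]
        refine Finset.sum_congr rfl fun t _ => ?_
        have hcomm : B * A ^ t = A ^ t * B := by
          rw [hA, ← pow_mul, ← pow_succ, ← pow_succ']
        rw [Matrix.mulVec_mulVec, hcomm, ← Matrix.mulVec_mulVec, ← Matrix.mulVec_sub, hkB,
          Matrix.mulVec_sub, Matrix.mulVec_mulVec, ← pow_succ]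
      have h2 := congrFun h1 i
      simp only [Pi.sub_apply] at h2
      linarith
    rw [hs, hs]
    have := pow_mulVec_sub_le hAs hc q i j
    have := pow_nonneg hD0 q
    nlinarith

theorem pow_pos_iff_of_pattern (hB : B ∈ Matrix.rowStochastic ℝ ι)
    (hB' : B' ∈ Matrix.rowStochastic ℝ ι) (h : ∀ i j, 0 < B i j ↔ 0 < B' i j) (m : ℕ) :
    ∀ i j, 0 < (B ^ m) i j ↔ 0 < (B' ^ m) i j := by
  have step : ∀ {B : Matrix ι ι ℝ}, B ∈ Matrix.rowStochastic ℝ ι → ∀ m i j,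
      0 < (B ^ (m + 1)) i j ↔ ∃ k, 0 < (B ^ m) i k ∧ 0 < B k j := by
    intro B hB m i j
    rw [pow_succ, Matrix.mul_apply]
    have hnn : ∀ k, 0 ≤ (B ^ m) i k * B k j := fun k =>
      mul_nonneg (Matrix.nonneg_of_mem_rowStochastic (pow_mem hB m))
        (Matrix.nonneg_of_mem_rowStochastic hB)
    rw [Finset.sum_pos_iff_of_nonneg fun k _ => hnn k]
    constructor
    · rintro ⟨k, -, hk⟩
      exact ⟨k, (pos_and_pos_or_neg_and_neg_of_mul_pos hk).resolve_right fun h =>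
        absurd h.2 (not_lt.2 (Matrix.nonneg_of_mem_rowStochastic hB))⟩
    · rintro ⟨k, h1, h2⟩
      exact ⟨k, Finset.mem_univ k, mul_pos h1 h2⟩
  induction m with
  | zero => simp
  | succ m ih =>
    intro i j
    rw [step hB, step hB']
    simp only [ih, h]

theorem pow_mul_pos (hB : B ∈ Matrix.rowStochastic ℝ ι) {m : ℕ} {i k j : ι}
    (h₁ : 0 < (B ^ m) i k) (h₂ : 0 < B k j) : 0 < (B ^ (m + 1)) i j := by
  rw [pow_succ, Matrix.mul_apply]
  exact Finset.sum_pos' (fun l _ => mul_nonneg (Matrix.nonneg_of_mem_rowStochastic (pow_mem hB m))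
    (Matrix.nonneg_of_mem_rowStochastic hB)) ⟨k, Finset.mem_univ k, mul_pos h₁ h₂⟩

/-- Two walks that can meet in a state can both stay there, by the positive diagonal. -/
theorem ergCoeff_pow_lt_one_mono [Nonempty ι] (hB : B ∈ Matrix.rowStochastic ℝ ι)
    (hdiag : ∀ i, 0 < B i i) {m n : ℕ} (hmn : m ≤ n) (h : ergCoeff (B ^ m) < 1) :
    ergCoeff (B ^ n) < 1 := by
  induction n, hmn using Nat.le_induction with
  | base => exact h
  | succ n _ ih =>
    rw [ergCoeff_lt_one_iff (pow_mem hB _)] at ih ⊢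
    intro i j
    obtain ⟨k, h1, h2⟩ := ih i j
    exact ⟨k, pow_mul_pos hB h1 (hdiag k), pow_mul_pos hB h2 (hdiag k)⟩

/-- By the positive diagonal, an entry reached along a path is positive in all later powers. Hence a
whole column is positive in some power, and it is common to all rows. -/
theorem exists_ergCoeff_pow_lt_one [Nonempty ι] (hB : B ∈ Matrix.rowStochastic ℝ ι)
    (hdiag : ∀ i, 0 < B i i) (hirr : ∀ i j, Relation.ReflTransGen (fun i j => 0 < B i j) i j) :
    ∃ n, 1 ≤ n ∧ ergCoeff (B ^ n) < 1 := by
  have h : ∀ i j, ∃ l, ∀ n ≥ l, 0 < (B ^ n) i j := by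
    intro i j
    induction hirr i j with
    | refl =>
      refine ⟨0, fun n _ => ?_⟩
      induction n with
      | zero => simp
      | succ n ih => exact pow_mul_pos hB (ih (Nat.zero_le n)) (hdiag i)
    | tail _ hbc ih =>
      obtain ⟨l, hl⟩ := ih
      refine ⟨l + 1, fun n hn => ?_⟩
      obtain ⟨n, rfl⟩ : ∃ n', n = n' + 1 := ⟨n - 1, by omega⟩
      exact pow_mul_pos hB (hl n (by omega)) hbc
  choose l hl using h
  obtain ⟨k⟩ := ‹Nonempty ι›
  refine ⟨max 1 (Finset.univ.sup fun i => l i k), le_max_left _ _, ?_⟩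
  have : Nonempty ι := ⟨k⟩
  rw [ergCoeff_lt_one_iff (pow_mem hB _)]
  have hp : ∀ i, 0 < (B ^ max 1 (Finset.univ.sup fun i => l i k)) i k := fun i =>
    hl i k _ (le_max_of_le_right (Finset.le_sup (f := fun i => l i k) (Finset.mem_univ i)))
  exact fun i j => ⟨k, hp i, hp j⟩

end Ergodicity
end PlanRec

/-! ### The chains of the η-greedy policies -/

namespace PlanRec.MDP.EndComponent

section Chain

variable {S Act : Type*} [Fintype S] [Fintype Act] {M : MDP S Act} (E : M.EndComponent)

instance : Nonempty E.states := E.nonempty.to_subtype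

instance (s : E.states) : Nonempty {a // a ∈ E.acts s} := (E.acts_nonempty s s.2).to_subtype

/-- `Q` is a transition function on the end component with the same support as the true one. -/
def IsDyn (Q : S → Act → S → ℝ) : Prop :=
  ∀ s ∈ E.states, ∀ a ∈ E.acts s, Q s a ∈ stdSimplex ℝ S ∧
    ∀ s', 0 < Q s a s' ↔ 0 < M.prob s a s'

theorem isDyn_prob : E.IsDyn M.prob := fun s _ a _ =>
  ⟨⟨M.prob_nonneg s a, M.sum_prob s a⟩, fun _ => Iff.rfl⟩

variable {E} {Q Q' : S → Act → S → ℝ} {α η : ℝ}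

theorem IsDyn.eq_zero (hQ : E.IsDyn Q) {s : S} (hs : s ∈ E.states) {a : Act} (ha : a ∈ E.acts s)
    {s' : S} (hs' : s' ∉ E.states) : Q s a s' = 0 := by
  obtain ⟨⟨h1, _⟩, h2⟩ := hQ s hs a ha
  by_contra h
  exact hs' (E.closed s hs a ha s' ((h2 s').1 (lt_of_le_of_ne (h1 s') (Ne.symm h))))

theorem sum_states_eq {f : S → ℝ} (hf : ∀ s ∉ E.states, f s = 0) :
    ∑ s : E.states, f s = ∑ s, f s := by
  rw [Finset.sum_coe_sort E.states f]
  exact Finset.sum_subset (Finset.subset_univ _) fun s _ hs => hf s hs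

theorem IsDyn.mem_stdSimplex (hQ : E.IsDyn Q) (s : E.states) {a : Act} (ha : a ∈ E.acts s) :
    (fun s' : E.states => Q s a s') ∈ stdSimplex ℝ E.states := by
  refine ⟨fun s' => (hQ s s.2 a ha).1.1 s', ?_⟩
  rw [sum_states_eq fun s' hs' => hQ.eq_zero s.2 ha hs']
  exact (hQ s s.2 a ha).1.2

theorem etaWeight_eq_zero (d : E.DetPolicy) (s : E.states) {a : Act} (ha : a ∉ E.acts s) :
    E.etaWeight η d s a = 0 := by
  have : a ≠ d s := fun h => ha (h ▸ (d s).2)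
  simp [etaWeight, ha, this]

theorem etaWeight_pos (hη : 0 < η) (hη₁ : η ≤ 1) (d : E.DetPolicy) (s : E.states) {a : Act}
    (ha : a ∈ E.acts s) : 0 < E.etaWeight η d s a := by
  classical
  have h1 : 0 < ((E.acts s).card : ℝ)⁻¹ := by
    have := Finset.card_pos.2 ⟨a, ha⟩
    positivity
  unfold etaWeight
  rw [if_pos ha]
  have h2 : 0 ≤ (1 - η) * (if a = d s then 1 else 0 : ℝ) :=
    mul_nonneg (by linarith) (by split_ifs <;> norm_num)
  have := add_pos_of_nonneg_of_pos h2 (mul_pos hη h1)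
  convert! this

theorem etaWeight_nonneg (hη : 0 < η) (hη₁ : η ≤ 1) (d : E.DetPolicy) (s : E.states) (a : Act) :
    0 ≤ E.etaWeight η d s a := by
  by_cases ha : a ∈ E.acts s
  · exact (etaWeight_pos hη hη₁ d s ha).le
  · rw [etaWeight_eq_zero d s ha]

/-- Averages over the actions of the `η`-greedy policy. -/
theorem sum_etaWeight_mul (d : E.DetPolicy) (s : E.states) (f : Act → ℝ) :
    ∑ a, E.etaWeight η d s a * f a =
      (1 - η) * f (d s) + η * (((E.acts s).card : ℝ)⁻¹ * ∑ a ∈ E.acts s, f a) := by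
  classical
  have : ∀ a, E.etaWeight η d s a * f a = (1 - η) * (if a = d s then f a else 0) +
      η * (((E.acts s).card : ℝ)⁻¹ * (if a ∈ E.acts s then f a else 0)) := fun a => by
    unfold etaWeight
    split_ifs <;> ring
  simp only [this, Finset.sum_add_distrib, ← Finset.mul_sum]
  simp

theorem sum_etaWeight (d : E.DetPolicy) (s : E.states) : ∑ a, E.etaWeight η d s a = 1 := by
  have := sum_etaWeight_mul (η := η) d s fun _ => 1
  simp only [mul_one, Finset.sum_const, nsmul_eq_mul] at this
  rw [this, inv_mul_cancel₀]
  · ring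
  · have := Finset.card_pos.2 (E.acts_nonempty s s.2)
    positivity

theorem chain_apply (Q : S → Act → S → ℝ) (w : E.states → Act → ℝ) (s s' : E.states)
    [DecidableEq E.states] :
    E.chain α Q w s s' = α * (∑ a, w s a * Q s a s') + (1 - α) * (1 : Matrix _ _ ℝ) s s' := by
  unfold chain
  simp only [Matrix.add_apply, Matrix.smul_apply, Matrix.of_apply, smul_eq_mul]
  congr!

/-- The zero pattern depends neither on `d` nor on the choice of `Q` among dynamics with the true
support. This is why the optimistic and the true dynamics have the same exponent `m`. -/
theorem chain_pos_iff (hα₀ : 0 < α) (hα : α < 1) (hη : 0 < η) (hη₁ : η ≤ 1) (hQ : E.IsDyn Q)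
    (d : E.DetPolicy) (s s' : E.states) :
    0 < E.chain α Q (E.etaWeight η d) s s' ↔ s = s' ∨ ∃ a ∈ E.acts s, 0 < M.prob s a s' := by
  classical
  rw [chain_apply]
  have hnn : ∀ a, 0 ≤ E.etaWeight η d s a * Q s a s' := fun a => by
    by_cases ha : a ∈ E.acts s
    · exact mul_nonneg (etaWeight_nonneg hη hη₁ d s a) ((hQ s s.2 a ha).1.1 s')
    · simp [etaWeight_eq_zero d s ha]
  have hs0 := Finset.sum_nonneg fun a (_ : a ∈ Finset.univ) => hnn a
  constructor
  · intro h
    by_cases hss : s = s'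
    · exact Or.inl hss
    · right
      rw [Matrix.one_apply_ne hss, mul_zero, add_zero] at h
      have h2 := (Finset.sum_pos_iff_of_nonneg fun a _ => hnn a).1 (pos_of_mul_pos_right h hα₀.le)
      obtain ⟨a, -, ha⟩ := h2
      have haE : a ∈ E.acts s := by
        by_contra hc
        simp [etaWeight_eq_zero d s hc] at ha
      exact ⟨a, haE, ((hQ s s.2 a haE).2 s').1
        (pos_of_mul_pos_right ha (etaWeight_nonneg hη hη₁ d s a))⟩
  · rintro (rfl | ⟨a, ha, hp⟩)
    · rw [Matrix.one_apply_eq]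
      nlinarith [mul_nonneg hα₀.le hs0]
    · have h1 : 0 < ∑ a, E.etaWeight η d s a * Q s a s' := Finset.sum_pos' (fun a _ => hnn a)
        ⟨a, Finset.mem_univ a, mul_pos (etaWeight_pos hη hη₁ d s ha)
          (((hQ s s.2 a ha).2 s').2 hp)⟩
      have h2 : 0 ≤ (1 - α) * (1 : Matrix E.states E.states ℝ) s s' :=
        mul_nonneg (by linarith) (by rw [Matrix.one_apply]; split_ifs <;> norm_num)
      have := mul_pos hα₀ h1
      linarith

theorem chain_mem_rowStochastic (hα₀ : 0 < α) (hα : α < 1) (hη : 0 < η) (hη₁ : η ≤ 1)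
    (hQ : E.IsDyn Q) (d : E.DetPolicy) [DecidableEq E.states] :
    E.chain α Q (E.etaWeight η d) ∈ Matrix.rowStochastic ℝ E.states := by
  rw [Matrix.mem_rowStochastic_iff_sum]
  have hnn : ∀ s s' : E.states, ∀ a, 0 ≤ E.etaWeight η d s a * Q s a s' := fun s s' a => by
    by_cases ha : a ∈ E.acts s
    · exact mul_nonneg (etaWeight_nonneg hη hη₁ d s a) ((hQ s s.2 a ha).1.1 s')
    · simp [etaWeight_eq_zero d s ha]
  refine ⟨fun s s' => ?_, fun s => ?_⟩
  · rw [chain_apply]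
    refine add_nonneg (mul_nonneg hα₀.le (Finset.sum_nonneg fun a _ => hnn s s' a))
      (mul_nonneg (by linarith) ?_)
    rw [Matrix.one_apply]; split_ifs <;> norm_num
  · simp only [chain_apply, Finset.sum_add_distrib, ← Finset.mul_sum]
    rw [Finset.sum_comm]
    have h1 : ∀ a, ∑ s' : E.states, E.etaWeight η d s a * Q s a s' = E.etaWeight η d s a :=
      fun a => by
        by_cases ha : a ∈ E.acts s
        · rw [← Finset.mul_sum, (hQ.mem_stdSimplex s ha).2, mul_one]
        · simp [etaWeight_eq_zero d s ha]
    simp only [h1, sum_etaWeight]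
    simp [Matrix.one_apply]

theorem chain_irreducible (hα₀ : 0 < α) (hα : α < 1) (hη : 0 < η) (hη₁ : η ≤ 1)
    (hQ : E.IsDyn Q) (d : E.DetPolicy) (s s' : E.states) :
    Relation.ReflTransGen (fun i j => 0 < E.chain α Q (E.etaWeight η d) i j) s s' := by
  have key : ∀ t : S, Relation.ReflTransGen
      (fun x y => x ∈ E.states ∧ ∃ a ∈ E.acts x, 0 < M.prob x a y) s t → ∀ ht : t ∈ E.states,
      Relation.ReflTransGen (fun i j => 0 < E.chain α Q (E.etaWeight η d) i j) s ⟨t, ht⟩ := by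
    intro t h
    induction h with
    | refl => exact fun _ => Relation.ReflTransGen.refl
    | tail _ hbc ih =>
      intro ht
      exact (ih hbc.1).tail ((chain_pos_iff hα₀ hα hη hη₁ hQ d ⟨_, hbc.1⟩ ⟨_, ht⟩).2
        (Or.inr hbc.2))
  exact key s' (E.connected s s.2 s' s'.2) s'.2

theorem erg_eq [DecidableEq E.states] (m : ℕ) (d : E.DetPolicy) :
    E.erg α η Q m d = ergCoeff (E.chain α Q (E.etaWeight η d) ^ m) := by
  unfold erg
  congr!

theorem exists_erg_lt_one (hα₀ : 0 < α) (hα : α < 1) (hη : 0 < η) (hη₁ : η ≤ 1)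
    (hQ : E.IsDyn Q) (d : E.DetPolicy) : ∃ n, 1 ≤ n ∧ E.erg α η Q n d < 1 := by
  classical
  have := exists_ergCoeff_pow_lt_one (chain_mem_rowStochastic hα₀ hα hη hη₁ hQ d)
    (fun i => (chain_pos_iff hα₀ hα hη hη₁ hQ d i i).2 (Or.inl rfl))
    (chain_irreducible hα₀ hα hη hη₁ hQ d)
  simpa only [erg_eq] using this

theorem erg_lt_one_iff (hα₀ : 0 < α) (hα : α < 1) (hη : 0 < η) (hη₁ : η ≤ 1)
    (hQ : E.IsDyn Q) (hQ' : E.IsDyn Q') (m : ℕ) (d : E.DetPolicy) :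
    E.erg α η Q m d < 1 ↔ E.erg α η Q' m d < 1 := by
  classical
  rw [erg_eq, erg_eq]
  have h := chain_mem_rowStochastic hα₀ hα hη hη₁ hQ d
  have h' := chain_mem_rowStochastic hα₀ hα hη hη₁ hQ' d
  rw [ergCoeff_lt_one_iff (pow_mem h m), ergCoeff_lt_one_iff (pow_mem h' m)]
  simp only [pow_pos_iff_of_pattern h h' (fun i j => by
    rw [chain_pos_iff hα₀ hα hη hη₁ hQ, chain_pos_iff hα₀ hα hη hη₁ hQ'])]

theorem mixExp_eq (hα₀ : 0 < α) (hα : α < 1) (hη : 0 < η) (hη₁ : η ≤ 1)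
    (hQ : E.IsDyn Q) (hQ' : E.IsDyn Q') : E.mixExp α η Q = E.mixExp α η Q' := by
  unfold mixExp
  simp only [erg_lt_one_iff hα₀ hα hη hη₁ hQ hQ']

theorem sInf_le_mixExp (Q : S → Act → S → ℝ) (d : E.DetPolicy) :
    sInf {m : ℕ | 1 ≤ m ∧ E.erg α η Q m d < 1} ≤ E.mixExp α η Q :=
  le_ciSup (f := fun d : E.DetPolicy => sInf {m : ℕ | 1 ≤ m ∧ E.erg α η Q m d < 1})
    (Set.finite_range _).bddAbove d

/-- The maximum over policies may exceed the least good exponent of `d`; monotonicity in the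
exponent covers the gap. -/
theorem erg_mixExp_lt_one (hα₀ : 0 < α) (hα : α < 1) (hη : 0 < η) (hη₁ : η ≤ 1)
    (hQ : E.IsDyn Q) (d : E.DetPolicy) : E.erg α η Q (E.mixExp α η Q) d < 1 := by
  have h := Nat.sInf_mem (s := {m : ℕ | 1 ≤ m ∧ E.erg α η Q m d < 1})
    (exists_erg_lt_one hα₀ hα hη hη₁ hQ d)
  classical
  simp only [Set.mem_ofPred_eq, erg_eq] at h
  rw [erg_eq]
  refine ergCoeff_pow_lt_one_mono (chain_mem_rowStochastic hα₀ hα hη hη₁ hQ d)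
    (fun i => (chain_pos_iff hα₀ hα hη hη₁ hQ d i i).2 (Or.inl rfl)) ?_ h.2
  simpa only [erg_eq] using sInf_le_mixExp (α := α) (η := η) Q d

instance : Nonempty E.DetPolicy := inferInstanceAs (Nonempty (∀ s : E.states, {a // a ∈ E.acts s}))

theorem one_le_mixExp (hα₀ : 0 < α) (hα : α < 1) (hη : 0 < η) (hη₁ : η ≤ 1)
    (hQ : E.IsDyn Q) : 1 ≤ E.mixExp α η Q := by
  obtain ⟨d⟩ : Nonempty E.DetPolicy := inferInstance
  exact (Nat.sInf_mem (s := {m : ℕ | 1 ≤ m ∧ E.erg α η Q m d < 1})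
    (exists_erg_lt_one hα₀ hα hη hη₁ hQ d)).1.trans (sInf_le_mixExp Q d)

theorem erg_le_ergBar (d : E.DetPolicy) :
    E.erg α η M.prob (E.mixExp α η M.prob) d ≤ E.ergBar α η :=
  le_ciSup (f := fun d => E.erg α η M.prob (E.mixExp α η M.prob) d)
    (Set.finite_range _).bddAbove d

theorem ergBar_lt_one (hα₀ : 0 < α) (hα : α < 1) (hη : 0 < η) (hη₁ : η ≤ 1) :
    E.ergBar α η < 1 := by
  obtain ⟨d, hd⟩ := exists_eq_ciSup_of_finite
    (f := fun d : E.DetPolicy => E.erg α η M.prob (E.mixExp α η M.prob) d)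
  unfold ergBar
  rw [← hd]
  exact erg_mixExp_lt_one hα₀ hα hη hη₁ E.isDyn_prob d

theorem ergBar_nonneg : 0 ≤ E.ergBar α η := by
  obtain ⟨d⟩ : Nonempty E.DetPolicy := inferInstance
  exact (ergCoeff_nonneg _).trans (erg_le_ergBar d)

theorem sum_abs_chain_sub_le (hα₀ : 0 < α) (hη : 0 < η) (hη₁ : η ≤ 1) (d : E.DetPolicy) {r : ℝ}
    (h : ∀ s ∈ E.states, ∀ a ∈ E.acts s, ∀ s', |Q s a s' - Q' s a s'| ≤ r) (s : E.states) :
    ∑ k, |E.chain α Q (E.etaWeight η d) s k - E.chain α Q' (E.etaWeight η d) s k| ≤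
      α * (E.states.card * r) := by
  classical
  have h1 : ∀ k : E.states,
      |E.chain α Q (E.etaWeight η d) s k - E.chain α Q' (E.etaWeight η d) s k| ≤ α * r := by
    intro k
    have e : E.chain α Q (E.etaWeight η d) s k - E.chain α Q' (E.etaWeight η d) s k =
        α * ∑ a, E.etaWeight η d s a * (Q s a k - Q' s a k) := by
      rw [chain_apply, chain_apply]
      simp only [mul_sub, Finset.sum_sub_distrib]
      ring
    rw [e, abs_mul, abs_of_pos hα₀]
    refine mul_le_mul_of_nonneg_left ?_ hα₀.le
    calc |∑ a, E.etaWeight η d s a * (Q s a k - Q' s a k)|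
        ≤ ∑ a, |E.etaWeight η d s a * (Q s a k - Q' s a k)| := Finset.abs_sum_le_sum_abs _ _
      _ ≤ ∑ a, E.etaWeight η d s a * r := by
          refine Finset.sum_le_sum fun a _ => ?_
          by_cases ha : a ∈ E.acts s
          · rw [abs_mul, abs_of_nonneg (etaWeight_nonneg hη hη₁ d s a)]
            exact mul_le_mul_of_nonneg_left (h s s.2 a ha k) (etaWeight_nonneg hη hη₁ d s a)
          · simp [etaWeight_eq_zero d s ha]
      _ = r := by rw [← Finset.sum_mul, sum_etaWeight, one_mul]
  calc _ ≤ ∑ k : E.states, α * r := Finset.sum_le_sum fun k _ => h1 k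
    _ = _ := by simp; ring

theorem mulVec_chain (d : E.DetPolicy) (Q : S → Act → S → ℝ) (v : E.states → ℝ) (s : E.states) :
    (E.chain α Q (E.etaWeight η d)).mulVec v s =
      ∑ a, E.etaWeight η d s a * (α * E.pair (Q s a) v + (1 - α) * v s) := by
  classical
  have h1 : ∑ a, E.etaWeight η d s a * (α * E.pair (Q s a) v + (1 - α) * v s) =
      α * ∑ a, E.etaWeight η d s a * E.pair (Q s a) v + (1 - α) * v s := by
    simp only [mul_add, Finset.sum_add_distrib, ← Finset.sum_mul, sum_etaWeight, one_mul]
    congr 1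
    rw [Finset.mul_sum]
    exact Finset.sum_congr rfl fun a _ => by ring
  rw [h1]
  simp only [Matrix.mulVec, dotProduct, chain_apply, add_mul, Finset.sum_add_distrib, pair]
  congr 1
  · simp only [Finset.mul_sum, Finset.sum_mul]
    rw [Finset.sum_comm]
    exact Finset.sum_congr rfl fun a _ => Finset.sum_congr rfl fun k _ => by ring
  · simp [Matrix.one_apply]

end Chain
end PlanRec.MDP.EndComponent

/-! ### A Bernstein bound with the empirical variance -/

namespace PlanRec

section Bernstein

/-- Both sides vanish at `p = q`; compare derivatives at `x ∈ [q, 1)`. With `D = x - q` and `v = q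
(1 - q)` they are at most `D / (v + D)` on the left and equal to `D / (x (1 - x))` on the right, and
`x (1 - x) ≤ v + D`. The variance is that of `q`, the empirical frequency, so the confidence width
can be computed from the samples. -/
theorem sq_div_le_kl {p q : ℝ} (hq : 0 < q) (hqp : q ≤ p) (hp : p < 1) :
    (p - q) ^ 2 / (2 * (q * (1 - q) + (p - q))) ≤
      q * (Real.log q - Real.log p) + (1 - q) * (Real.log (1 - q) - Real.log (1 - p)) := by
  set F : ℝ → ℝ := fun p => q * (Real.log q - Real.log p) +
    (1 - q) * (Real.log (1 - q) - Real.log (1 - p)) -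
      (p - q) ^ 2 / (2 * (q * (1 - q) + (p - q))) with hF
  have hv : 0 < q * (1 - q) := mul_pos hq (by linarith)
  have hd : ∀ x ∈ Set.Ico q 1, HasDerivAt F
      (q * (0 - 1 / x) + (1 - q) * (0 - (-1) / (1 - x)) -
        ((2 * (x - q) ^ 1 * 1) * (2 * (q * (1 - q) + (x - q))) - (x - q) ^ 2 * (2 * 1)) /
          (2 * (q * (1 - q) + (x - q))) ^ 2) x := by
    intro x hx
    have hx0 : 0 < x := hq.trans_le hx.1
    have hx1 : 0 < 1 - x := by linarith [hx.2]
    have hxq : 0 ≤ x - q := by linarith [hx.1]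
    have h1 : HasDerivAt (fun x : ℝ => Real.log x) (1 / x) x := by
      simpa using (hasDerivAt_id x).log hx0.ne'
    have h2 : HasDerivAt (fun x : ℝ => Real.log (1 - x)) ((-1) / (1 - x)) x :=
      ((hasDerivAt_id x).const_sub 1).log hx1.ne'
    have h3 : HasDerivAt (fun x : ℝ => x - q) 1 x := (hasDerivAt_id x).sub_const q
    have h4 : HasDerivAt (fun x : ℝ => 2 * (q * (1 - q) + (x - q))) (2 * 1) x :=
      (h3.const_add _).const_mul 2
    have h5 := (h3.pow 2).div h4 (by positivity)
    have h6 := (((hasDerivAt_const x (Real.log q)).sub h1).const_mul q).add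
      (((hasDerivAt_const x (Real.log (1 - q))).sub h2).const_mul (1 - q))
    have h7 := h6.sub h5
    refine h7.congr_deriv ?_
    norm_num
  have hmono : MonotoneOn F (Set.Ico q 1) := by
    refine monotoneOn_of_deriv_nonneg (convex_Ico q 1)
      (fun x hx => (hd x hx).continuousAt.continuousWithinAt)
      (fun x hx => (hd x (interior_subset hx)).differentiableAt.differentiableWithinAt) ?_
    intro x hx
    have hx' := interior_subset hx
    rw [(hd x hx').deriv]
    have hx0 : 0 < x := hq.trans_le hx'.1
    have hx1 : 0 < 1 - x := by linarith [hx'.2]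
    have hD : 0 ≤ x - q := by linarith [hx'.1]
    have e1 : q * (0 - 1 / x) + (1 - q) * (0 - (-1) / (1 - x)) = (x - q) / (x * (1 - x)) := by
      field_simp
      ring
    have e2 : ((2 * (x - q) ^ 1 * 1) * (2 * (q * (1 - q) + (x - q))) - (x - q) ^ 2 * (2 * 1)) /
          (2 * (q * (1 - q) + (x - q))) ^ 2 ≤ (x - q) / (q * (1 - q) + (x - q)) := by
      rw [div_le_div_iff₀ (by positivity) (by positivity)]
      have : 0 ≤ (x - q) ^ 2 * (q * (1 - q) + (x - q)) := by positivity
      nlinarith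
    have e3 : (x - q) / (q * (1 - q) + (x - q)) ≤ (x - q) / (x * (1 - x)) := by
      refine div_le_div_of_nonneg_left hD (by positivity) ?_
      nlinarith [mul_nonneg hD hq.le, mul_nonneg hD hx0.le]
    rw [e1]
    linarith
  have := hmono ⟨le_rfl, by linarith⟩ ⟨hqp, hp⟩ hqp
  simp only [hF, sub_self, ne_eq, OfNat.ofNat_ne_zero, not_false_eq_true, zero_pow, zero_div,
    mul_zero, add_zero] at this
  linarith

variable {S : Type*} [MeasurableSpace S] {Ω : Type*} [MeasurableSpace Ω] {μ : Measure Ω}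
  [IsProbabilityMeasure μ] {X : ℕ → Ω → S} {ν : Measure S} {B : Set S}

open Classical in
/-- The number of samples in `B` among the first `n`. -/
noncomputable def hits (X : ℕ → Ω → S) (B : Set S) (n : ℕ) (ω : Ω) : ℕ :=
  ((Finset.range n).filter fun i => X i ω ∈ B).card

theorem hits_le (n : ℕ) (ω : Ω) : hits X B n ω ≤ n := by
  classical
  simpa [hits] using Finset.card_filter_le (Finset.range n) fun i => X i ω ∈ B

theorem measurable_hits (hX : ∀ i, Measurable (X i)) (hB : MeasurableSet B) (n : ℕ) :
    Measurable (hits X B n) := by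
  classical
  have : hits X B n = fun ω => ∑ i ∈ Finset.range n, (X i ⁻¹' B).indicator (fun _ => 1) ω := by
    funext ω
    rw [hits, Finset.card_filter]
    refine Finset.sum_congr rfl fun i _ => ?_
    rw [Set.indicator_apply]
    rfl
  rw [this]
  exact Finset.measurable_sum _ fun i _ => measurable_const.indicator (hX i hB)

/-- Markov's inequality for `r ^ hits`, kept in product form so that `r = 0` is allowed. -/
theorem measureReal_hits_le_mul_pow_le (hX : ∀ i, Measurable (X i)) (hind : iIndepFun X μ)
    (hlaw : ∀ i, μ.map (X i) = ν) (hB : MeasurableSet B) (n k : ℕ) {r : ℝ} (hr : 0 ≤ r)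
    (hr1 : r ≤ 1) :
    μ.real {ω | hits X B n ω ≤ k} * r ^ k ≤ (1 - ν.real B + ν.real B * r) ^ n := by
  classical
  set f : S → ℝ := fun x => if x ∈ B then r else 1 with hf
  have hfm : Measurable f := Measurable.ite hB measurable_const measurable_const
  have hprod : ∀ ω, ∏ i : Fin n, f (X i ω) = r ^ hits X B n ω := fun ω => by
    rw [Fin.prod_univ_eq_prod_range (fun i => f (X i ω)) n]
    simp only [hf, hits, Finset.prod_ite, Finset.prod_const, one_pow, mul_one]
  have hνp : IsProbabilityMeasure ν := by
    rw [← hlaw 0]; exact Measure.isProbabilityMeasure_map (hX 0).aemeasurable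
  have hone : ∀ i, ∫ ω, f (X i ω) ∂μ = 1 - ν.real B + ν.real B * r := fun i => by
    rw [← integral_map (hX i).aemeasurable hfm.aestronglyMeasurable, hlaw i]
    have : f = fun x => 1 + B.indicator (fun _ => r - 1) x := by
      funext x
      by_cases hx : x ∈ B <;> simp [hf, hx]
    rw [this, integral_add (integrable_const _)
      ((integrable_const (r - 1)).indicator hB), integral_indicator_const _ hB]
    simp
    ring
  have hexp : ∫ ω, r ^ hits X B n ω ∂μ = (1 - ν.real B + ν.real B * r) ^ n := by
    have h1 := (hind.precomp (g := fun i : Fin n => (i : ℕ)) Fin.val_injective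
      ).integral_fun_prod_comp (f := fun _ => f) (fun i => (hX i).aemeasurable)
        (fun i => hfm.aestronglyMeasurable)
    simp only [hprod, hone] at h1
    simpa using h1
  have hm : MeasurableSet {ω | hits X B n ω ≤ k} :=
    measurable_hits hX hB n (Set.to_countable (Set.Iic k)).measurableSet
  rw [← hexp, ← smul_eq_mul, ← integral_indicator_const _ hm]
  refine integral_mono ((integrable_const _).indicator hm) ?_ fun ω => ?_
  · refine Integrable.of_bound ?_ 1 (Eventually.of_forall fun ω => ?_)
    · exact (measurable_from_nat (f := fun j => r ^ j)).comp (measurable_hits hX hB n)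
        |>.aestronglyMeasurable
    · rw [Real.norm_eq_abs, abs_of_nonneg (pow_nonneg hr _)]
      exact pow_le_one₀ hr hr1
  · by_cases hω : ω ∈ {ω | hits X B n ω ≤ k}
    · rw [Set.indicator_of_mem hω]
      exact pow_le_pow_of_le_one hr hr1 hω
    · rw [Set.indicator_of_notMem hω]
      exact pow_nonneg hr _

/-- Optimizing the Chernoff bound over `r` gives the divergence of `k / n` from `p`, to which
`sq_div_le_kl` applies. The cases `p = 1` and `k = 0`, where logarithms degenerate, are separate. -/
theorem measureReal_hits_le (hX : ∀ i, Measurable (X i)) (hind : iIndepFun X μ)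
    (hlaw : ∀ i, μ.map (X i) = ν) (hB : MeasurableSet B) {n k : ℕ} (hkn : k < n) {y : ℝ}
    (hy : 0 ≤ y) (hkp : (k : ℝ) / n < ν.real B)
    (h : 2 * y * ((k : ℝ) / n * (1 - (k : ℝ) / n) + (ν.real B - (k : ℝ) / n)) ≤
      (ν.real B - (k : ℝ) / n) ^ 2) :
    μ.real {ω | hits X B n ω ≤ k} ≤ Real.exp (-(n * y)) := by
  have hνp : IsProbabilityMeasure ν := by
    rw [← hlaw 0]; exact Measure.isProbabilityMeasure_map (hX 0).aemeasurable
  have hn : (0 : ℝ) < n := by exact_mod_cast (by omega : 0 < n)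
  have key := fun r => measureReal_hits_le_mul_pow_le hX hind hlaw hB n k (r := r)
  set p := ν.real B
  set q := (k : ℝ) / n with hq
  set m := μ.real {ω | hits X B n ω ≤ k}
  have hm0 : 0 ≤ m := measureReal_nonneg
  have hp1 : p ≤ 1 := measureReal_le_one
  have hq0 : 0 ≤ q := by positivity
  rcases hp1.eq_or_lt with hp | hp
  -- With `p = 1` the bound reads `r ^ (n - k)`; as `k < n`, the choice `r = exp (-n y)` suffices.
  · have hr1 : Real.exp (-(n * y)) ≤ 1 := Real.exp_le_one_iff.2 (by nlinarith)
    have h1 := key (Real.exp (-(n * y))) (Real.exp_pos _).le hr1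
    rw [hp, sub_self, zero_add, one_mul, show n = k + (n - k) by omega, pow_add] at h1
    rw [← show n = k + (n - k) by omega, mul_comm] at h1
    refine (le_of_mul_le_mul_left h1 (pow_pos (Real.exp_pos _) k)).trans ?_
    exact pow_le_of_le_one (Real.exp_pos _).le hr1 (by omega)
  · have hy2 : y ≤ (p - q) ^ 2 / (2 * (q * (1 - q) + (p - q))) := by
      have : 0 < q * (1 - q) + (p - q) :=
        add_pos_of_nonneg_of_pos (mul_nonneg hq0 (by linarith)) (by linarith)
      rw [le_div_iff₀ (by positivity)]
      linarith
    rcases Nat.eq_zero_or_pos k with rfl | hk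
    · have h1 := key 0 le_rfl zero_le_one
      rw [pow_zero, mul_one, mul_zero, add_zero] at h1
      refine h1.trans ?_
      have hq' : q = 0 := by simp [hq]
      rw [hq'] at hy2 hkp
      have h2 : y ≤ p := by
        refine hy2.trans ?_
        simp only [sub_zero, zero_mul, zero_add]
        rw [div_le_iff₀ (by positivity)]
        nlinarith
      rw [← mul_neg, Real.exp_nat_mul]
      refine pow_le_pow_left₀ (by linarith) ?_ n
      linarith [Real.add_one_le_exp (-y)]
    · have hqpos : 0 < q := by positivity
      have hp0 : 0 < p := hqpos.trans hkp
      have hkl := hy2.trans (sq_div_le_kl hqpos hkp.le hp)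
      have h1p : 0 < 1 - p := by linarith
      have h1q : 0 < 1 - q := by linarith
      -- The minimizer of `(1 - p + p r)^n / r^k`.
      set r := q * (1 - p) / (p * (1 - q)) with hr
      have hrpos : 0 < r := by positivity
      have hr1 : r ≤ 1 := by
        rw [hr, div_le_one (by positivity)]
        nlinarith
      have h1 := key r hrpos.le hr1
      have e1 : 1 - p + p * r = (1 - p) / (1 - q) := by
        rw [hr]; field_simp; ring
      rw [e1, ← le_div_iff₀ (by positivity)] at h1
      refine h1.trans ?_
      rw [← Real.log_le_iff_le_exp (by positivity), Real.log_div (by positivity) (by positivity),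
        Real.log_pow, Real.log_pow, Real.log_div h1p.ne' h1q.ne', hr,
        Real.log_div (by positivity) (by positivity), Real.log_mul hqpos.ne' h1p.ne',
        Real.log_mul hp0.ne' h1q.ne']
      have hk' : (k : ℝ) = n * q := by rw [hq]; field_simp
      rw [hk']
      nlinarith [mul_le_mul_of_nonneg_left hkl hn.le]

/-- The threshold is random, but only finitely many counts occur: if `k` is the largest count that
violates the bound, the event is contained in `hits ≤ k`, and a single tail bound suffices. -/
theorem measureReal_deviation_le (hX : ∀ i, Measurable (X i)) (hind : iIndepFun X μ)
    (hlaw : ∀ i, μ.map (X i) = ν) (hB : MeasurableSet B) (n : ℕ) {y : ℝ} (hy : 0 ≤ y) :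
    μ.real {ω | Real.sqrt (2 * ((hits X B n ω : ℝ) / n * (1 - (hits X B n ω : ℝ) / n)) * y) + 2 * y
      < ν.real B - (hits X B n ω : ℝ) / n} ≤ Real.exp (-(n * y)) := by
  classical
  have hνp : IsProbabilityMeasure ν := by
    rw [← hlaw 0]; exact Measure.isProbabilityMeasure_map (hX 0).aemeasurable
  have hp1 : ν.real B ≤ 1 := measureReal_le_one
  rcases Nat.eq_zero_or_pos n with rfl | hn
  · simp
  have hn' : (0 : ℝ) < n := by exact_mod_cast hn
  set bad : Finset ℕ := (Finset.range (n + 1)).filter fun k =>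
    Real.sqrt (2 * ((k : ℝ) / n * (1 - (k : ℝ) / n)) * y) + 2 * y < ν.real B - (k : ℝ) / n with hbad
  rcases bad.eq_empty_or_nonempty with he | hne
  · have : {ω | Real.sqrt (2 * ((hits X B n ω : ℝ) / n * (1 - (hits X B n ω : ℝ) / n)) * y) + 2 * y
        < ν.real B - (hits X B n ω : ℝ) / n} = ∅ := by
      ext ω
      simp only [Set.mem_ofPred_eq, Set.mem_empty_iff_false, iff_false]
      intro hω
      have : hits X B n ω ∈ bad := Finset.mem_filter.2
        ⟨Finset.mem_range.2 (Nat.lt_succ_of_le (hits_le n ω)), hω⟩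
      simp [he] at this
    rw [this, measureReal_empty]
    exact (Real.exp_pos _).le
  · set k := bad.max' hne
    have hk := (Finset.mem_filter.1 (bad.max'_mem hne))
    have hkbad : Real.sqrt (2 * ((k : ℝ) / n * (1 - (k : ℝ) / n)) * y) + 2 * y <
      ν.real B - (k : ℝ) / n := hk.2
    set s := Real.sqrt (2 * ((k : ℝ) / n * (1 - (k : ℝ) / n)) * y) with hs
    have hs0 : 0 ≤ s := Real.sqrt_nonneg _
    have hkp : (k : ℝ) / n < ν.real B := by linarith
    have hkn : k < n := by
      have : (k : ℝ) / n < 1 := by linarith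
      rw [div_lt_one hn'] at this
      exact_mod_cast this
    have hq0 : 0 ≤ (k : ℝ) / n := by positivity
    have hs2 : s ^ 2 = 2 * ((k : ℝ) / n * (1 - (k : ℝ) / n)) * y := by
      refine Real.sq_sqrt ?_
      have : 0 ≤ 1 - (k : ℝ) / n := by linarith
      positivity
    refine (measureReal_mono ?_).trans (measureReal_hits_le hX hind hlaw hB hkn hy hkp ?_)
    · intro ω hω
      exact bad.le_max' _ (Finset.mem_filter.2
        ⟨Finset.mem_range.2 (Nat.lt_succ_of_le (hits_le n ω)), hω⟩)
    -- With `d = p - k / n > s + 2 y`: `d² ≥ s d + 2 y d ≥ s² + 2 y d`.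
    · nlinarith

end Bernstein
end PlanRec

/-! ### Sample sizes and confidence widths -/

namespace PlanRec

section Numerics

/-- This is `log x ≤ x - 1` at `x = 2 u / 5`, since `2 / 5 ≥ 1 / e`. -/
theorem log_le_mul_self {u : ℝ} (hu : 0 < u) : Real.log u ≤ 2 / 5 * u := by
  have h1 := Real.log_le_sub_one_of_pos (show 0 < 2 / 5 * u by positivity)
  rw [Real.log_mul (by norm_num) hu.ne'] at h1
  have h2 : -1 ≤ Real.log (2 / 5 : ℝ) := by
    rw [Real.le_log_iff_exp_le (by norm_num), Real.exp_neg, inv_le_comm₀ (Real.exp_pos 1)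
      (by norm_num)]
    have := Real.exp_one_gt_d9
    norm_num at this ⊢
    linarith
  linarith

variable {S Act : Type*} [Fintype S] [Fintype Act] [Nonempty S] [Nonempty Act]

variable (S Act) in
theorem one_le_card_sq_mul_card : 1 ≤ (Fintype.card S : ℝ) ^ 2 * Fintype.card Act := by
  have h1 : (1 : ℝ) ≤ Fintype.card S := by exact_mod_cast Fintype.card_pos
  have h2 : (1 : ℝ) ≤ Fintype.card Act := by exact_mod_cast Fintype.card_pos
  nlinarith [one_le_pow₀ h1 (n := 2)]

/-- `7/3 ξ` is the width at empirical frequency `0`, so this bound separates impossible transitions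
from merely unseen ones. With `u = n β / 5 ≥ 2` the logarithm in `ξ` is `L + 2 log u ≤ 9/5 u`, and
`7/3 · 9/5 u = 21/5 u < 5 u - β = (n - 1) β`. -/
theorem xi_lt_of_phiSupport_le {β δ : ℝ} (hβ : 0 < β) (hβ₁ : β ≤ 1) (hδ : 0 < δ) (hδ₁ : δ < 1)
    {n : ℕ} (hn : phiSupport S Act β δ ≤ n) : 1 < n ∧ 7 / 3 * xi S Act δ n < β := by
  have hC := one_le_card_sq_mul_card S Act
  unfold phiSupport at hn
  unfold xi
  simp only [mul_assoc] at hn ⊢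
  set C := (Fintype.card S : ℝ) ^ 2 * Fintype.card Act
  set L := Real.log (100 * C / (β ^ 2 * δ)) with hL
  set u : ℝ := n * β / 5 with hu
  have hL2 : 2 ≤ L := by
    rw [hL, Real.le_log_iff_exp_le (by positivity)]
    have h1 : Real.exp 2 ≤ 100 := by
      have := Real.exp_one_lt_d9
      rw [show (2 : ℝ) = 1 + 1 by norm_num, Real.exp_add]
      nlinarith [Real.exp_pos 1]
    refine h1.trans ?_
    rw [le_div_iff₀ (by positivity)]
    have : β ^ 2 * δ ≤ 1 := by
      have := pow_le_one₀ hβ.le hβ₁ (n := 2)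
      nlinarith
    nlinarith
  have hLu : L ≤ u := by
    rw [hu, le_div_iff₀ (by norm_num)]
    rw [div_mul_eq_mul_div, div_le_iff₀ hβ] at hn
    linarith
  have hnu : (n : ℝ) * β = 5 * u := by rw [hu]; ring
  have hn10 : (10 : ℝ) ≤ n := by
    have h0 : (0 : ℝ) ≤ n := Nat.cast_nonneg n
    nlinarith
  have hu0 : 0 < u := by linarith
  refine ⟨by exact_mod_cast (by linarith : (1 : ℝ) < n), ?_⟩
  have hlog : Real.log (4 * ((n : ℝ) ^ 2 * C) / δ) = L + 2 * Real.log u := by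
    rw [hL, ← Nat.cast_ofNat (R := ℝ) (n := 2), ← Real.log_pow, ← Real.log_mul (by positivity)
      (by positivity)]
    congr 1
    rw [hu]
    field_simp
    ring
  rw [hlog, ← mul_div_assoc, div_lt_iff₀ (by linarith)]
  nlinarith [log_le_mul_self hu0]

theorem zeta_pos {ρ : ℝ} (hρ : 0 < ρ) : 0 < zeta ρ := by
  unfold zeta
  have : 3 / (7 * Real.sqrt 2) < Real.sqrt ((3 / (7 * Real.sqrt 2)) ^ 2 + 12 / 7 * ρ) := by
    apply Real.lt_sqrt_of_sq_lt
    linarith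
  linarith

theorem zeta_eq {ρ : ℝ} (hρ : 0 < ρ) : zeta ρ / Real.sqrt 2 + 7 / 3 * zeta ρ ^ 2 = ρ := by
  have h2 : 0 < Real.sqrt 2 := Real.sqrt_pos.2 (by norm_num)
  have hb : zeta ρ / Real.sqrt 2 = 7 / 3 * (3 / (7 * Real.sqrt 2)) * zeta ρ := by
    field_simp
  rw [hb]
  unfold zeta
  set b := 3 / (7 * Real.sqrt 2)
  have hs : Real.sqrt (b ^ 2 + 12 / 7 * ρ) ^ 2 = b ^ 2 + 12 / 7 * ρ := Real.sq_sqrt (by positivity)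
  nlinarith

/-- With `u = n ζ² / 2` the logarithm in `ξ` is `L + 2 log u ≤ 9/5 u - 3/2 ζ²`, which is below `9/10
ζ² (n - 1)`. The summand `3` of `psiInv` absorbs the denominator `n - 1`. -/
theorem xi_le_of_psiInv_le {δ ρ : ℝ} (hδ : 0 < δ) (hδ₁ : δ < 1) (hρ : 0 < ρ) {n : ℕ}
    (hn : psiInv S Act δ ρ ≤ n) (hn1 : 1 < n) : xi S Act δ n ≤ 9 / 10 * zeta ρ ^ 2 := by
  have hC := one_le_card_sq_mul_card S Act
  have hn' : (psiInv S Act δ ρ : ℝ) ≤ n := by exact_mod_cast hn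
  have hz := zeta_pos hρ
  unfold psiInv at hn'
  push_cast at hn'
  have hce := (Nat.le_ceil (2 / zeta ρ ^ 2 *
    Real.log (16 * (Fintype.card S : ℝ) ^ 2 * Fintype.card Act / (zeta ρ ^ 4 * δ))))
  unfold xi
  simp only [mul_assoc] at hn' hce ⊢
  set C := (Fintype.card S : ℝ) ^ 2 * Fintype.card Act
  set z := zeta ρ
  set L := Real.log (16 * C / (z ^ 4 * δ)) with hL
  have hLn : 2 / z ^ 2 * L + 3 ≤ n := by linarith
  set u : ℝ := n * z ^ 2 / 2 with hu
  have hn1' : (1 : ℝ) < n := by exact_mod_cast hn1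
  have hu0 : 0 < u := by positivity
  have hLu : L + 3 / 2 * z ^ 2 ≤ u := by
    rw [hu]
    have h1 := mul_le_mul_of_nonneg_right hLn (sq_nonneg z)
    have h2 : (2 / z ^ 2 * L + 3) * z ^ 2 = 2 * L + 3 * z ^ 2 := by field_simp
    linarith
  have hlog : Real.log (4 * ((n : ℝ) ^ 2 * C) / δ) = L + 2 * Real.log u := by
    rw [hL, ← Nat.cast_ofNat (R := ℝ) (n := 2), ← Real.log_pow, ← Real.log_mul (by positivity)
      (by positivity)]
    congr 1
    rw [hu]
    field_simp
    ring
  rw [hlog, div_le_iff₀ (by linarith)]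
  have hnu : (n : ℝ) * z ^ 2 = 2 * u := by rw [hu]; ring
  nlinarith [log_le_mul_self hu0, sq_nonneg z]

theorem xi_pos {δ : ℝ} (hδ : 0 < δ) (hδ₁ : δ < 1) {n : ℕ} (hn : 1 < n) : 0 < xi S Act δ n := by
  have hC := one_le_card_sq_mul_card S Act
  have hn1 : (1 : ℝ) < n := by exact_mod_cast hn
  unfold xi
  refine div_pos (Real.log_pos ?_) (by linarith)
  rw [lt_div_iff₀ hδ, mul_assoc, mul_assoc]
  nlinarith [mul_le_mul (one_le_pow₀ hn1.le (n := 2)) hC zero_le_one (by positivity)]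

/-- As `q (1 - q) ≤ 1/4` and `√(9/10) ≤ 19/20`, the width is at most `19/20` of the left side of the
equation for `ζ`. The factor below `1` is needed in `gain_lt`. -/
theorem psi_le_of_psiInv_le {δ ρ : ℝ} (hδ : 0 < δ) (hδ₁ : δ < 1) (hρ : 0 < ρ) {n : ℕ}
    (hn : psiInv S Act δ ρ ≤ n) (hn1 : 1 < n) (q : ℝ) : psi S Act δ n q ≤ 19 / 20 * ρ := by
  have h1 := xi_le_of_psiInv_le hδ hδ₁ hρ hn hn1
  have h0 := xi_pos (S := S) (Act := Act) hδ hδ₁ hn1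
  have hz := zeta_pos hρ
  have h2 : 0 < Real.sqrt 2 := Real.sqrt_pos.2 (by norm_num)
  unfold psi
  have h3 : Real.sqrt (2 * (q * (1 - q)) * xi S Act δ n) ≤ 19 / 20 * (zeta ρ / Real.sqrt 2) := by
    apply Real.sqrt_le_iff.2
    refine ⟨by positivity, ?_⟩
    rw [mul_pow, div_pow (zeta ρ), Real.sq_sqrt (by norm_num)]
    nlinarith [sq_nonneg (2 * q - 1), sq_nonneg (zeta ρ)]
  calc _ ≤ 19 / 20 * (zeta ρ / Real.sqrt 2) + 7 / 3 * (9 / 10 * zeta ρ ^ 2) := by linarith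
    _ ≤ 19 / 20 * (zeta ρ / Real.sqrt 2 + 7 / 3 * zeta ρ ^ 2) := by nlinarith [sq_nonneg (zeta ρ)]
    _ = _ := by rw [zeta_eq hρ]

/-- For `ρ ≤ 1/2` one has `ρ ≤ 2 ζ`, so `1 / ζ ≤ 24 Y`. The constant is `2 · 24² · 16 = 18432`, plus
rounding and the summand `3`. -/
theorem psiInv_le {δ ρ Y : ℝ} (hδ : 0 < δ) (hδ₁ : δ < 1) (hY : 1 ≤ Y) (hρ : 1 / (12 * Y) ≤ ρ)
    (hρ' : ρ ≤ 1 / 2) :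
    (psiInv S Act δ ρ : ℝ) ≤ 20000 * Y ^ 2 *
      (1 + Real.log ((Fintype.card S : ℝ) ^ 2 * Fintype.card Act * Y / δ)) := by
  have hC := one_le_card_sq_mul_card S Act
  have hρ0 : 0 < ρ := lt_of_lt_of_le (by positivity) hρ
  have hz := zeta_pos hρ0
  have hze := zeta_eq hρ0
  unfold psiInv
  push_cast
  simp only [mul_assoc (16 : ℝ)]
  set C := (Fintype.card S : ℝ) ^ 2 * Fintype.card Act
  set z := zeta ρ
  have h2 : 7 / 5 ≤ Real.sqrt 2 := Real.le_sqrt_of_sq_le (by norm_num)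
  have hz1 : z ≤ 1 / 2 := by
    have : 0 ≤ z / Real.sqrt 2 := by positivity
    nlinarith
  have hzρ : ρ ≤ 2 * z := by
    have : z / Real.sqrt 2 ≤ z / (7 / 5) := div_le_div_of_nonneg_left hz.le (by norm_num) h2
    nlinarith
  have hinv : 1 / z ≤ 24 * Y := by
    rw [div_le_iff₀ (by positivity)] at hρ
    rw [div_le_iff₀ hz]
    nlinarith
  set l := Real.log (C * Y / δ) with hl
  have hCY : 1 ≤ C * Y / δ := by
    rw [le_div_iff₀ hδ]; nlinarith
  have hl0 : 0 ≤ l := Real.log_nonneg hCY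
  have hlog : Real.log (16 * C / (z ^ 4 * δ)) ≤ 16 * (1 + l) := by
    have e1 : 16 * C / (z ^ 4 * δ) ≤ 16 * 24 ^ 4 * (C * Y / δ) ^ 4 := by
      have a1 : (1 / z) ^ 4 ≤ (24 * Y) ^ 4 := pow_le_pow_left₀ (by positivity) hinv 4
      have a2 : C / δ ≤ (C / δ) ^ 4 := by
        apply le_self_pow₀ _ (by norm_num)
        rw [le_div_iff₀ hδ]; linarith
      calc 16 * C / (z ^ 4 * δ) = 16 * ((C / δ) * (1 / z) ^ 4) := by field_simp
        _ ≤ 16 * ((C / δ) ^ 4 * (24 * Y) ^ 4) := by gcongr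
        _ = _ := by ring
    have e2 : Real.log (16 * 24 ^ 4 : ℝ) ≤ 16 := by
      rw [Real.log_le_iff_le_exp (by norm_num)]
      have h3 : (2.7 : ℝ) ≤ Real.exp 1 := by linarith [Real.exp_one_gt_d9]
      have h4 : Real.exp 16 = Real.exp 1 ^ 16 := by rw [← Real.exp_nat_mul]; norm_num
      rw [h4]
      refine le_trans ?_ (pow_le_pow_left₀ (by norm_num) h3 16)
      norm_num
    have e3 := Real.log_le_log (by positivity) e1
    rw [Real.log_mul (by norm_num) (by positivity), Real.log_pow, ← hl] at e3
    push_cast at e3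
    refine (e3.trans (add_le_add e2 le_rfl)).trans ?_
    linarith
  have hpre : 2 / z ^ 2 ≤ 1152 * Y ^ 2 := by
    have := pow_le_pow_left₀ (by positivity) hinv 2
    calc 2 / z ^ 2 = 2 * (1 / z) ^ 2 := by field_simp
      _ ≤ 2 * (24 * Y) ^ 2 := by linarith
      _ = _ := by ring
  have hlogpos : 0 ≤ Real.log (16 * C / (z ^ 4 * δ)) := by
    refine Real.log_nonneg ?_
    rw [le_div_iff₀ (by positivity)]
    have : z ^ 4 ≤ 1 := pow_le_one₀ hz.le (by linarith)
    nlinarith [pow_pos hz 4]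
  have hceil := (Nat.ceil_lt_add_one (mul_nonneg (by positivity : 0 ≤ 2 / z ^ 2) hlogpos)).le
  have hmul : 2 / z ^ 2 * Real.log (16 * C / (z ^ 4 * δ)) ≤ 1152 * Y ^ 2 * (16 * (1 + l)) :=
    mul_le_mul hpre hlog hlogpos (by positivity)
  have hY2 : 1 ≤ Y ^ 2 := one_le_pow₀ hY
  nlinarith [mul_nonneg (sq_nonneg Y) hl0]

end Numerics

/-! ### Probability of the concentration event -/

section Concentration

variable {S Act : Type*} [Fintype S] [Fintype Act] [MeasurableSpace S] [MeasurableSingletonClass S]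
  {M : MDP S Act} {Ω : Type*} [MeasurableSpace Ω] {μ : Measure Ω} [IsProbabilityMeasure μ]

theorem measureReal_psi_lt_le {δ : ℝ} (hδ : 0 < δ) (hδ₁ : δ < 1) {s : S} {a : Act}
    {X : S → Act → ℕ → Ω → S}
    (hX : ∀ i, Measurable (X s a i)) (hind : iIndepFun (X s a) μ)
    (hlaw : ∀ i, μ.map (X s a i) = (M.P s a).toMeasure) (s' : S) {n : ℕ} (hn : 1 < n) :
    μ.real {ω | psi S Act δ n (empirical (fun s a i => X s a i ω) n s a s') <
      |M.prob s a s' - empirical (fun s a i => X s a i ω) n s a s'|} ≤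
      δ / (2 * (n : ℝ) ^ 2 * ((Fintype.card S : ℝ) ^ 2 * Fintype.card Act)) := by
  classical
  have : Nonempty S := ⟨s⟩
  have : Nonempty Act := ⟨a⟩
  have hC := one_le_card_sq_mul_card S Act
  have hn1 : (1 : ℝ) < n := by exact_mod_cast hn
  have hxi := xi_pos (S := S) (Act := Act) hδ hδ₁ hn
  -- Chosen so that `n y` is exactly the logarithm in `ξ`. Since `y ≤ ξ` and `2 ≤ 7/3`, the
  -- resulting deviation is within `psi`.
  set y := xi S Act δ n * (n - 1) / n with hy
  have hy0 : 0 ≤ y := by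
    have : (0 : ℝ) ≤ n - 1 := by linarith
    positivity
  have hyxi : y ≤ xi S Act δ n := by
    rw [hy, div_le_iff₀ (by linarith)]
    nlinarith
  have hexp : Real.exp (-(n * y)) =
      δ / (4 * (n : ℝ) ^ 2 * ((Fintype.card S : ℝ) ^ 2 * Fintype.card Act)) := by
    have e : (n : ℝ) * y = Real.log (4 * (n : ℝ) ^ 2 * (Fintype.card S : ℝ) ^ 2 *
        Fintype.card Act / δ) := by
      rw [hy, xi]
      have : (n : ℝ) - 1 ≠ 0 := by linarith
      field_simp
    have hpos : 0 < 4 * (n : ℝ) ^ 2 * ((Fintype.card S : ℝ) ^ 2 * Fintype.card Act) := by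
      positivity
    rw [e, ← Real.log_inv, Real.exp_log (by simp only [mul_assoc] at hpos ⊢; positivity), inv_div]
    simp only [mul_assoc]
  have hB : ((M.P s a).toMeasure).real {s'} = M.prob s a s' := by
    rw [measureReal_def, PMF.toMeasure_apply_singleton _ _ (measurableSet_singleton s')]
    rfl
  have hBc : ((M.P s a).toMeasure).real {s'}ᶜ = 1 - M.prob s a s' := by
    rw [probReal_compl_eq_one_sub (measurableSet_singleton s'), hB]
  have hemp : ∀ ω, empirical (fun s a i => X s a i ω) n s a s' = (hits (X s a) {s'} n ω : ℝ) / n :=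
    fun ω => by
      unfold empirical hits
      simp only [Set.mem_singleton_iff]
  have hempc : ∀ ω, (hits (X s a) {s'}ᶜ n ω : ℝ) / n =
      1 - empirical (fun s a i => X s a i ω) n s a s' := fun ω => by
    have h1 : hits (X s a) {s'} n ω + hits (X s a) {s'}ᶜ n ω = n := by
      unfold hits
      have := Finset.card_filter_add_card_filter_not (s := Finset.range n)
        (fun i => X s a i ω ∈ ({s'} : Set S))
      rw [Finset.card_range] at this
      convert this using 3 <;> ext <;> simp
    have h2 : (hits (X s a) {s'} n ω : ℝ) + hits (X s a) {s'}ᶜ n ω = n := by exact_mod_cast h1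
    rw [hemp, eq_sub_iff_add_eq, ← add_div, add_comm, h2, div_self (by linarith)]
  have d1 := measureReal_deviation_le hX hind hlaw (measurableSet_singleton s') n hy0
  -- The upper tail is the lower tail of the complement, and `q (1 - q)` is symmetric.
  have d2 := measureReal_deviation_le hX hind hlaw (measurableSet_singleton s').compl n hy0
  rw [hexp] at d1 d2
  simp only [hB, hBc, ← hemp, hempc] at d1 d2
  refine (measureReal_mono fun ω hω => ?_).trans ((measureReal_union_le _ _).trans
    ((add_le_add d1 d2).trans (le_of_eq ?_)))
  · simp only [Set.mem_ofPred_eq] at hω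
    set q := empirical (fun s a i => X s a i ω) n s a s' with hq
    have hq0 : 0 ≤ q := by rw [hq, hemp]; positivity
    have hq1 : q ≤ 1 := by
      rw [hq, hemp, div_le_one (by linarith)]
      exact_mod_cast hits_le n ω
    have hle : Real.sqrt (2 * (q * (1 - q)) * y) + 2 * y ≤ psi S Act δ n q := by
      unfold psi
      refine add_le_add (Real.sqrt_le_sqrt ?_) (by linarith)
      refine mul_le_mul_of_nonneg_left hyxi ?_
      have : 0 ≤ 1 - q := by linarith
      positivity
    have hω' := hle.trans_lt hω
    rcases lt_abs.1 hω' with h | h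
    · exact Or.inl h
    · refine Or.inr ?_
      simp only [Set.mem_ofPred_eq]
      rw [← hq, show (1 - q) * (1 - (1 - q)) = q * (1 - q) by ring]
      linarith
  · field_simp
    norm_num

/-- Union bound: the `|S|² |Act|` triples cost at most `δ / (2 n²)` for each `n`, and `∑ 1 / n² = π²
/ 6 ≤ 2`. -/
theorem ofReal_le_measure_concentrated {δ : ℝ} (hδ : 0 < δ) (hδ₁ : δ < 1) [Nonempty S]
    [Nonempty Act] {X : S → Act → ℕ → Ω → S} (hX : ∀ s a i, Measurable (X s a i))
    (hind : ∀ s, ∀ a ∈ M.avail s, iIndepFun (X s a) μ)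
    (hlaw : ∀ s, ∀ a ∈ M.avail s, ∀ i, μ.map (X s a i) = (M.P s a).toMeasure) :
    ENNReal.ofReal (1 - δ) ≤ μ {ω | M.Concentrated δ (fun s a i => X s a i ω)} := by
  have hC := one_le_card_sq_mul_card S Act
  set C := (Fintype.card S : ℝ) ^ 2 * Fintype.card Act with hCdef
  set bad : ℕ → S × Act × S → Set Ω := fun n x => {ω | x.2.1 ∈ M.avail x.1 ∧ 1 < n ∧
    psi S Act δ n (empirical (fun s a i => X s a i ω) n x.1 x.2.1 x.2.2) <
      |M.prob x.1 x.2.1 x.2.2 - empirical (fun s a i => X s a i ω) n x.1 x.2.1 x.2.2|} with hbad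
  have hb : ∀ n x, μ (bad n x) ≤ ENNReal.ofReal (δ / (2 * (n : ℝ) ^ 2 * C)) := fun n x => by
    by_cases hx : x.2.1 ∈ M.avail x.1 ∧ 1 < n
    · rw [← ofReal_measureReal]
      refine ENNReal.ofReal_le_ofReal (le_trans (measureReal_mono fun ω hω => hω.2.2)
        (measureReal_psi_lt_le hδ hδ₁ (hX x.1 x.2.1) (hind _ _ hx.1) (hlaw _ _ hx.1) x.2.2 hx.2))
    · have : bad n x = ∅ := by
        ext ω
        simp only [hbad, Set.mem_ofPred_eq, Set.mem_empty_iff_false, iff_false]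
        exact fun h => hx ⟨h.1, h.2.1⟩
      simp [this]
  have hsum : Summable fun n : ℕ => δ / 2 * (1 / (n : ℝ) ^ 2) :=
    (hasSum_zeta_two.mul_left (δ / 2)).summable
  have hcompl : μ {ω | M.Concentrated δ (fun s a i => X s a i ω)}ᶜ ≤ ENNReal.ofReal δ := by
    calc μ {ω | M.Concentrated δ (fun s a i => X s a i ω)}ᶜ
        ≤ μ (⋃ n, ⋃ x, bad n x) := measure_mono fun ω hω => by
          simp only [MDP.Concentrated, Set.mem_compl_iff, Set.mem_ofPred_eq, not_forall,
            not_le] at hω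
          obtain ⟨s, a, ha, s', n, hn, h⟩ := hω
          exact Set.mem_iUnion.2 ⟨n, Set.mem_iUnion.2 ⟨(s, a, s'), ha, hn, h⟩⟩
      _ ≤ ∑' n, μ (⋃ x, bad n x) := measure_iUnion_le _
      _ ≤ ∑' n : ℕ, ENNReal.ofReal (δ / 2 * (1 / (n : ℝ) ^ 2)) := by
          refine ENNReal.tsum_le_tsum fun n => (measure_iUnion_fintype_le _ _).trans ?_
          refine (Finset.sum_le_sum fun x _ => hb n x).trans ?_
          rw [Finset.sum_const, nsmul_eq_mul, Finset.card_univ, Fintype.card_prod,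
            Fintype.card_prod, ← ENNReal.ofReal_natCast, ← ENNReal.ofReal_mul (by positivity)]
          refine ENNReal.ofReal_le_ofReal (le_of_eq ?_)
          have : ((Fintype.card S * (Fintype.card Act * Fintype.card S) : ℕ) : ℝ) = C := by
            rw [hCdef]; push_cast; ring
          rw [this]
          field_simp
      _ = ENNReal.ofReal (∑' n : ℕ, δ / 2 * (1 / (n : ℝ) ^ 2)) :=
          (ENNReal.ofReal_tsum_of_nonneg (fun n => by positivity) hsum).symm
      _ ≤ ENNReal.ofReal δ := by
          refine ENNReal.ofReal_le_ofReal ?_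
          rw [(hasSum_zeta_two.mul_left (δ / 2)).tsum_eq]
          have : Real.pi ^ 2 ≤ 12 := by nlinarith [Real.pi_lt_d2, Real.pi_pos]
          nlinarith
  rw [ENNReal.ofReal_sub _ hδ.le, ENNReal.ofReal_one, tsub_le_iff_right,
    ← measure_univ (μ := μ)]
  exact (measure_univ_le_add_compl {ω | M.Concentrated δ (fun s a i => X s a i ω)}).trans
    (add_le_add_right hcompl _)

end Concentration
end PlanRec

/-! ### Optimistic Bellman operators, optimal gains, plausible dynamics -/

namespace PlanRec.MDP.EndComponent

section Optimism

variable {S Act : Type*} [Fintype S] [Fintype Act] {M : MDP S Act} (E : M.EndComponent)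

/-- The cost and next-state distribution pairs that a Bellman update in `s` minimizes over, when
`U s a` is the set of candidate distributions of `(s, a)`. -/
def choices (U : S → Act → Set (S → ℝ)) (s : E.states) : Set (ℝ × (E.states → ℝ)) :=
  {k | ∃ a ∈ E.acts s, ∃ p ∈ U s a, k = (M.cost s a, fun s' : E.states => p s')}

/-- The Bellman operator with candidate distributions `U s a`. -/
noncomputable def uncertainBellman (U : S → Act → Set (S → ℝ)) (α : ℝ) (v : E.states → ℝ) :
    E.states → ℝ :=
  fun s => (⨅ a : {a // a ∈ E.acts s}, (M.cost s a + α * sInf ((fun p => E.pair p v) '' U s a))) +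
    (1 - α) * v s

variable {E} {U : S → Act → Set (S → ℝ)} {α : ℝ}

theorem continuous_pair (v : E.states → ℝ) : Continuous fun p : S → ℝ => E.pair p v := by
  unfold pair
  fun_prop

theorem exists_pair_eq_sInf {V : Set (S → ℝ)} (hV : IsCompact V) (hne : V.Nonempty)
    (v : E.states → ℝ) :
    ∃ p ∈ V, E.pair p v = sInf ((fun p => E.pair p v) '' V) ∧ ∀ p' ∈ V, E.pair p v ≤ E.pair p' v := by
  obtain ⟨p, hp, hmin⟩ := hV.exists_isMinOn hne (continuous_pair v).continuousOn
  refine ⟨p, hp, ?_, hmin⟩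
  have : IsLeast ((fun p => E.pair p v) '' V) (E.pair p v) :=
    ⟨⟨p, hp, rfl⟩, by rintro _ ⟨p', hp', rfl⟩; exact hmin hp'⟩
  exact this.csInf_eq.symm

/-- Compactness of the candidate sets and finiteness of the action sets make all infima attained. -/
theorem isBellman_uncertainBellman (hα₀ : 0 ≤ α)
    (hU : ∀ s ∈ E.states, ∀ a ∈ E.acts s, IsCompact (U s a) ∧ (U s a).Nonempty) :
    IsBellman α (E.choices U) (E.uncertainBellman U α) := by
  intro v s
  constructor
  · obtain ⟨a, ha⟩ := exists_eq_ciInf_of_finite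
      (f := fun a : {a // a ∈ E.acts s} => M.cost s a + α * sInf ((fun p => E.pair p v) '' U s a))
    obtain ⟨p, hp, hpe, -⟩ := exists_pair_eq_sInf (hU s s.2 a a.2).1 (hU s s.2 a a.2).2 v
    refine ⟨_, ⟨a, a.2, p, hp, rfl⟩, ?_⟩
    simp only [uncertainBellman, ← ha, ← hpe]
    rfl
  · rintro _ ⟨_, ⟨a, ha, p, hp, rfl⟩, rfl⟩
    obtain ⟨p', hp', hpe, hmin⟩ := exists_pair_eq_sInf (hU s s.2 a ha).1 (hU s s.2 a ha).2 v
    have h1 : (⨅ a : {a // a ∈ E.acts s},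
        (M.cost s a + α * sInf ((fun p => E.pair p v) '' U s a))) ≤
        M.cost s a + α * sInf ((fun p => E.pair p v) '' U s a) :=
      ciInf_le (Set.finite_range _).bddBelow (⟨a, ha⟩ : {a // a ∈ E.acts s})
    have h2 := mul_le_mul_of_nonneg_left (hmin p hp) hα₀
    rw [hpe] at h2
    simp only [uncertainBellman]
    simp only [pair] at h2
    simp only [pair] at h1 ⊢
    linarith

/-- The relation of possible steps within the end component. -/
def Step (E : M.EndComponent) (s t : E.states) : Prop := ∃ a ∈ E.acts s, 0 < M.prob s a t

theorem reflTransGen_step (s t : E.states) : Relation.ReflTransGen E.Step s t := by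
  have key : ∀ t : S, Relation.ReflTransGen
      (fun x y => x ∈ E.states ∧ ∃ a ∈ E.acts x, 0 < M.prob x a y) s t → ∀ ht : t ∈ E.states,
      Relation.ReflTransGen E.Step s ⟨t, ht⟩ := by
    intro t h
    induction h with
    | refl => exact fun _ => Relation.ReflTransGen.refl
    | tail _ hbc ih =>
      intro ht
      exact (ih hbc.1).tail hbc.2
  exact key t (E.connected s s.2 t t.2) t.2

section Gain

variable [MeasurableSpace S] [MeasurableSingletonClass S]
  [MeasurableSpace Act] [MeasurableSingletonClass Act] {π : S → PMF Act}

/-- Laziness is invisible to the gain: `α P v + (1 - α) v - v = P (α v) - α v`. So `h` is `α v`,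
extended by `0` outside the component. -/
theorem exists_sum_toReal_mul_eq (π : S → PMF Act) (α : ℝ) (v : E.states → ℝ) :
    ∃ h : S → ℝ, ∀ s : E.states,
      ∑ a, (π s a).toReal * (M.cost s a + α * E.pair (M.prob s a) v + (1 - α) * v s) - v s =
        actAvg π (fun x => M.cost x.1 x.2) s + M.avgStep π h s - h s := by
  classical
  refine ⟨fun t => if ht : t ∈ E.states then α * v ⟨t, ht⟩ else 0, fun s => ?_⟩
  have h1 : ∀ a, (π s a).toReal * ∑ t, M.prob s a t *
      (if ht : t ∈ E.states then α * v ⟨t, ht⟩ else 0) =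
      (π s a).toReal * (α * E.pair (M.prob s a) v) := fun a => by
    congr 1
    rw [← sum_states_eq (E := E) (f := fun t => M.prob s a t *
      (if ht : t ∈ E.states then α * v ⟨t, ht⟩ else 0)) (fun t ht => by simp [ht]), pair,
      Finset.mul_sum]
    refine Finset.sum_congr rfl fun t _ => ?_
    simp only [t.2, dif_pos]
    ring
  simp only [actAvg, avgStep, h1, s.2, dif_pos, mul_add, Finset.sum_add_distrib, ← Finset.sum_mul,
    PMF.sum_toReal_eq_one]
  ring

theorem IsPolicy.le_gain_of_le (hπ : E.IsPolicy π) {v : E.states → ℝ} {G : ℝ}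
    (hG : ∀ s : E.states, G ≤
      ∑ a, (π s a).toReal * (M.cost s a + α * E.pair (M.prob s a) v + (1 - α) * v s) - v s)
    {s : S} (hs : s ∈ E.states) : G ≤ M.gain π s := by
  obtain ⟨h, hh⟩ := exists_sum_toReal_mul_eq π α v
  refine hπ.le_gain (h := h) (fun t ht => ?_) hs
  have := hG ⟨t, ht⟩
  rwa [hh] at this

theorem IsPolicy.gain_le_of_le (hπ : E.IsPolicy π) {v : E.states → ℝ} {G : ℝ}
    (hG : ∀ s : E.states,
      ∑ a, (π s a).toReal * (M.cost s a + α * E.pair (M.prob s a) v + (1 - α) * v s) - v s ≤ G)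
    {s : S} (hs : s ∈ E.states) : M.gain π s ≤ G := by
  obtain ⟨h, hh⟩ := exists_sum_toReal_mul_eq π α v
  refine hπ.gain_le (h := h) (fun t ht => ?_) hs
  have := hG ⟨t, ht⟩
  rwa [hh] at this

/-- Every policy of the end component has a gain of at least the smallest increment of an
optimistic Bellman update. -/
theorem IsPolicy.le_gain_of_isBellman (hπ : E.IsPolicy π) {T : (E.states → ℝ) → E.states → ℝ}
    (hT : IsBellman α (E.choices U) T)
    (hU : ∀ s ∈ E.states, ∀ a ∈ E.acts s, M.prob s a ∈ U s a) {v : E.states → ℝ} {G : ℝ}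
    (hG : ∀ s, G ≤ T v s - v s) {s : S} (hs : s ∈ E.states) : G ≤ M.gain π s := by
  refine hπ.le_gain_of_le (α := α) (v := v) (fun t => ?_) hs
  -- Every action with its true distribution competes in the minimum `T v t`, so averages over
  -- actions lie above it.
  have h1 : T v t ≤
      ∑ a, (π t a).toReal * (M.cost t a + α * E.pair (M.prob t a) v + (1 - α) * v t) := by
    calc T v t = ∑ a, (π t a).toReal * T v t := by
          rw [← Finset.sum_mul, PMF.sum_toReal_eq_one, one_mul]
      _ ≤ _ := by
          refine Finset.sum_le_sum fun a _ => ?_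
          by_cases ha : a ∈ E.acts t
          · exact mul_le_mul_of_nonneg_left
              ((hT v t).2 ⟨_, ⟨a, ha, _, hU t t.2 a ha, rfl⟩, rfl⟩) ENNReal.toReal_nonneg
          · simp [hπ.toReal_eq_zero t.2 ha]
  linarith [hG t]

/-- Run value iteration with the exact dynamics, that is, with singleton candidate sets. The
increments converge to a constant `g`, which is below every gain. Among the finitely many greedy
policies one recurs infinitely often, and its gain is at most `g + e` for each `e > 0`. -/
theorem exists_isGainOptimal {cmax β : ℝ}
    (hcost : ∀ s, ∀ a ∈ M.avail s, 0 ≤ M.cost s a ∧ M.cost s a ≤ cmax) (hβ : 0 < β)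
    (hβP : ∀ s, ∀ a ∈ M.avail s, ∀ s', 0 < M.prob s a s' → β ≤ M.prob s a s') :
    ∃ πA, E.IsGainOptimal πA := by
  classical
  set U : S → Act → Set (S → ℝ) := fun s a => {M.prob s a} with hUdef
  have hα₀ : (0 : ℝ) < 1 / 2 := by norm_num
  have hα : (1 / 2 : ℝ) < 1 := by norm_num
  have hT := isBellman_uncertainBellman (E := E) (U := U) hα₀.le fun s _ a _ =>
    ⟨isCompact_singleton, Set.singleton_nonempty _⟩
  set T := E.uncertainBellman U (1 / 2)
  have hK : ∀ s, ∀ k ∈ E.choices U s, 0 ≤ k.1 ∧ k.2 ∈ stdSimplex ℝ E.states := by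
    rintro s _ ⟨a, ha, _, rfl, rfl⟩
    exact ⟨(hcost s a (E.acts_avail s s.2 ha)).1, E.isDyn_prob.mem_stdSimplex s ha⟩
  obtain ⟨W, hW⟩ := IsBellman.exists_span_iterate_le (reflTransGen_step (E := E)) (c := cmax) hβ
    hα₀ hα
  obtain ⟨g, hg⟩ := hT.increments_converge hα₀.le hα (fun s k hk => (hK s k hk).2)
    (hW _ T hT hK (by
      rintro s t ⟨a, ha, hp⟩
      exact ⟨_, ⟨a, ha, _, rfl, rfl⟩, (hcost s a (E.acts_avail s s.2 ha)).2,
        hβP s a (E.acts_avail s s.2 ha) t hp⟩))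
  have hgreedy : ∀ n, ∃ d : E.DetPolicy, ∀ s, T^[n + 1] 0 s = M.cost s (d s) +
      1 / 2 * E.pair (M.prob s (d s)) (T^[n] 0) + (1 - 1 / 2) * T^[n] 0 s := fun n => by
    have : ∀ s : E.states, ∃ a : {a // a ∈ E.acts s}, T^[n + 1] 0 s = M.cost s a +
      1 / 2 * E.pair (M.prob s a) (T^[n] 0) + (1 - 1 / 2) * T^[n] 0 s := fun s => by
        obtain ⟨⟨_, ⟨a, ha, _, rfl, rfl⟩, h⟩, -⟩ := hT (T^[n] 0) s
        refine ⟨⟨a, ha⟩, ?_⟩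
        rw [Function.iterate_succ_apply', ← h]
        rfl
    choose d hd using this
    exact ⟨d, hd⟩
  choose d hd using hgreedy
  obtain ⟨d₀, hd₀⟩ := Finite.exists_infinite_fiber d
  obtain ⟨s₁, hs₁⟩ := E.nonempty
  obtain ⟨a₁, ha₁⟩ := E.acts_nonempty s₁ hs₁
  set π₀ : S → PMF Act := fun s => if hs : s ∈ E.states then PMF.pure (d₀ ⟨s, hs⟩)
    else PMF.pure a₁ with hπ₀
  have hpol : E.IsPolicy π₀ := fun s hs a ha => by
    simp only [hπ₀, dif_pos hs, PMF.pure_apply, ne_eq, ite_eq_right_iff, one_ne_zero, imp_false,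
      not_not] at ha
    rw [ha]
    exact (d₀ ⟨s, hs⟩).2
  refine ⟨π₀, hpol, fun π' hπ' s hs => ?_⟩
  have hlow : g ≤ M.gain π' s := by
    refine le_of_forall_pos_sub_le fun e he => ?_
    obtain ⟨n₀, hn₀⟩ := hg e he
    refine hπ'.le_gain_of_isBellman hT (fun s _ a _ => rfl) (v := T^[n₀] 0) (fun t => ?_) hs
    have := (abs_le.1 (hn₀ n₀ le_rfl t)).1
    rw [Function.iterate_succ_apply'] at this
    linarith
  refine le_trans ?_ hlow
  refine le_of_forall_pos_le_add fun e he => ?_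
  obtain ⟨n₀, hn₀⟩ := hg e he
  obtain ⟨n, hn, hnd⟩ : ∃ n, n₀ ≤ n ∧ d n = d₀ := by
    obtain ⟨n, hn, hgt⟩ := (Set.infinite_coe_iff.1 hd₀).exists_gt n₀
    exact ⟨n, hgt.le, hn⟩
  refine hpol.gain_le_of_le (α := 1 / 2) (v := T^[n] 0) (fun t => ?_) hs
  have hsum : ∑ a, (π₀ t a).toReal * (M.cost t a + 1 / 2 * E.pair (M.prob t a) (T^[n] 0) +
      (1 - 1 / 2) * T^[n] 0 t) = T^[n + 1] 0 t := by
    rw [Finset.sum_eq_single (d₀ t : Act)]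
    · rw [hd n t, hnd]
      simp [hπ₀]
    · intro b _ hb
      simp [hπ₀, hb]
    · simp
  rw [hsum]
  linarith [(abs_le.1 (hn₀ n hn t)).2]

end Gain

section Plausible

variable {β δ : ℝ}

theorem isCompact_plausible (n : ℕ) (q : S → ℝ) : IsCompact (plausible Act β δ n q) := by
  refine (isCompact_stdSimplex ℝ S).of_isClosed_subset ?_ fun p hp => hp.1
  have : plausible Act β δ n q = stdSimplex ℝ S ∩ ⋂ s', {p : S → ℝ | (q s' = 0 → p s' = 0) ∧
      (q s' = 1 → p s' = 1) ∧ (q s' ≠ 0 → q s' ≠ 1 →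
        |p s' - q s'| ≤ psi S Act δ n (q s') ∧ p s' ∈ Set.Icc β (1 - β))} := by
    ext p
    simp [plausible]
  rw [this]
  refine (isClosed_stdSimplex ℝ S).inter (isClosed_iInter fun s' => ?_)
  have hc : Continuous fun p : S → ℝ => p s' := continuous_apply s'
  have imp : ∀ (P : Prop) {R : Set (S → ℝ)}, IsClosed R → IsClosed {p | P → p ∈ R} := by
    intro P R hR
    by_cases hP : P <;> simp [hP, hR]
  refine (imp _ (isClosed_eq hc continuous_const)).inter
    ((imp _ (isClosed_eq hc continuous_const)).inter (imp _ (imp _ ?_)))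
  exact (isClosed_le (hc.sub continuous_const).abs continuous_const).inter
    (isClosed_Icc.preimage hc)

/-- Samples that only contain possible transitions. -/
def _root_.PlanRec.MDP.Possible (M : MDP S Act) (x : S → Act → ℕ → S) : Prop :=
  ∀ s, ∀ a ∈ M.avail s, ∀ i, 0 < M.prob s a (x s a i)

variable {x : S → Act → ℕ → S} {n : ℕ}

theorem prob_add_prob_le_one {s : S} {a : Act} {t u : S} (h : t ≠ u) :
    M.prob s a t + M.prob s a u ≤ 1 := by
  classical
  rw [← M.sum_prob s a, ← Finset.sum_pair (f := M.prob s a) h]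
  exact Finset.sum_le_sum_of_subset_of_nonneg (Finset.subset_univ _)
    fun _ _ _ => M.prob_nonneg _ _ _

/-- Once the supports are verified, the true transition probabilities are plausible. -/
theorem prob_mem_plausible
    (hβP : ∀ s, ∀ a ∈ M.avail s, ∀ s', 0 < M.prob s a s' → β ≤ M.prob s a s')
    (hx : M.Concentrated δ x) (hp : M.Possible x) (hn : 1 < n)
    (hxi : 7 / 3 * xi S Act δ n < β) {s : S} {a : Act} (ha : a ∈ M.avail s) :
    M.prob s a ∈ plausible Act β δ n (empirical x n s a) := by
  classical
  have hn0 : (n : ℝ) ≠ 0 := by positivity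
  -- At frequency `0` the width is `7/3 ξ < β`, and no positive probability lies below `β`.
  have f0 : ∀ s', empirical x n s a s' = 0 → ¬ 0 < M.prob s a s' := fun s' h0 hpos => by
    have h1 := hx s a ha s' n hn
    have h2 := hβP s a ha s' hpos
    rw [h0, sub_zero, abs_of_pos hpos] at h1
    simp only [psi, zero_mul, mul_zero, Real.sqrt_zero, zero_add] at h1
    linarith
  have f1 : ∀ s', empirical x n s a s' ≠ 0 → 0 < M.prob s a s' := fun s' h => by
    unfold empirical at h
    have h1 : ((Finset.range n).filter fun i => x s a i = s').card ≠ 0 := fun h0 => h (by simp [h0])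
    obtain ⟨i, hi⟩ := Finset.card_ne_zero.1 h1
    rw [← (Finset.mem_filter.1 hi).2]
    exact hp s a ha i
  have f2 : ∀ s', (∀ i < n, x s a i = s') → M.prob s a s' = 1 := fun s' h => by
    have h1 : ∀ t, t ≠ s' → M.prob s a t = 0 := fun t ht => by
      have h2 : empirical x n s a t = 0 := by
        unfold empirical
        rw [Finset.filter_false_of_mem, Finset.card_empty]
        · simp
        · intro i hi he
          exact ht (he ▸ h i (Finset.mem_range.1 hi))
      exact le_antisymm (not_lt.1 (f0 t h2)) (M.prob_nonneg _ _ _)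
    rw [← M.sum_prob s a, Finset.sum_eq_single s' (fun t _ ht => h1 t ht) (by simp)]
  have f3 : ∀ s', empirical x n s a s' = 1 → ∀ i < n, x s a i = s' := fun s' h i hi => by
    unfold empirical at h
    rw [div_eq_one_iff_eq hn0] at h
    have h1 : ((Finset.range n).filter fun i => x s a i = s').card = (Finset.range n).card := by
      rw [Finset.card_range]
      convert (Nat.cast_injective h)
    exact (Finset.card_filter_eq_iff.1 h1) i (Finset.mem_range.2 hi)
  refine ⟨⟨M.prob_nonneg s a, M.sum_prob s a⟩, fun s' => ⟨fun h => ?_, fun h => ?_, fun h h' => ?_⟩⟩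
  · exact le_antisymm (not_lt.1 (f0 s' h)) (M.prob_nonneg _ _ _)
  · exact f2 s' (f3 s' h)
  · refine ⟨hx s a ha s' n hn, hβP s a ha s' (f1 s' h), ?_⟩
    -- If `s'` had probability above `1 - β`, no other state could have probability at least `β`;
    -- all samples would equal `s'` and the frequency would be `1`.
    by_contra hcon
    have hall : ∀ i < n, x s a i = s' := fun i hi => by
      by_contra hne
      have h1 := hβP s a ha _ (hp s a ha i)
      have h2 := prob_add_prob_le_one (M := M) (s := s) (a := a) hne
      linarith [not_le.1 hcon]
    refine h' ?_
    unfold empirical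
    rw [Finset.filter_true_of_mem (fun i hi => hall i (Finset.mem_range.1 hi)), Finset.card_range,
      div_self hn0]

/-- Frequencies `0` and `1` are copied, and any other frequency forces probability at least `β`. So
all plausible distributions share one support, the true one as soon as the truth is plausible. -/
theorem pos_iff_of_mem_plausible (hβ : 0 < β) {q p p' : S → ℝ}
    (hp : p ∈ plausible Act β δ n q) (hp' : p' ∈ plausible Act β δ n q) (s' : S) :
    0 < p s' ↔ 0 < p' s' := by
  obtain ⟨h0, h1, h2⟩ := hp.2 s'
  obtain ⟨h0', h1', h2'⟩ := hp'.2 s'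
  by_cases hq0 : q s' = 0
  · rw [h0 hq0, h0' hq0]
  · by_cases hq1 : q s' = 1
    · rw [h1 hq1, h1' hq1]
    · exact iff_of_true (hβ.trans_le (h2 hq0 hq1).2.1) (hβ.trans_le (h2' hq0 hq1).2.1)

theorem abs_sub_le_of_mem_plausible {q p p' : S → ℝ} {r : ℝ} (hr : 0 ≤ r)
    (hψ : ∀ y, psi S Act δ n y ≤ r)
    (hp : p ∈ plausible Act β δ n q) (hp' : p' ∈ plausible Act β δ n q) (s' : S) :
    |p s' - p' s'| ≤ 2 * r := by
  obtain ⟨h0, h1, h2⟩ := hp.2 s'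
  obtain ⟨h0', h1', h2'⟩ := hp'.2 s'
  by_cases hq0 : q s' = 0
  · rw [h0 hq0, h0' hq0]; simpa using hr
  · by_cases hq1 : q s' = 1
    · rw [h1 hq1, h1' hq1]; simpa using hr
    · have a1 := abs_le.1 ((h2 hq0 hq1).1.trans (hψ _))
      have a2 := abs_le.1 ((h2' hq0 hq1).1.trans (hψ _))
      exact abs_le.2 ⟨by linarith [a1.1, a2.2], by linarith [a1.2, a2.1]⟩

end Plausible

end Optimism
end PlanRec.MDP.EndComponent

/-! ### One repeat of the algorithm and its stopping test -/

namespace PlanRec.MDP.EndComponent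

section Repeats

variable {S Act : Type*} [Fintype S] [Fintype Act] {M : MDP S Act} {E : M.EndComponent}
  {α β δ η ε cmax : ℝ} {n : ℕ} {q : S → Act → S → ℝ}

/-- The true transition probabilities of the end component are plausible. -/
def TruePlausible (E : M.EndComponent) (β δ : ℝ) (n : ℕ) (q : S → Act → S → ℝ) : Prop :=
  ∀ s ∈ E.states, ∀ a ∈ E.acts s, M.prob s a ∈ plausible Act β δ n (q s a)

theorem TruePlausible.isBellman (hq : E.TruePlausible β δ n q) (hα₀ : 0 ≤ α) :
    IsBellman α (E.choices fun s a => plausible Act β δ n (q s a)) (E.bellman α β δ n q) :=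
  isBellman_uncertainBellman hα₀ fun s hs a ha => ⟨isCompact_plausible n _, _, hq s hs a ha⟩

theorem TruePlausible.isDyn (hβ : 0 < β) (hq : E.TruePlausible β δ n q) {Q : S → Act → S → ℝ}
    (hQ : ∀ s ∈ E.states, ∀ a ∈ E.acts s, Q s a ∈ plausible Act β δ n (q s a)) : E.IsDyn Q :=
  fun s hs a ha => ⟨(hQ s hs a ha).1,
    fun s' => pos_iff_of_mem_plausible hβ (hQ s hs a ha) (hq s hs a ha) s'⟩

/-- A plausible distribution has the support of the true one, so no mass leaves the component. -/
theorem TruePlausible.mem_stdSimplex (hβ : 0 < β) (hq : E.TruePlausible β δ n q) {p : S → ℝ}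
    (s : E.states) {a : Act} (ha : a ∈ E.acts s) (hp : p ∈ plausible Act β δ n (q s a)) :
    (fun s' : E.states => p s') ∈ stdSimplex ℝ E.states := by
  refine ⟨fun s' => hp.1.1 s', ?_⟩
  rw [sum_states_eq (f := p)]
  · exact hp.1.2
  · intro t ht
    have h := pos_iff_of_mem_plausible hβ hp (hq s s.2 a ha) t
    rw [E.prob_eq_zero s.2 ha ht] at h
    exact le_antisymm (not_lt.1 fun hc => absurd (h.1 hc) (lt_irrefl 0)) (hp.1.1 t)

theorem TruePlausible.choices_spec (hβ : 0 < β)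
    (hcost : ∀ s, ∀ a ∈ M.avail s, 0 ≤ M.cost s a ∧ M.cost s a ≤ cmax)
    (hq : E.TruePlausible β δ n q) :
    ∀ s, ∀ k ∈ E.choices (fun s a => plausible Act β δ n (q s a)) s,
      0 ≤ k.1 ∧ k.2 ∈ stdSimplex ℝ E.states := by
  rintro s _ ⟨a, ha, p, hp, rfl⟩
  exact ⟨(hcost s a (E.acts_avail s s.2 ha)).1, hq.mem_stdSimplex hβ s ha hp⟩

variable (E) in
theorem exists_span_valueIter_le (hβ : 0 < β) (hα₀ : 0 < α) (hα : α < 1)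
    (hcost : ∀ s, ∀ a ∈ M.avail s, 0 ≤ M.cost s a ∧ M.cost s a ≤ cmax)
    (hβP : ∀ s, ∀ a ∈ M.avail s, ∀ s', 0 < M.prob s a s' → β ≤ M.prob s a s') :
    ∃ W, ∀ δ n q, E.TruePlausible β δ n q → ∀ j s t,
      E.valueIter α β δ n q j s - E.valueIter α β δ n q j t ≤ W := by
  obtain ⟨W, hW⟩ := IsBellman.exists_span_iterate_le (reflTransGen_step (E := E)) (c := cmax) hβ
    hα₀ hα
  refine ⟨W, fun δ n q hq => hW _ _ (hq.isBellman hα₀.le) (hq.choices_spec hβ hcost) ?_⟩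
  rintro s t ⟨a, ha, hp⟩
  exact ⟨_, ⟨a, ha, _, hq s s.2 a ha, rfl⟩, (hcost s a (E.acts_avail s s.2 ha)).2,
    hβP s a (E.acts_avail s s.2 ha) t hp⟩

theorem spanDist_le {v v' : E.states → ℝ} {g e : ℝ} (h : ∀ s, |v' s - v s - g| ≤ e) :
    E.spanDist v' v ≤ 2 * e := by
  have h1 : ⨆ s, (v' s - v s) ≤ g + e := ciSup_le fun s => by linarith [(abs_le.1 (h s)).2]
  have h2 : g - e ≤ ⨅ s, (v' s - v s) := le_ciInf fun s => by linarith [(abs_le.1 (h s)).1]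
  unfold spanDist
  linarith

theorem exists_pmf_of_etaWeight (hη : 0 < η) (hη₁ : η ≤ 1) (d : E.DetPolicy) :
    ∃ π : S → PMF Act, ∀ (s : E.states) a, (π s a).toReal = E.etaWeight η d s a := by
  obtain ⟨s₁, hs₁⟩ := E.nonempty
  obtain ⟨a₁, ha₁⟩ := E.acts_nonempty s₁ hs₁
  have : ∀ s : S, ∃ p : PMF Act, ∀ hs : s ∈ E.states, ∀ a,
      (p a).toReal = E.etaWeight η d ⟨s, hs⟩ a := fun s => by
    by_cases hs : s ∈ E.states
    · refine ⟨PMF.ofFintype (fun a => ENNReal.ofReal (E.etaWeight η d ⟨s, hs⟩ a)) ?_,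
        fun _ a => ?_⟩
      · rw [← ENNReal.ofReal_sum_of_nonneg fun a _ => etaWeight_nonneg hη hη₁ d _ a,
          sum_etaWeight, ENNReal.ofReal_one]
      · rw [PMF.ofFintype_apply, ENNReal.toReal_ofReal (etaWeight_nonneg hη hη₁ d _ a)]
    · exact ⟨PMF.pure a₁, fun h => absurd h hs⟩
  choose π hπ using this
  exact ⟨π, fun s a => hπ s s.2 a⟩

theorem TruePlausible.exists_isPass (hβ : 0 < β) (hα₀ : 0 < α) (hα : α < 1) (hη : 0 < η)
    (hη₁ : η ≤ 1) (hε : 0 < ε)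
    (hcost : ∀ s, ∀ a ∈ M.avail s, 0 ≤ M.cost s a ∧ M.cost s a ≤ cmax)
    (hβP : ∀ s, ∀ a ∈ M.avail s, ∀ s', 0 < M.prob s a s' → β ≤ M.prob s a s')
    (hq : E.TruePlausible β δ n q) : ∃ R : E.Pass, E.IsPass α β δ η ε n q R := by
  classical
  obtain ⟨W, hW⟩ := E.exists_span_valueIter_le hβ hα₀ hα hcost hβP
  obtain ⟨g, hg⟩ := (hq.isBellman hα₀.le).increments_converge hα₀.le hα
    (fun s k hk => (hq.choices_spec hβ hcost s k hk).2) (hW δ n q hq)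
  -- Increments within `ε / 6` of `g` have span at most `ε / 3 < 2 ε / 3`.
  obtain ⟨n₀, hn₀⟩ := hg (ε / 6) (by positivity)
  have hex : ∃ j, E.spanDist (E.valueIter α β δ n q (j + 1)) (E.valueIter α β δ n q j) <
      2 * ε / 3 := ⟨n₀, (spanDist_le (hn₀ n₀ le_rfl)).trans_lt (by linarith)⟩
  set j := Nat.find hex
  set v' := E.valueIter α β δ n q (j + 1)
  have hdyn : ∀ s : S, ∀ a, ∃ p : S → ℝ, s ∈ E.states → a ∈ E.acts s →
      p ∈ plausible Act β δ n (q s a) ∧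
        ∀ p' ∈ plausible Act β δ n (q s a), E.pair p v' ≤ E.pair p' v' := fun s a => by
    by_cases h : s ∈ E.states ∧ a ∈ E.acts s
    · obtain ⟨p, hp, -, hmin⟩ := exists_pair_eq_sInf (isCompact_plausible (Act := Act) n (q s a))
        ⟨_, hq s h.1 a h.2⟩ v'
      exact ⟨p, fun _ _ => ⟨hp, hmin⟩⟩
    · exact ⟨0, fun h1 h2 => absurd ⟨h1, h2⟩ h⟩
  choose dyn hdyn using hdyn
  have hd : ∀ s : E.states, ∃ d : {a // a ∈ E.acts s}, ∀ a : {a // a ∈ E.acts s},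
      E.qValue α β δ n q v' s d ≤ E.qValue α β δ n q v' s a := fun s => Finite.exists_min _
  choose d hd using hd
  obtain ⟨π, hπ⟩ := exists_pmf_of_etaWeight hη hη₁ (E := E) d
  exact ⟨⟨E.valueIter α β δ n q j, v', dyn, d, π⟩,
    ⟨j, rfl, rfl, Nat.find_spec hex, fun i hi => not_lt.1 (Nat.find_min hex hi)⟩,
    fun s a ha => hdyn s a s.2 ha, fun s a ha => hd s ⟨a, ha⟩, hπ⟩

theorem IsPass.isPolicy {R : E.Pass} (hR : E.IsPass α β δ η ε n q R) : E.IsPolicy R.policy := by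
  intro s hs a ha
  by_contra hc
  have h1 := hR.policy_eq ⟨s, hs⟩ a
  rw [etaWeight_eq_zero _ _ hc] at h1
  rcases (ENNReal.toReal_eq_zero_iff _).1 h1 with h | h
  · exact ha h
  · exact (R.policy s).apply_ne_top a h

theorem IsPass.isFull (hη : 0 < η) (hη₁ : η ≤ 1) {R : E.Pass} (hR : E.IsPass α β δ η ε n q R) :
    E.IsFull R.policy := by
  intro s hs a ha h0
  have h1 := hR.policy_eq ⟨s, hs⟩ a
  rw [h0, ENNReal.toReal_zero] at h1
  exact (etaWeight_pos hη hη₁ R.greedy ⟨s, hs⟩ ha).ne h1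

theorem pair_sub_le {Q : S → Act → S → ℝ} (hQ : E.IsDyn Q) (s : E.states) {a : Act}
    (ha : a ∈ E.acts s) {v : E.states → ℝ} {W : ℝ} (hv : ∀ i j, v i - v j ≤ W) :
    E.pair (Q s a) v - v s ≤ W := by
  have := sum_mul_le_of_mem_stdSimplex (hQ.mem_stdSimplex s ha) (v := v) (B := v s + W)
    fun j => by linarith [hv j s]
  unfold pair
  linarith

/-- One step of the `η`-greedy policy in the optimistic dynamics increases the value by hardly more
than the last iteration did. -/
theorem IsPass.step_le (hβ : 0 < β) (hα₀ : 0 < α) (hα : α < 1) (hη : 0 < η) (hη₁ : η ≤ 1)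
    (hcost : ∀ s, ∀ a ∈ M.avail s, 0 ≤ M.cost s a ∧ M.cost s a ≤ cmax)
    (hq : E.TruePlausible β δ n q) {R : E.Pass} (hR : E.IsPass α β δ η ε n q R) {W : ℝ}
    (hW : ∀ i j, R.v' i - R.v' j ≤ W) (s : E.states) :
    ∑ a, E.etaWeight η R.greedy s a * M.cost s a +
        (E.chain α R.dyn (E.etaWeight η R.greedy)).mulVec R.v' s - R.v' s ≤
      (⨆ s, (R.v' s - R.v s)) + η * (cmax + α * W) := by
  have hT := hq.isBellman (α := α) hα₀.le
  have hK := hq.choices_spec hβ hcost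
  obtain ⟨j, hv, hv', -, -⟩ := hR.iterates
  have hvT : R.v' = E.bellman α β δ n q R.v := by
    rw [hv, hv', valueIter, valueIter, Function.iterate_succ_apply']
  have hdyn : E.IsDyn R.dyn := hq.isDyn hβ fun s hs a ha => (hR.optimistic ⟨s, hs⟩ a ha).1
  set Mx := ⨆ s, (R.v' s - R.v s) with hMx
  have hle : ∀ s, R.v' s - R.v s ≤ Mx := fun s =>
    le_ciSup (f := fun s => R.v' s - R.v s) (Set.finite_range _).bddAbove s
  -- The iterates increase. Nonnegativity is used at the end to replace `(1 - η) Mx` by `Mx`.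
  have hMx0 : 0 ≤ Mx := by
    refine le_trans ?_ (hle s)
    rw [hv, hv']
    exact hT.iterate_mono hα₀.le hα hK j s
  -- The policy is greedy at `v'`, not at `v`, so one further update enters; the maximal increment
  -- does not grow.
  have hinc : E.bellman α β δ n q R.v' s - R.v' s ≤ Mx := by
    have h1 := hT.increment_le hα₀.le (fun s k hk => (hK s k hk).2) hle s
    rw [← hvT] at h1
    nlinarith [hle s]
  have hval : ∀ a ∈ E.acts s, E.qValue α β δ n q R.v' s a =
      M.cost s a + α * E.pair (R.dyn s a) R.v' := fun a ha => by
    have hl : IsLeast ((fun p => E.pair p R.v') '' plausible Act β δ n (q s a))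
        (E.pair (R.dyn s a) R.v') := by
      refine ⟨⟨_, (hR.optimistic s a ha).1, rfl⟩, ?_⟩
      rintro _ ⟨p, hp, rfl⟩
      exact (hR.optimistic s a ha).2 p hp
    rw [qValue, hl.csInf_eq]
  set f : Act → ℝ := fun a =>
    M.cost s a + (α * E.pair (R.dyn s a) R.v' + (1 - α) * R.v' s) - R.v' s with hf
  have hfd : f (R.greedy s) ≤ Mx := by
    refine le_trans ?_ hinc
    obtain ⟨⟨_, ⟨a, ha, p, hp, rfl⟩, h⟩, -⟩ := hT R.v' s
    have h1 := hR.greedy_le s a ha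
    rw [hval _ (R.greedy s).2, hval a ha] at h1
    have h2 := mul_le_mul_of_nonneg_left ((hR.optimistic s a ha).2 p hp) hα₀.le
    rw [← h]
    simp only [hf]
    change _ ≤ M.cost s a + α * E.pair p R.v' + (1 - α) * R.v' s - R.v' s
    linarith
  have hfa : ∀ a ∈ E.acts s, f a ≤ cmax + α * W := fun a ha => by
    have h1 := pair_sub_le hdyn s ha hW
    have h2 := (hcost s a (E.acts_avail s s.2 ha)).2
    simp only [hf]
    nlinarith
  have hsum : ∑ a, E.etaWeight η R.greedy s a * M.cost s a +
        (E.chain α R.dyn (E.etaWeight η R.greedy)).mulVec R.v' s - R.v' s =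
      ∑ a, E.etaWeight η R.greedy s a * f a := by
    rw [mulVec_chain]
    simp only [hf, mul_sub, mul_add (E.etaWeight η R.greedy s _) (M.cost s _),
      Finset.sum_sub_distrib, Finset.sum_add_distrib, ← Finset.sum_mul, sum_etaWeight, one_mul]
  rw [hsum, sum_etaWeight_mul]
  have hcard : (0 : ℝ) < (E.acts s).card := by
    exact_mod_cast Finset.card_pos.2 (E.acts_nonempty s s.2)
  have havg : ((E.acts s).card : ℝ)⁻¹ * ∑ a ∈ E.acts s, f a ≤ cmax + α * W := by
    rw [inv_mul_le_iff₀ hcard]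
    calc _ ≤ ∑ a ∈ E.acts s, (cmax + α * W) := Finset.sum_le_sum hfa
      _ = _ := by rw [Finset.sum_const, nsmul_eq_mul]
  nlinarith [mul_le_mul_of_nonneg_left havg hη.le,
    mul_le_mul_of_nonneg_left hfd (by linarith : 0 ≤ 1 - η), mul_nonneg hη.le hMx0]

/-- Bernoulli's inequality removes the `m`-th root: `1 + m x ≤ (1 + x)^m ≤ 1 + t`. -/
theorem StopTest.mul_le (hα₀ : 0 < α) (hα : α < 1) (hη : 0 < η) (hη₁ : η ≤ 1) (hε : 0 < ε)
    (hc : 0 < cmax) {ρ : ℝ} (hρ : 0 ≤ ρ) {R : E.Pass} (hdyn : E.IsDyn R.dyn)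
    (h : E.StopTest α η ε cmax ρ R) :
    E.mixExp α η R.dyn * (α * (E.states.card * ρ)) * cmax ≤
      ε / 3 * (1 - E.erg α η R.dyn (E.mixExp α η R.dyn) R.greedy) := by
  have hΔ := erg_mixExp_lt_one hα₀ hα hη hη₁ hdyn R.greedy
  have hm := one_le_mixExp hα₀ hα hη hη₁ hdyn
  have hcard : (0 : ℝ) < E.states.card := by exact_mod_cast Finset.card_pos.2 E.nonempty
  unfold StopTest at h
  simp only at h
  set m := E.mixExp α η R.dyn
  set Δ := E.erg α η R.dyn m R.greedy
  set t := ε / 3 * (1 - Δ) / cmax with ht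
  have ht0 : 0 ≤ t := div_nonneg (mul_nonneg (by linarith) (by linarith)) hc.le
  have h1 : 1 + α * (E.states.card * ρ) ≤ (t + 1) ^ (1 / (m : ℝ)) := by
    rw [one_div_mul_eq_div, le_div_iff₀ (by positivity)] at h
    linarith
  have h2 : (1 + α * (E.states.card * ρ)) ^ m ≤ t + 1 := by
    refine (pow_le_pow_left₀ (by positivity) h1 m).trans (le_of_eq ?_)
    rw [one_div, Real.rpow_inv_natCast_pow (by linarith) (by omega)]
  have h3 := one_add_mul_le_pow (show -2 ≤ α * (E.states.card * ρ) by
    have : 0 ≤ α * (E.states.card * ρ) := by positivity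
    linarith) m
  have h4 : m * (α * (E.states.card * ρ)) ≤ t := by linarith
  rwa [ht, le_div_iff₀ hc] at h4

theorem IsPass.gain_lt [MeasurableSpace S] [MeasurableSingletonClass S]
    [MeasurableSpace Act] [MeasurableSingletonClass Act]
    (hβ : 0 < β) (hα₀ : 0 < α) (hα : α < 1) (hη : 0 < η) (hη₁ : η ≤ 1) (hε : 0 < ε)
    (hc : 0 < cmax)
    (hcost : ∀ s, ∀ a ∈ M.avail s, 0 ≤ M.cost s a ∧ M.cost s a ≤ cmax)
    (hq : E.TruePlausible β δ n q) {R : E.Pass} (hR : E.IsPass α β δ η ε n q R) {W ρ : ℝ}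
    (hW : ∀ i j, R.v' i - R.v' j ≤ W) (hηW : η * (cmax + α * W) ≤ ε / 100) (hρ : 0 ≤ ρ)
    (hψ : ∀ y, psi S Act δ n y ≤ 19 / 20 * ρ) (htest : E.StopTest α η ε cmax ρ R)
    {π' : S → PMF Act} (hπ' : E.IsPolicy π') {s : S} (hs : s ∈ E.states) :
    M.gain R.policy s < M.gain π' s + ε := by
  classical
  have hdyn : E.IsDyn R.dyn := hq.isDyn hβ fun s hs a ha => (hR.optimistic ⟨s, hs⟩ a ha).1
  have hΔ := erg_mixExp_lt_one hα₀ hα hη hη₁ hdyn R.greedy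
  have hmul := htest.mul_le hα₀ hα hη hη₁ hε hc hρ hdyn
  have hstep := hR.step_le hβ hα₀ hα hη hη₁ hcost hq hW
  have hB := chain_mem_rowStochastic hα₀ hα hη hη₁ hdyn R.greedy
  have hB' := chain_mem_rowStochastic hα₀ hα hη hη₁ E.isDyn_prob R.greedy
  -- Both dynamics are within `19/20 ρ` of the empirical frequencies, hence within twice that of
  -- each other.
  have hdiff := sum_abs_chain_sub_le (E := E) (Q := M.prob) (Q' := R.dyn) hα₀ hη hη₁ R.greedy
    (fun s hs a ha s' => abs_sub_le_of_mem_plausible (by positivity) hψ (hq s hs a ha)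
      (hR.optimistic ⟨s, hs⟩ a ha).1 s')
  have hspan : (⨆ s, (R.v' s - R.v s)) - (⨅ s, (R.v' s - R.v s)) < 2 * ε / 3 := by
    obtain ⟨j, -, -, h, -⟩ := hR.iterates
    exact h
  have hlow : (⨅ s, (R.v' s - R.v s)) ≤ M.gain π' s := by
    refine hπ'.le_gain_of_isBellman (hq.isBellman hα₀.le) hq (v := R.v) (fun t => ?_) hs
    obtain ⟨j, hv, hv', -, -⟩ := hR.iterates
    have hvT : R.v' = E.bellman α β δ n q R.v := by
      rw [hv, hv', valueIter, valueIter, Function.iterate_succ_apply']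
    rw [← hvT]
    exact ciInf_le (f := fun s => R.v' s - R.v s) (Set.finite_range _).bddBelow t
  rw [erg_eq] at hΔ hmul
  set B := E.chain α R.dyn (E.etaWeight η R.greedy)
  set B' := E.chain α M.prob (E.etaWeight η R.greedy)
  set m := E.mixExp α η R.dyn
  set c : E.states → ℝ := fun s => ∑ a, E.etaWeight η R.greedy s a * M.cost s a with hcdef
  have hc0 : ∀ s, 0 ≤ c s ∧ c s ≤ cmax := fun s => by
    have hterm : ∀ a, 0 ≤ E.etaWeight η R.greedy s a * M.cost s a ∧
        E.etaWeight η R.greedy s a * M.cost s a ≤ E.etaWeight η R.greedy s a * cmax := fun a => by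
      by_cases ha : a ∈ E.acts s
      · have hw := etaWeight_nonneg hη hη₁ R.greedy s a
        obtain ⟨h1, h2⟩ := hcost s a (E.acts_avail s s.2 ha)
        exact ⟨mul_nonneg hw h1, mul_le_mul_of_nonneg_left h2 hw⟩
      · simp [etaWeight_eq_zero R.greedy s ha]
    refine ⟨Finset.sum_nonneg fun a _ => (hterm a).1, ?_⟩
    calc c s ≤ ∑ a, E.etaWeight η R.greedy s a * cmax :=
          Finset.sum_le_sum fun a _ => (hterm a).2
      _ = cmax := by rw [← Finset.sum_mul, sum_etaWeight, one_mul]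
  obtain ⟨h, hosc, hres⟩ := exists_approx_poisson hB hΔ (c := c) (C := cmax)
    (fun i j => by linarith [(hc0 i).2, (hc0 j).1]) (show 0 < ε / 1000 by positivity)
  -- The nearly constant residual of `h` bounds the average cost of the optimistic chain from below,
  -- and `v'` bounds it from above.
  have hopt : ∀ i, c i + B.mulVec h i - h i - ε / 1000 ≤
      (⨆ s, (R.v' s - R.v s)) + η * (cmax + α * W) := fun i =>
    poisson_bounds_le hB (c := c) (h := h) (fun j => by linarith [hres i j]) hstep
  have hpert : ∀ i, B'.mulVec h i - B.mulVec h i ≤ 19 / 20 * (ε / 3) := fun i => by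
    have h1 := abs_sum_mul_le_of_sum_eq_zero (d := fun k => B' i k - B i k)
      (by rw [Finset.sum_sub_distrib, sum_row hB', sum_row hB, sub_self]) hosc
    have e : ∑ k, (B' i k - B i k) * h k = B'.mulVec h i - B.mulVec h i := by
      simp [Matrix.mulVec, dotProduct, sub_mul, Finset.sum_sub_distrib]
    rw [e] at h1
    refine (le_abs_self _).trans (h1.trans ?_)
    have hX : 0 ≤ (m : ℝ) * cmax / (1 - ergCoeff (B ^ m)) :=
      div_nonneg (by positivity) (by linarith)
    calc _ ≤ (1 / 2 * (α * (E.states.card * (2 * (19 / 20 * ρ))))) *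
          (m * cmax / (1 - ergCoeff (B ^ m))) :=
          mul_le_mul_of_nonneg_right (by linarith [hdiff i]) hX
      _ = 19 / 20 * ((m * (α * (E.states.card * ρ)) * cmax) / (1 - ergCoeff (B ^ m))) := by ring
      _ ≤ 19 / 20 * (ε / 3) := by
          refine mul_le_mul_of_nonneg_left ?_ (by norm_num)
          rw [div_le_iff₀ (by linarith)]
          exact hmul
  have hup : M.gain R.policy s ≤ (⨆ s, (R.v' s - R.v s)) + ε / 100 + ε / 1000 +
      19 / 20 * (ε / 3) := by
    refine hR.isPolicy.gain_le_of_le (α := α) (v := h) (fun t => ?_) hs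
    have e : ∑ a, (R.policy t a).toReal *
        (M.cost t a + α * E.pair (M.prob t a) h + (1 - α) * h t) = c t + B'.mulVec h t := by
      rw [mulVec_chain, hcdef, ← Finset.sum_add_distrib]
      refine Finset.sum_congr rfl fun a _ => ?_
      rw [hR.policy_eq]
      ring
    rw [e]
    linarith [hopt t, hpert t]
  -- In units of `ε` the errors are `2/3 + 19/60 + 1/100 + 1/1000 < 1`.
  linarith

/-- Let `z = m α |A| ρ` and `κ = ε (1 - Δ̄) / (3 c_max)`, so that `z ≤ κ / 2 ≤ 1/6`; here `ε ≤
c_max` enters. The optimistic `Δ` is at most `Δ̄ + 2 z`, so the quantity `t` in the test is at least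
`κ - 2 z / 3`. On the other side `(1 + α |A| ρ)^m ≤ exp z ≤ 1 + z + z²`, and `z + z² + 2 z / 3 ≤
11/6 z ≤ κ`. -/
theorem stopTest_of_le (hα₀ : 0 < α) (hα : α < 1) (hη : 0 < η) (hη₁ : η ≤ 1) (hε : 0 < ε)
    (hεc : ε ≤ cmax) {ρ : ℝ} (hρ : 0 ≤ ρ) {R : E.Pass} (hdyn : E.IsDyn R.dyn)
    (hclose : ∀ s ∈ E.states, ∀ a ∈ E.acts s, ∀ s', |R.dyn s a s' - M.prob s a s'| ≤ 2 * ρ)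
    (hρY : 6 * E.complexity α η ε cmax * ρ ≤ 1) : E.StopTest α η ε cmax ρ R := by
  classical
  have hc : 0 < cmax := hε.trans_le hεc
  have hD := ergBar_lt_one (E := E) hα₀ hα hη hη₁
  have hD0 := ergBar_nonneg (E := E) (α := α) (η := η)
  have hm := one_le_mixExp hα₀ hα hη hη₁ hdyn
  have hcard : (0 : ℝ) < E.states.card := by exact_mod_cast Finset.card_pos.2 E.nonempty
  have hB := chain_mem_rowStochastic hα₀ hα hη hη₁ hdyn R.greedy
  have hB' := chain_mem_rowStochastic hα₀ hα hη hη₁ E.isDyn_prob R.greedy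
  have hpow := sum_abs_pow_sub_le hB hB'
    (sum_abs_chain_sub_le hα₀ hη hη₁ R.greedy hclose) (E.mixExp α η R.dyn)
  have herg := ergCoeff_le_add hpow
  rw [← erg_eq, ← erg_eq] at herg
  have hmeq := mixExp_eq hα₀ hα hη hη₁ hdyn E.isDyn_prob
  have hbar := erg_le_ergBar (α := α) (η := η) R.greedy
  rw [← hmeq] at hbar
  unfold complexity at hρY
  rw [← hmeq] at hρY
  unfold StopTest
  simp only
  set m := E.mixExp α η R.dyn
  set Δ := E.erg α η R.dyn m R.greedy
  set D := E.ergBar α η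
  have hm0 : (0 : ℝ) < m := by exact_mod_cast hm
  set u := ε / 3 / cmax with hu
  have hu0 : 0 < u := by positivity
  have hu1 : u ≤ 1 / 3 := by rw [hu, div_le_iff₀ hc]; linarith
  set z := m * (α * (E.states.card * ρ)) with hz
  have hz0 : 0 ≤ z := by positivity
  set κ := u * (1 - D) with hκ
  have hκ1 : κ ≤ 1 / 3 := by nlinarith
  have hzκ : z ≤ κ / 2 := by
    have h1 : 6 * (m * E.states.card * cmax / (ε * (1 - D))) * ρ =
        2 * (m * (E.states.card * ρ)) / κ := by
      have : 1 - D ≠ 0 := by linarith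
      rw [hκ, hu]
      field_simp
      ring
    have hκ0 : 0 < κ := mul_pos hu0 (by linarith)
    rw [h1, div_le_one hκ0] at hρY
    have h2 : z ≤ m * (E.states.card * ρ) := by
      rw [hz]
      refine mul_le_mul_of_nonneg_left ?_ hm0.le
      nlinarith [mul_nonneg hcard.le hρ]
    linarith
  have hΔ : Δ ≤ D + 2 * z := by
    have : (m : ℝ) * (α * (E.states.card * (2 * ρ))) = 2 * z := by rw [hz]; ring
    linarith
  set t := ε / 3 * (1 - Δ) / cmax with ht
  have htu : t = u * (1 - Δ) := by rw [ht, hu]; ring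
  have hpow1 : (1 + α * (E.states.card * ρ)) ^ m ≤ t + 1 := by
    have h1 : 1 + α * (E.states.card * ρ) ≤ Real.exp (α * (E.states.card * ρ)) := by
      linarith [Real.add_one_le_exp (α * (E.states.card * ρ))]
    have h2 : (1 + α * (E.states.card * ρ)) ^ m ≤ Real.exp z := by
      rw [hz, Real.exp_nat_mul]
      exact pow_le_pow_left₀ (by positivity) h1 m
    have h3 := Real.abs_exp_sub_one_sub_id_le (x := z)
      (by rw [abs_of_nonneg hz0]; linarith)
    have h4 := (abs_le.1 h3).2
    have h5 : κ - 2 / 3 * z ≤ t := by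
      rw [htu, hκ]
      nlinarith
    nlinarith
  have hroot : 1 + α * (E.states.card * ρ) ≤ (t + 1) ^ (1 / (m : ℝ)) := by
    rw [one_div]
    calc 1 + α * (E.states.card * ρ) = ((1 + α * (E.states.card * ρ)) ^ m) ^ ((m : ℝ)⁻¹) :=
          (Real.pow_rpow_inv_natCast (by positivity) (by omega)).symm
      _ ≤ _ := Real.rpow_le_rpow (by positivity) hpow1 (by positivity)
  rw [one_div_mul_eq_div, le_div_iff₀ (by positivity)]
  linarith

end Repeats
end PlanRec.MDP.EndComponent

/-! ### Halving of the accuracy, and assembly -/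

namespace PlanRec.MDP

section Main

variable {S Act : Type*} [Fintype S] [Fintype Act] {M : MDP S Act} {E : M.EndComponent}
  {α β δ η ε cmax : ℝ}

theorem EndComponent.le_one_of_le_prob (E : M.EndComponent)
    (hβP : ∀ s, ∀ a ∈ M.avail s, ∀ s', 0 < M.prob s a s' → β ≤ M.prob s a s') : β ≤ 1 := by
  obtain ⟨s, hs⟩ := E.nonempty
  obtain ⟨a, ha⟩ := E.acts_nonempty s hs
  obtain ⟨s', -, h⟩ := Finset.exists_lt_of_sum_lt (s := Finset.univ) (f := fun _ : S => (0 : ℝ))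
    (g := M.prob s a) (by simp [M.sum_prob])
  refine (hβP s a (E.acts_avail s hs ha) s' h).trans ?_
  rw [← M.sum_prob s a]
  exact Finset.single_le_sum (fun t _ => M.prob_nonneg s a t) (Finset.mem_univ s')

theorem EndComponent.one_le_complexity (hα₀ : 0 < α) (hα : α < 1) (hη : 0 < η) (hη₁ : η ≤ 1)
    (hε : 0 < ε) (hεc : ε ≤ cmax) : 1 ≤ E.complexity α η ε cmax := by
  have hD := EndComponent.ergBar_lt_one (E := E) hα₀ hα hη hη₁
  have hD0 := EndComponent.ergBar_nonneg (E := E) (α := α) (η := η)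
  have hm : (1 : ℝ) ≤ E.mixExp α η M.prob := by
    exact_mod_cast EndComponent.one_le_mixExp hα₀ hα hη hη₁ E.isDyn_prob
  have hcard : (1 : ℝ) ≤ E.states.card := by exact_mod_cast Finset.card_pos.2 E.nonempty
  unfold EndComponent.complexity
  rw [le_div_iff₀ (mul_pos hε (by linarith)), one_mul]
  have h1 : ε * (1 - E.ergBar α η) ≤ cmax := by nlinarith
  have h2 : 1 ≤ (E.mixExp α η M.prob : ℝ) * E.states.card := by nlinarith
  nlinarith

theorem rho_le_half {k : ℕ} (hk : 1 ≤ k) : rho k ≤ 1 / 2 := by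
  unfold rho
  simpa using pow_le_pow_of_le_one (by norm_num : (0 : ℝ) ≤ 1 / 2) (by norm_num) hk

theorem rho_pos (k : ℕ) : 0 < rho k := by unfold rho; positivity

theorem mul_rho_le_one {y : ℝ} (hy : 0 < y) {k : ℕ} (hk : Real.logb 2 y ≤ k) : y * rho k ≤ 1 := by
  rw [Real.logb_le_iff_le_rpow (by norm_num) hy, Real.rpow_natCast] at hk
  unfold rho
  rw [one_div, inv_pow, ← div_eq_mul_inv, div_le_one (by positivity)]
  exact hk

theorem one_div_le_rho {y : ℝ} (hy : 0 < y) {k : ℕ} (hk : (k : ℝ) ≤ Real.logb 2 y + 1) :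
    1 / (2 * y) ≤ rho k := by
  have h : (k : ℝ) ≤ Real.logb 2 (2 * y) := by
    rw [Real.logb_mul (by norm_num) hy.ne', Real.logb_self_eq_one (by norm_num)]
    linarith
  rw [Real.le_logb_iff_rpow_le (by norm_num) (by positivity), Real.rpow_natCast] at h
  unfold rho
  rw [one_div_pow]
  exact one_div_le_one_div_of_le (by positivity) h

variable [MeasurableSpace S] [MeasurableSingletonClass S]

/-- Needed besides concentration: a sampled impossible transition would enter the plausible
supports. -/
theorem ae_possible {Ω : Type*} [MeasurableSpace Ω] {μ : Measure Ω} {X : S → Act → ℕ → Ω → S}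
    (hX : ∀ s a i, Measurable (X s a i))
    (hlaw : ∀ s, ∀ a ∈ M.avail s, ∀ i, μ.map (X s a i) = (M.P s a).toMeasure) :
    ∀ᵐ ω ∂μ, M.Possible fun s a i => X s a i ω := by
  unfold Possible
  simp only [ae_all_iff]
  intro s a ha i
  have hms : MeasurableSet {t | ¬ 0 < M.prob s a t} := (Set.toFinite _).measurableSet
  rw [ae_iff]
  change μ (X s a i ⁻¹' {t | ¬ 0 < M.prob s a t}) = 0
  rw [← Measure.map_apply (hX s a i) hms, hlaw s a ha i, PMF.toMeasure_apply_eq_zero_iff _ hms,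
    Set.disjoint_left]
  intro t ht ht'
  exact ht' (ENNReal.toReal_pos ht ((M.P s a).apply_ne_top t))

end Main
end PlanRec.MDP

open PlanRec PlanRec.MDP

theorem mainTheorem2 :
    ∃ K : ℝ, 0 < K ∧
    ∀ (S : Type*) (Act : Type*) [Fintype S] [Fintype Act]
      [MeasurableSpace S] [MeasurableSingletonClass S]
      [MeasurableSpace Act] [MeasurableSingletonClass Act]
      (M : PlanRec.MDP S Act) (E : M.EndComponent) (_ : E.IsAMEC)
      (cmax β α ε : ℝ)
      (_ : 0 < cmax) (_ : ∀ s, ∀ a ∈ M.avail s, 0 ≤ M.cost s a ∧ M.cost s a ≤ cmax)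
      (_ : 0 < β) (_ : ∀ s, ∀ a ∈ M.avail s, ∀ s', 0 < M.prob s a s' → β ≤ M.prob s a s')
      (_ : 0 < α) (_ : α < 1) (_ : 0 < ε) (_ : ε ≤ cmax),
    ∃ ηstar : ℝ, 0 < ηstar ∧ ηstar ≤ 1 ∧
    ∀ (η : ℝ) (_ : 0 < η) (_ : η ≤ ηstar)
      (δ : ℝ) (_ : 0 < δ) (_ : δ < 1)
      (n₀ : ℕ) (_ : PlanRec.phiSupport S Act β δ ≤ n₀)
      (Ω : Type*) [MeasurableSpace Ω] (μ : MeasureTheory.Measure Ω)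
      [MeasureTheory.IsProbabilityMeasure μ]
      (X : S → Act → ℕ → Ω → S) (_ : ∀ s a i, Measurable (X s a i))
      (_ : ∀ s, ∀ a ∈ M.avail s, ProbabilityTheory.iIndepFun (X s a) μ)
      (_ : ∀ s, ∀ a ∈ M.avail s, ∀ i, μ.map (X s a i) = (M.P s a).toMeasure),
    E.ergBar α η < 1 ∧
    (∃ πA, E.IsGainOptimal πA) ∧
    ENNReal.ofReal (1 - δ) ≤ μ {ω | M.Concentrated δ (fun s a i => X s a i ω)} ∧
    ∀ᵐ ω ∂μ, M.Concentrated δ (fun s a i => X s a i ω) →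
      (∀ k : ℕ, 1 ≤ k → ∃ R : E.Pass, E.IsRepeat α β δ η ε n₀ (fun s a i => X s a i ω) k R) ∧
      ∀ R : ℕ → E.Pass,
        (∀ k : ℕ, 1 ≤ k → E.IsRepeat α β δ η ε n₀ (fun s a i => X s a i ω) k (R k)) →
        ∃ N : ℕ, 1 ≤ N ∧
          (∀ k : ℕ, 1 ≤ k → k < N → ¬ E.StopTest α η ε cmax (PlanRec.rho k) (R k)) ∧
          E.StopTest α η ε cmax (PlanRec.rho N) (R N) ∧
          (N : ℤ) ≤ ⌈Real.logb 2 (6 * E.complexity α η ε cmax)⌉ ∧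
          (PlanRec.sampleSize S Act δ n₀ N : ℝ) - n₀ ≤
            K * E.complexity α η ε cmax ^ 2 *
              (1 + Real.log ((Fintype.card S : ℝ) ^ 2 * Fintype.card Act
                * E.complexity α η ε cmax / δ)) ∧
          (∀ πA, E.IsGainOptimal πA → ∀ s ∈ E.states,
            |M.gain ((R N).policy) s - M.gain πA s| < ε) ∧
          ∀ s ∈ E.states, M.satProb ((R N).policy) s = 1 := by
  classical
  refine ⟨20000, by norm_num, ?_⟩
  intro S Act _ _ _ _ _ _ M E hE cmax β α ε hc hcost hβ hβP hα₀ hα hε hεc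
  obtain ⟨W, hW⟩ := E.exists_span_valueIter_le hβ hα₀ hα hcost hβP
  have hden : 0 < cmax + α * |W| := by positivity
  -- This keeps the loss from exploration below `ε / 100`; the absolute value makes the denominator
  -- positive.
  refine ⟨min 1 (ε / 100 / (cmax + α * |W|)), by positivity, min_le_left _ _, ?_⟩
  intro η hη hηs δ hδ hδ₁ n₀ hn₀ Ω _ μ _ X hX hind hlaw
  have hη₁ : η ≤ 1 := hηs.trans (min_le_left _ _)
  have hηW : η * (cmax + α * |W|) ≤ ε / 100 := by
    rw [← le_div_iff₀ hden]
    exact hηs.trans (min_le_right _ _)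
  have hβ₁ : β ≤ 1 := E.le_one_of_le_prob hβP
  obtain ⟨s₁, hs₁⟩ := E.nonempty
  obtain ⟨a₁, ha₁⟩ := E.acts_nonempty s₁ hs₁
  have : Nonempty S := ⟨s₁⟩
  have : Nonempty Act := ⟨a₁⟩
  refine ⟨EndComponent.ergBar_lt_one hα₀ hα hη hη₁, EndComponent.exists_isGainOptimal hcost hβ hβP,
    ofReal_le_measure_concentrated hδ hδ₁ hX hind hlaw, ?_⟩
  filter_upwards [ae_possible hX hlaw] with ω hposs hconc
  have hsize : ∀ k, 1 < sampleSize S Act δ n₀ k ∧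
      7 / 3 * xi S Act δ (sampleSize S Act δ n₀ k) < β := fun k =>
    xi_lt_of_phiSupport_le hβ hβ₁ hδ hδ₁ (hn₀.trans (by
      exact_mod_cast le_max_left n₀ (psiInv S Act δ (rho k))))
  have hq : ∀ k, E.TruePlausible β δ (sampleSize S Act δ n₀ k)
      (empirical (fun s a i => X s a i ω) (sampleSize S Act δ n₀ k)) := fun k s hs a ha =>
    EndComponent.prob_mem_plausible hβP hconc hposs (hsize k).1 (hsize k).2 (E.acts_avail s hs ha)
  have hψ : ∀ k y, psi S Act δ (sampleSize S Act δ n₀ k) y ≤ 19 / 20 * rho k := fun k y =>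
    psi_le_of_psiInv_le hδ hδ₁ (rho_pos k) (le_max_right n₀ _) (hsize k).1 y
  refine ⟨fun k _ => (hq k).exists_isPass hβ hα₀ hα hη hη₁ hε hcost hβP, fun R hR => ?_⟩
  have hY := EndComponent.one_le_complexity (E := E) hα₀ hα hη hη₁ hε hεc
  set Y := E.complexity α η ε cmax
  have hlogpos : 0 < Real.logb 2 (6 * Y) := Real.logb_pos (by norm_num) (by linarith)
  have hceil0 : 0 < ⌈Real.logb 2 (6 * Y)⌉ := Int.ceil_pos.2 hlogpos
  obtain ⟨k₀, hk₀⟩ : ∃ k₀ : ℕ, (k₀ : ℤ) = ⌈Real.logb 2 (6 * Y)⌉ :=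
    ⟨_, Int.toNat_of_nonneg hceil0.le⟩
  have hk₀1 : 1 ≤ k₀ := by omega
  have hk₀r : (k₀ : ℝ) = (⌈Real.logb 2 (6 * Y)⌉ : ℝ) := by exact_mod_cast hk₀
  have htest : E.StopTest α η ε cmax (rho k₀) (R k₀) := by
    have hRk := hR k₀ hk₀1
    refine EndComponent.stopTest_of_le hα₀ hα hη hη₁ hε hεc (rho_pos k₀).le
      ((hq k₀).isDyn hβ fun s hs a ha => (hRk.optimistic ⟨s, hs⟩ a ha).1) (fun s hs a ha s' => ?_) ?_
    · exact EndComponent.abs_sub_le_of_mem_plausible (rho_pos k₀).le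
        (fun y => (hψ k₀ y).trans (by linarith [rho_pos k₀]))
        (hRk.optimistic ⟨s, hs⟩ a ha).1 (hq k₀ s hs a ha) s'
    · refine mul_rho_le_one (by linarith) ?_
      rw [hk₀r]
      exact Int.le_ceil _
  have hex : ∃ N, 1 ≤ N ∧ E.StopTest α η ε cmax (rho N) (R N) := ⟨k₀, hk₀1, htest⟩
  obtain ⟨hN1, hNtest⟩ := Nat.find_spec hex
  have hNmin : ∀ k, 1 ≤ k → k < Nat.find hex → ¬ E.StopTest α η ε cmax (rho k) (R k) :=
    fun k hk hlt h => Nat.find_min hex hlt ⟨hk, h⟩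
  have hNk : Nat.find hex ≤ k₀ := Nat.find_min' hex ⟨hk₀1, htest⟩
  set N := Nat.find hex
  have hpass : E.IsPass α β δ η ε (sampleSize S Act δ n₀ N)
      (empirical (fun s a i => X s a i ω) (sampleSize S Act δ n₀ N)) (R N) := hR N hN1
  refine ⟨N, hN1, hNmin, hNtest, by omega, ?_, fun πA hπA s hs => ?_, fun s hs => ?_⟩
  · have hNr : (N : ℝ) ≤ Real.logb 2 (6 * Y) + 1 := by
      have h1 : (N : ℝ) ≤ k₀ := by exact_mod_cast hNk
      have h2 := Int.ceil_lt_add_one (Real.logb 2 (6 * Y))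
      linarith
    -- The first success comes no later than `k₀ < log₂ (6 Y) + 1`, so `ρ` has not fallen below `1 /
    -- (12 Y)`, which caps the sample size.
    have hρ := one_div_le_rho (by linarith) hNr
    rw [show 2 * (6 * Y) = 12 * Y by ring] at hρ
    have h3 := psiInv_le (S := S) (Act := Act) hδ hδ₁ hY hρ (rho_le_half hN1)
    refine le_trans ?_ h3
    unfold sampleSize
    rw [Nat.cast_max, sub_le_iff_le_add]
    exact max_le (by linarith [(Nat.cast_nonneg (psiInv S Act δ (rho N)) : (0 : ℝ) ≤ _)])
      (by linarith [(Nat.cast_nonneg n₀ : (0 : ℝ) ≤ n₀)])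
  · have h1 := hπA.2 _ hpass.isPolicy s hs
    have h2 := hpass.gain_lt hβ hα₀ hα hη hη₁ hε hc hcost (hq N) (W := |W|) (fun i j => by
      obtain ⟨l, -, hv', -, -⟩ := hpass.iterates
      rw [hv']
      exact (hW _ _ _ (hq N) _ i j).trans (le_abs_self W)) hηW (rho_pos N).le (hψ N) hNtest
      hπA.1 hs
    rw [abs_lt]
    constructor <;> linarith
  · exact hpass.isPolicy.satProb_eq_one (hpass.isFull hη hη₁) hE.1 hs
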